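/- Let $n\ge 3$, $1<p\le \frac{2n}{n+2}$, $s_{\mathrm c}:=\frac{n(2-p)}{p}$, $s>s_{\mathrm c}$, $0<\lambda\le\Lambda<\infty$ and $K>0$. There is a constant $C>0$, depending only on $n,p,s,\lambda,\Lambda,K$, with the following property. Let $E_1,E_p:\mathbb R^n\to[0,\infty)$ be convex functions such that $E_1\in C^0(\mathbb R^n)\cap C^2(\mathbb R^n\setminus\{0\})$, $E_p\in C^1(\mathbb R^n)\cap C^2(\mathbb R^n\setminus\{0\})$, $E_1(kz)=kE_1(z)$ for all $k>0$ and $z\in\mathbb R^n$, $|\nabla E_p(z)|\le\Lambda|z|^{p-1}$ for all $z\in\mathbb R^n$, and $\lambda|z|^{p-2}\mathrm{id}_n\leqslant\nabla^2E_p(z)\leqslant\Lambda|z|^{p-2}\mathrm{id}_n$ for all $z\ne0$. Let $K$ be such that $|\zeta|\le K$ for every $z\in\mathbb R^n$ and every $\zeta$ in the subdifferential $\partial E_1(z)$. Let $\Omega\subset\mathbb R^n$ be a bounded open set, $T>0$, $\Omega_T:=\Omega\times(0,T)$, $p':=p/(p-1)$, $V:=W^{1,p}(\Omega)\cap L^2(\Omega)$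 and $V_0:=W^{1,p}_0(\Omega)\cap L^2(\Omega)$, and let $V_0'$ be the continuous dual of $V_0$. Let $u$ be a weak solution of $\partial_tu-\operatorname{div}(\nabla(E_1+E_p)(\nabla u))=0$ in $\Omega_T$. That is, $u\in L^p(0,T;V)\cap C^0([0,T];L^2(\Omega))$ with $\partial_tu\in L^{p'}(0,T;V_0')$, and there is a $Z\in L^\infty(\Omega_T;\mathbb R^n)$ with $Z\in\partial E_1(\nabla u)$ a.e. in $\Omega_T$ and $$\int_0^T\langle\partial_tu,\varphi\rangle_{V_0',V_0}\,dt+\iint_{\Omega_T}\langle Z+\nabla E_p(\nabla u)\mid\nabla\varphi\rangle\,dx\,dt=0$$ for all $\varphi\in L^p(0,T;V_0)$ with $\partial_t\varphi\in L^{p'}(0,T;V_0')$. Suppose that $u\in L^s_{\mathrm{loc}}(\Omega_T)$. Then, for every parabolic cylinder $Q_R=Q_R(x_0,t_0):=B_R(x_0)\times(t_0-R^2,t_0]$ with $R\in(0,1)$ and $\overline{Q_R}\subset\Omega_T$, $$\|u\|_{L^\infty(Q_{R/2})}\le C\left(R^{-s_{\mathrm c}}\,\frac1{|Q_R|}\iint_{Q_R}(|u|+1)^s\,dx\,dt\right)^{1/(s-s_{\mathrm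 c})},$$ where $Q_{R/2}=Q_{R/2}(x_0,t_0)$. -/

import Mathlib

open MeasureTheory Set Filter Topology
open scoped ENNReal ContDiff

noncomputable section

namespace OnePLaplace

/-- The Euclidean space `ℝⁿ`. -/
abbrev Eucl (n : ℕ) := EuclideanSpace ℝ (Fin n)

/-! ### Sobolev spaces -/

/-- `φ` is a `C^k` function with compact support contained in `Ω`. -/
def IsTest {X : Type*} [NormedAddCommGroup X] [NormedSpace ℝ X] (k : WithTop ℕ∞)
    (Ω : Set X) (φ : X → ℝ) : Prop :=
  ContDiff ℝ k φ ∧ HasCompactSupport φ ∧ tsupport φ ⊆ Ω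

/-- `f ∈ W^{1,q}(Ω)`, with weak gradient `g`. -/
def MemW {n : ℕ} (Ω : Set (Eucl n)) (q : ℝ≥0∞) (f : Eucl n → ℝ) (g : Eucl n → Eucl n) : Prop :=
  MemLp f q (volume.restrict Ω) ∧ MemLp g q (volume.restrict Ω) ∧
    ∀ φ : Eucl n → ℝ, IsTest ∞ Ω φ →
      ∫ x in Ω, f x • gradient φ x = - ∫ x in Ω, φ x • g x

/-- `f ∈ W₀^{1,q}(Ω)`, with weak gradient `g`: the pair is the limit in `W^{1,q}(Ω)` of
functions of class `C¹` with compact support in `Ω`. -/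
def MemWZero {n : ℕ} (Ω : Set (Eucl n)) (q : ℝ≥0∞) (f : Eucl n → ℝ) (g : Eucl n → Eucl n) :
    Prop :=
  MemW Ω q f g ∧ ∃ φ : ℕ → Eucl n → ℝ, (∀ k, IsTest 1 Ω (φ k)) ∧
    Tendsto (fun k => eLpNorm (f - φ k) q (volume.restrict Ω)) atTop (𝓝 0) ∧
    Tendsto (fun k => eLpNorm (g - gradient (φ k)) q (volume.restrict Ω)) atTop (𝓝 0)

lemma IsTest.add {X : Type*} [NormedAddCommGroup X] [NormedSpace ℝ X] {k : WithTop ℕ∞}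
    {Ω : Set X} {φ ψ : X → ℝ} (hφ : IsTest k Ω φ) (hψ : IsTest k Ω ψ) : IsTest k Ω (φ + ψ) :=
  ⟨hφ.1.add hψ.1, hφ.2.1.add hψ.2.1,
    (tsupport_add φ ψ).trans (union_subset hφ.2.2 hψ.2.2)⟩

lemma IsTest.smul {X : Type*} [NormedAddCommGroup X] [NormedSpace ℝ X] {k : WithTop ℕ∞}
    {Ω : Set X} {φ : X → ℝ} (hφ : IsTest k Ω φ) (c : ℝ) : IsTest k Ω (c • φ) := by
  have h : tsupport (c • φ) ⊆ tsupport φ :=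
    closure_mono (Function.support_const_smul_subset c φ)
  exact ⟨contDiff_const.smul hφ.1, hφ.2.1.of_isClosed_subset (isClosed_tsupport _) h,
    h.trans hφ.2.2⟩

section
variable {n : ℕ} {Ω : Set (Eucl n)} {q : ℝ≥0∞} {f f' : Eucl n → ℝ} {g g' : Eucl n → Eucl n}

lemma IsTest.continuous_gradient {k : WithTop ℕ∞} (hk : 1 ≤ k) {φ : Eucl n → ℝ}
    (hφ : IsTest k Ω φ) : Continuous (gradient φ) :=
  (InnerProductSpace.toDual ℝ (Eucl n)).symm.continuous.comp
    (hφ.1.continuous_fderiv (by intro h; simp [h] at hk))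

lemma IsTest.hasCompactSupport_gradient {k : WithTop ℕ∞} {φ : Eucl n → ℝ}
    (hφ : IsTest k Ω φ) : HasCompactSupport (gradient φ) :=
  (hφ.2.1.fderiv (𝕜 := ℝ)).comp_left (map_zero (InnerProductSpace.toDual ℝ (Eucl n)).symm)

lemma gradient_add_fun {φ ψ : Eucl n → ℝ} (hφ : Differentiable ℝ φ) (hψ : Differentiable ℝ ψ) :
    gradient (φ + ψ) = gradient φ + gradient ψ := by
  ext1 x
  simp [gradient, fderiv_add (hφ x) (hψ x)]

lemma gradient_smul_fun {φ : Eucl n → ℝ} (c : ℝ) (hφ : Differentiable ℝ φ) :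
    gradient (c • φ) = c • gradient φ := by
  ext1 x
  simp [gradient, fderiv_const_smul (hφ x)]

lemma MemW.congr (h : MemW Ω q f g) (hf : f =ᵐ[volume.restrict Ω] f')
    (hg : g =ᵐ[volume.restrict Ω] g') : MemW Ω q f' g' := by
  refine ⟨h.1.ae_eq hf, h.2.1.ae_eq hg, fun φ hφ => ?_⟩
  have e1 : ∫ x in Ω, f' x • gradient φ x = ∫ x in Ω, f x • gradient φ x :=
    integral_congr_ae (hf.mono fun x hx => by simp only [hx])
  have e2 : ∫ x in Ω, φ x • g' x = ∫ x in Ω, φ x • g x :=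
    integral_congr_ae (hg.mono fun x hx => by simp only [hx])
  rw [e1, e2, h.2.2 φ hφ]

lemma MemW.add (hq : 1 ≤ q) (h : MemW Ω q f g) (h' : MemW Ω q f' g') :
    MemW Ω q (f + f') (g + g') := by
  refine ⟨h.1.add h'.1, h.2.1.add h'.2.1, fun φ hφ => ?_⟩
  have c1 := hφ.continuous_gradient (by norm_cast)
  have c2 := hφ.hasCompactSupport_gradient
  have e := (h.1.locallyIntegrable hq).integrable_smul_right_of_hasCompactSupport c1 c2
  have e' := (h'.1.locallyIntegrable hq).integrable_smul_right_of_hasCompactSupport c1 c2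
  have d := (h.2.1.locallyIntegrable hq).integrable_smul_left_of_hasCompactSupport
    hφ.1.continuous hφ.2.1
  have d' := (h'.2.1.locallyIntegrable hq).integrable_smul_left_of_hasCompactSupport
    hφ.1.continuous hφ.2.1
  simp only [Pi.add_apply, add_smul, smul_add]
  rw [integral_add e e', integral_add d d', h.2.2 φ hφ, h'.2.2 φ hφ, neg_add]

lemma MemW.smul (h : MemW Ω q f g) (c : ℝ) : MemW Ω q (c • f) (c • g) := by
  refine ⟨h.1.const_smul c, h.2.1.const_smul c, fun φ hφ => ?_⟩
  simp only [Pi.smul_apply, smul_eq_mul, mul_smul, smul_comm _ c]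
  rw [integral_smul, integral_smul, h.2.2 φ hφ, smul_neg]

lemma memW_zero : MemW Ω q (0 : Eucl n → ℝ) (0 : Eucl n → Eucl n) :=
  ⟨MemLp.zero, MemLp.zero, fun φ _ => by simp⟩

lemma MemWZero.congr (h : MemWZero Ω q f g) (hf : f =ᵐ[volume.restrict Ω] f')
    (hg : g =ᵐ[volume.restrict Ω] g') : MemWZero Ω q f' g' := by
  obtain ⟨h1, φ, h2, h3, h4⟩ := h
  refine ⟨h1.congr hf hg, φ, h2, ?_, ?_⟩
  · refine h3.congr fun k => eLpNorm_congr_ae (hf.mono fun x hx => by simp [hx])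
  · refine h4.congr fun k => eLpNorm_congr_ae (hg.mono fun x hx => by simp [hx])

lemma memWZero_zero : MemWZero Ω q (0 : Eucl n → ℝ) (0 : Eucl n → Eucl n) := by
  have h0 : gradient (0 : Eucl n → ℝ) = 0 := by
    ext1 x
    simp [gradient]
  refine ⟨memW_zero, fun _ => 0, fun _ => ⟨contDiff_const, HasCompactSupport.zero, ?_⟩, ?_, ?_⟩
  · simp [tsupport]
  · simp
  · simp [h0]

lemma MemWZero.add (hq : 1 ≤ q) (h : MemWZero Ω q f g) (h' : MemWZero Ω q f' g') :
    MemWZero Ω q (f + f') (g + g') := by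
  obtain ⟨h1, φ, h2, h3, h4⟩ := h
  obtain ⟨h1', φ', h2', h3', h4'⟩ := h'
  have m {k} : AEStronglyMeasurable (φ k) (volume.restrict Ω) :=
    (h2 k).1.continuous.aestronglyMeasurable
  have m' {k} : AEStronglyMeasurable (φ' k) (volume.restrict Ω) :=
    (h2' k).1.continuous.aestronglyMeasurable
  have l {k} : AEStronglyMeasurable (gradient (φ k)) (volume.restrict Ω) :=
    ((h2 k).continuous_gradient le_rfl).aestronglyMeasurable
  have l' {k} : AEStronglyMeasurable (gradient (φ' k)) (volume.restrict Ω) :=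
    ((h2' k).continuous_gradient le_rfl).aestronglyMeasurable
  refine ⟨h1.add hq h1', fun k => φ k + φ' k, fun k => (h2 k).add (h2' k), ?_, ?_⟩
  · refine tendsto_of_tendsto_of_tendsto_of_le_of_le tendsto_const_nhds
      (by simpa using h3.add h3') (fun _ => zero_le) fun k => ?_
    rw [add_sub_add_comm]
    exact eLpNorm_add_le (h1.1.1.sub m) (h1'.1.1.sub m') hq
  · refine tendsto_of_tendsto_of_tendsto_of_le_of_le tendsto_const_nhds
      (by simpa using h4.add h4') (fun _ => zero_le) fun k => ?_
    dsimp only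
    rw [gradient_add_fun ((h2 k).1.differentiable one_ne_zero)
      ((h2' k).1.differentiable one_ne_zero), add_sub_add_comm]
    exact eLpNorm_add_le (h1.2.1.1.sub l) (h1'.2.1.1.sub l') hq

lemma MemWZero.smul (h : MemWZero Ω q f g) (c : ℝ) : MemWZero Ω q (c • f) (c • g) := by
  obtain ⟨h1, φ, h2, h3, h4⟩ := h
  refine ⟨h1.smul c, fun k => c • φ k, fun k => (h2 k).smul c, ?_, ?_⟩
  · simp only [← smul_sub, eLpNorm_const_smul]
    simpa using ENNReal.Tendsto.const_mul h3 (Or.inr enorm_ne_top)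
  · simp only [gradient_smul_fun c ((h2 _).1.differentiable one_ne_zero), ← smul_sub,
      eLpNorm_const_smul]
    simpa using ENNReal.Tendsto.const_mul h4 (Or.inr enorm_ne_top)

end

/-- `L²(Ω)`. -/
abbrev LTwo {n : ℕ} (Ω : Set (Eucl n)) := Lp ℝ 2 (volume.restrict Ω)

/-- `W^{1,q}(Ω) ∩ L²(Ω)`, as the space of the pairs `(v, ∇v)` in `L²(Ω) × L^q(Ω; ℝⁿ)`. -/
def submoduleV {n : ℕ} (Ω : Set (Eucl n)) (q : ℝ≥0∞) [Fact (1 ≤ q)] :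
    Submodule ℝ (LTwo Ω × Lp (Eucl n) q (volume.restrict Ω)) where
  carrier := {v | MemW Ω q v.1 v.2}
  zero_mem' := memW_zero.congr (Lp.coeFn_zero _ _ _).symm (Lp.coeFn_zero _ _ _).symm
  add_mem' {v w} hv hw := (MemW.add Fact.out hv hw).congr (Lp.coeFn_add v.1 w.1).symm
    (Lp.coeFn_add v.2 w.2).symm
  smul_mem' c v hv := (MemW.smul hv c).congr (Lp.coeFn_smul c v.1).symm
    (Lp.coeFn_smul c v.2).symm

/-- `W₀^{1,q}(Ω) ∩ L²(Ω)`, as the space of the pairs `(v, ∇v)` in `L²(Ω) × L^q(Ω; ℝⁿ)`. -/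
def submoduleVZero {n : ℕ} (Ω : Set (Eucl n)) (q : ℝ≥0∞) [Fact (1 ≤ q)] :
    Submodule ℝ (LTwo Ω × Lp (Eucl n) q (volume.restrict Ω)) where
  carrier := {v | MemWZero Ω q v.1 v.2}
  zero_mem' := memWZero_zero.congr (Lp.coeFn_zero _ _ _).symm (Lp.coeFn_zero _ _ _).symm
  add_mem' {v w} hv hw := (MemWZero.add Fact.out hv hw).congr (Lp.coeFn_add v.1 w.1).symm
    (Lp.coeFn_add v.2 w.2).symm
  smul_mem' c v hv := (MemWZero.smul hv c).congr (Lp.coeFn_smul c v.1).symm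
    (Lp.coeFn_smul c v.2).symm

/-- The normed space `V = W^{1,q}(Ω) ∩ L²(Ω)`.  For bounded `Ω` and `q ≤ 2`, the norm inherited
from the product, `max ‖v‖_{L²} ‖∇v‖_{L^q}`, is equivalent to `‖v‖_{W^{1,q}} + ‖v‖_{L²}`. -/
def V {n : ℕ} (Ω : Set (Eucl n)) (q : ℝ≥0∞) [Fact (1 ≤ q)] : Type := ↥(submoduleV Ω q)

/-- The normed space `V₀ = W₀^{1,q}(Ω) ∩ L²(Ω)`.  The norm inherited from the product,
`max ‖v‖_{L²} ‖∇v‖_{L^q}`, is equivalent to `‖∇v‖_{L^q} + ‖v‖_{L²}`. -/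
def VZero {n : ℕ} (Ω : Set (Eucl n)) (q : ℝ≥0∞) [Fact (1 ≤ q)] : Type := ↥(submoduleVZero Ω q)

section
variable {n : ℕ} {Ω : Set (Eucl n)} {q : ℝ≥0∞} [Fact (1 ≤ q)]

instance : NormedAddCommGroup (V Ω q) := inferInstanceAs (NormedAddCommGroup (submoduleV Ω q))

instance : NormedSpace ℝ (V Ω q) := inferInstanceAs (NormedSpace ℝ (submoduleV Ω q))

instance : NormedAddCommGroup (VZero Ω q) :=
  inferInstanceAs (NormedAddCommGroup (submoduleVZero Ω q))

instance : NormedSpace ℝ (VZero Ω q) := inferInstanceAs (NormedSpace ℝ (submoduleVZero Ω q))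

/-- The continuous dual space `V₀'` with the dual norm. -/
def VZeroDual {n : ℕ} (Ω : Set (Eucl n)) (q : ℝ≥0∞) [Fact (1 ≤ q)] : Type :=
  StrongDual ℝ (VZero Ω q)

instance : NormedAddCommGroup (VZeroDual Ω q) :=
  inferInstanceAs (NormedAddCommGroup (StrongDual ℝ (VZero Ω q)))

instance : NormedSpace ℝ (VZeroDual Ω q) :=
  inferInstanceAs (NormedSpace ℝ (StrongDual ℝ (VZero Ω q)))

/-- The duality pairing `⟨w, v⟩` of `V₀'` and `V₀`. -/
def VZeroDual.pairing (w : VZeroDual Ω q) (v : VZero Ω q) : ℝ :=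
  (show StrongDual ℝ (VZero Ω q) from w) v

/-- `v ∈ V` as an element of `L²(Ω)`. -/
def V.fn (v : V Ω q) : LTwo Ω := v.1.1

/-- The weak gradient of `v ∈ V`. -/
def V.grad (v : V Ω q) : Lp (Eucl n) q (volume.restrict Ω) := v.1.2

/-- `v ∈ V₀` as an element of `L²(Ω)`. -/
def VZero.fn (v : VZero Ω q) : LTwo Ω := v.1.1

/-- The weak gradient of `v ∈ V₀`. -/
def VZero.grad (v : VZero Ω q) : Lp (Eucl n) q (volume.restrict Ω) := v.1.2

end

/-! ### Parabolic function spaces -/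

/-- Lebesgue measure on the time interval `(0, T)`. -/
abbrev timeMeasure (T : ℝ) : Measure ℝ := volume.restrict (Ioo 0 T)

/-- The space-time cylinder `Ω_T = Ω × (0, T)`. -/
abbrev spaceTime {n : ℕ} (Ω : Set (Eucl n)) (T : ℝ) : Set (Eucl n × ℝ) := Ω ×ˢ Ioo 0 T

/-- `w = ∂ₜ u` as a `V₀'`-valued distribution on `(0, T)`, where `L²(Ω) ⊆ V₀'` through
`v ↦ (u, v)_{L²}`. -/
def HasTimeDeriv {n : ℕ} (Ω : Set (Eucl n)) (q : ℝ≥0∞) [Fact (1 ≤ q)] (T : ℝ)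
    (u : ℝ → LTwo Ω) (w : ℝ → VZeroDual Ω q) : Prop :=
  ∀ ζ : ℝ → ℝ, IsTest ∞ (Ioo 0 T) ζ → ∀ v : VZero Ω q,
    ∫ t, deriv ζ t * inner ℝ (u t) v.fn ∂(timeMeasure T) =
      - ∫ t, ζ t * (w t).pairing v ∂(timeMeasure T)

/-- `u ∈ X^p(0, T; Ω)` with `∂ₜ u = w`: here `u ∈ L^p(0, T; V)` and
`∂ₜ u ∈ L^{p'}(0, T; V₀')`. -/
def MemX {n : ℕ} (Ω : Set (Eucl n)) (p T : ℝ) [Fact (1 ≤ ENNReal.ofReal p)]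
    (u : ℝ → V Ω (ENNReal.ofReal p))
    (w : ℝ → VZeroDual Ω (ENNReal.ofReal p)) : Prop :=
  MemLp u (ENNReal.ofReal p) (timeMeasure T) ∧
    MemLp w (ENNReal.ofReal p.conjExponent) (timeMeasure T) ∧
    HasTimeDeriv Ω (ENNReal.ofReal p) T (fun t => (u t).fn) w

/-- `φ ∈ X₀^p(0, T; Ω)`: here `φ ∈ L^p(0, T; V₀)` and `∂ₜ φ ∈ L^{p'}(0, T; V₀')`. -/
def MemXZero {n : ℕ} (Ω : Set (Eucl n)) (p T : ℝ) [Fact (1 ≤ ENNReal.ofReal p)]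
    (φ : ℝ → VZero Ω (ENNReal.ofReal p)) : Prop :=
  MemLp φ (ENNReal.ofReal p) (timeMeasure T) ∧
    ∃ w : ℝ → VZeroDual Ω (ENNReal.ofReal p),
      MemLp w (ENNReal.ofReal p.conjExponent) (timeMeasure T) ∧
      HasTimeDeriv Ω (ENNReal.ofReal p) T (fun t => (φ t).fn) w

/-- `u` agrees almost everywhere on `(0, T)` with an element of `C⁰([0, T]; L²(Ω))`. -/
def MemCLTwo {n : ℕ} (Ω : Set (Eucl n)) (T : ℝ) (u : ℝ → LTwo Ω) : Prop :=
  ∃ c : ℝ → LTwo Ω, ContinuousOn c (Icc 0 T) ∧ c =ᵐ[timeMeasure T] u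

/-- The measurable function `f` on `Ω_T` represents the curve `F` of functions on `Ω`:
`f(·, t) = F(t)` a.e. in `Ω`, for a.e. `t ∈ (0, T)`. -/
def Represents {n : ℕ} {G : Type*} [NormedAddCommGroup G] (Ω : Set (Eucl n)) (T : ℝ)
    (f : Eucl n × ℝ → G) (F : ℝ → Eucl n → G) : Prop :=
  AEStronglyMeasurable f (volume.restrict (spaceTime Ω T)) ∧
    ∀ᵐ t ∂(timeMeasure T), (fun x => f (x, t)) =ᵐ[volume.restrict Ω] F t

/-! ### The equation -/

/-- The subdifferential of `E₁` at `z`. -/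
def subdifferential {n : ℕ} (E₁ : Eucl n → ℝ) (z : Eucl n) : Set (Eucl n) :=
  {ζ | ∀ w, E₁ z + inner ℝ ζ (w - z) ≤ E₁ w}

/-- The structural assumptions on the convex energy densities: `E₁` is positively
one-homogeneous, and `E_p` has `p`-growth with the ellipticity constants `lam ≤ Lam`. -/
structure IsDensityPair {n : ℕ} (p lam Lam : ℝ) (E₁ Ep : Eucl n → ℝ) : Prop where
  nonneg_one : ∀ z, 0 ≤ E₁ z
  nonneg_p : ∀ z, 0 ≤ Ep z
  convex_one : ConvexOn ℝ univ E₁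
  convex_p : ConvexOn ℝ univ Ep
  continuous_one : Continuous E₁
  contDiffOn_one : ContDiffOn ℝ 2 E₁ {0}ᶜ
  contDiff_p : ContDiff ℝ 1 Ep
  contDiffOn_p : ContDiffOn ℝ 2 Ep {0}ᶜ
  homogeneous : ∀ (k : ℝ) (z : Eucl n), 0 < k → E₁ (k • z) = k * E₁ z
  gradient_bound : ∀ z, ‖gradient Ep z‖ ≤ Lam * ‖z‖ ^ (p - 1)
  hessian_lower : ∀ z ≠ 0, ∀ ξ,
    lam * ‖z‖ ^ (p - 2) * ‖ξ‖ ^ 2 ≤ inner ℝ (fderiv ℝ (gradient Ep) z ξ) ξ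
  hessian_upper : ∀ z ≠ 0, ∀ ξ,
    inner ℝ (fderiv ℝ (gradient Ep) z ξ) ξ ≤ Lam * ‖z‖ ^ (p - 2) * ‖ξ‖ ^ 2

/-- `u` is a weak solution of `∂ₜ u - div (∇(E₁ + E_p)(∇u)) = 0` in `Ω_T`: here `U` is `u` as a
curve in `V`, `w = ∂ₜ u`, and `Du`, `Z` are the spatial gradient of `u` and the vector field with
values in the subdifferential of `E₁`, as functions on `Ω_T`. -/
def IsWeakSolution {n : ℕ} (Ω : Set (Eucl n)) (p T : ℝ) [Fact (1 ≤ ENNReal.ofReal p)]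
    (E₁ Ep : Eucl n → ℝ) (u : Eucl n × ℝ → ℝ) : Prop :=
  ∃ (U : ℝ → V Ω (ENNReal.ofReal p)) (w : ℝ → VZeroDual Ω (ENNReal.ofReal p))
    (Du Z : Eucl n × ℝ → Eucl n),
    MemX Ω p T U w ∧ MemCLTwo Ω T (fun t => (U t).fn) ∧
    Represents Ω T u (fun t => (U t).fn) ∧ Represents Ω T Du (fun t => (U t).grad) ∧
    MemLp Z ⊤ (volume.restrict (spaceTime Ω T)) ∧
    (∀ᵐ y ∂(volume.restrict (spaceTime Ω T)), Z y ∈ subdifferential E₁ (Du y)) ∧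
    ∀ φ : ℝ → VZero Ω (ENNReal.ofReal p), MemXZero Ω p T φ →
      ∫ t, (w t).pairing (φ t) ∂(timeMeasure T) +
        ∫ t, (∫ x in Ω, inner ℝ (Z (x, t) + gradient Ep (Du (x, t))) ((φ t).grad x))
          ∂(timeMeasure T) = 0

/-- `u ∈ L^s_loc(A)`: `u ∈ L^s(K)` for every compact `K ⊆ A`. -/
def MemLpLoc {n : ℕ} (u : Eucl n × ℝ → ℝ) (s : ℝ) (A : Set (Eucl n × ℝ)) : Prop :=
  ∀ K ⊆ A, IsCompact K → MemLp u (ENNReal.ofReal s) (volume.restrict K)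

/-- The parabolic cylinder `Q_R(x₀, t₀) = B_R(x₀) × (t₀ - R², t₀]`. -/
def cylinder {n : ℕ} (R : ℝ) (x₀ : Eucl n) (t₀ : ℝ) : Set (Eucl n × ℝ) :=
  Metric.ball x₀ R ×ˢ Ioc (t₀ - R ^ 2) t₀

end OnePLaplace

end

open OnePLaplace

noncomputable section

namespace OnePLaplace


/-! The proof is a Moser iteration on powers of $w=1+u^2$. Test the equation with $u\,T(u)^m\eta^2$,
where $T$ is a smooth bounded truncation of $w$ and $\eta$ a spatial cutoff. One-homogeneity gives
$\langle\zeta\mid z\rangle\ge0$ for $\zeta\in\partial E_1(z)$, so $E_1$ cannot spoil the coercivity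
$\lambda|\nabla u|^p$ of $E_p$. The growth terms $K|u|$ and $|u|^p$ are both controlled by $w$,
because $p<2$. This gives bounds for $\sup_t\int wT^m$ and $\iint T^m|\nabla u|^p$ on a smaller
cylinder by $\iint wT^m$ on a larger one (`energy_cutoff_le`, `energy_average_le`).

No chain rule for $\partial_tu$ is used. Since $\Psi(s)=sT(s)^m$ is nondecreasing with convex
primitive $\Phi$, $\Phi(u(t))-\Phi(u(t-h))\le\Psi(u(t))(u(t)-u(t-h))$. The right side is evaluated
by testing the equation, integrated over $(t-h,t)$, with the frozen slice $\Psi(u(t))\eta^2\in V_0$.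
Integrating in $t$, dividing by $h$ and using continuity of translations in $L^{p'}$ gives
`energy_le`.

On almost every time slice the Sobolev inequality applies to $\sqrt w\,T^{m/p}\eta^2$. Hölder's
inequality combines it with the supremum in time, and letting the truncation tend to infinity yields
`exists_gain_const`: with $\kappa=1+p/n$, a bound on $\iint w^{\sigma/2}$ becomes a bound on $\iint
w^{(\kappa\sigma-(2-p))/2}$. The map $\sigma\mapsto\kappa\sigma-(2-p)$ has the repelling fixed point
$s_{\mathrm c}=n(2-p)/p$, so the exponents $\sigma_k=s_{\mathrm c}+\kappa^k(s-s_{\mathrm c})$ tend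
to infinity exactly when $s>s_{\mathrm c}$. The condition $p\le 2n/(n+2)$ means $s_{\mathrm c}\ge2$,
which keeps $m=\sigma/2-1\ge0$ throughout.

The iteration itself is `le_of_superlinear_iteration`, applied in `ae_abs_le_of_gain`. The exponent
$1/(s-s_{\mathrm c})$ is the limit of $\kappa^k/\sigma_k$, and the factor $R^{-s_{\mathrm c}}$
follows from $2\kappa/(\kappa-1)=s_{\mathrm c}+n+2$, where $R^{n+2}$ is the scale of $|Q_R|$
(`iteration_value_eq`). -/

/-! ### Truncated powers of `1 + s²` -/

/-- A bounded smooth truncation of `1 + s²`. -/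
def trunc (M s : ℝ) : ℝ := (1 + s ^ 2) * M / (M + (1 + s ^ 2))

/-- The logarithmic derivative of `trunc M`. -/
def truncLog (M s : ℝ) : ℝ := 2 * s * M / ((1 + s ^ 2) * (M + (1 + s ^ 2)))

section
variable {M : ℝ} (hM : 0 < M) (s : ℝ)
include hM

lemma trunc_pos : 0 < trunc M s := by unfold trunc; positivity

lemma trunc_le_left : trunc M s ≤ M := by
  unfold trunc
  rw [div_le_iff₀ (by positivity)]
  nlinarith [sq_nonneg s]

lemma trunc_le_right : trunc M s ≤ 1 + s ^ 2 := by
  unfold trunc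
  rw [div_le_iff₀ (by positivity)]
  nlinarith [sq_nonneg s, sq_nonneg (1 + s ^ 2)]

lemma truncLog_mul_self_nonneg : 0 ≤ s * truncLog M s := by
  unfold truncLog
  rw [← mul_div_assoc, show s * (2 * s * M) = 2 * s ^ 2 * M by ring]
  positivity

lemma truncLog_mul_self_le : s * truncLog M s ≤ 2 := by
  unfold truncLog
  rw [← mul_div_assoc, div_le_iff₀ (by positivity)]
  nlinarith [sq_nonneg s, mul_nonneg (sq_nonneg s) (sq_nonneg s), mul_nonneg (sq_nonneg s) hM.le]

lemma one_add_sq_mul_truncLog_le (hs : 0 ≤ s) : (1 + s ^ 2) * truncLog M s ≤ 2 * s := by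
  unfold truncLog
  rw [← mul_div_assoc, mul_div_mul_left _ _ (by positivity)]
  rw [div_le_iff₀ (by positivity)]
  nlinarith [mul_nonneg hs (sq_nonneg s)]

lemma hasDerivAt_trunc : HasDerivAt (trunc M) (trunc M s * truncLog M s) s := by
  have h1 : HasDerivAt (fun s : ℝ => 1 + s ^ 2) (2 * s) s := by
    simpa using (hasDerivAt_pow 2 s).const_add 1
  have h : HasDerivAt (trunc M) _ s := (h1.mul_const M).div (h1.const_add M) (by positivity)
  convert h using 1
  have : M + (1 + s ^ 2) ≠ 0 := by positivity
  unfold trunc truncLog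
  field_simp
  ring

lemma contDiff_trunc {k : WithTop ℕ∞} : ContDiff ℝ k (trunc M) := by
  unfold trunc
  refine ContDiff.div (by fun_prop) (by fun_prop) fun x => ?_
  positivity

lemma contDiff_trunc_rpow (e : ℝ) {k : WithTop ℕ∞} : ContDiff ℝ k (fun s => trunc M s ^ e) :=
  (contDiff_trunc hM).rpow_const_of_ne fun s => (trunc_pos hM s).ne'

lemma hasDerivAt_trunc_rpow (e : ℝ) :
    HasDerivAt (fun s => trunc M s ^ e) (trunc M s ^ e * (e * truncLog M s)) s := by
  convert (hasDerivAt_trunc hM s).rpow_const (p := e) (Or.inl (trunc_pos hM s).ne') using 1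
  rw [Real.rpow_sub_one (trunc_pos hM s).ne']
  have := (trunc_pos hM s).ne'
  field_simp

end

lemma trunc_neg (M s : ℝ) : trunc M (-s) = trunc M s := by simp [trunc]

lemma tendsto_trunc (s : ℝ) : Tendsto (fun k : ℕ => trunc (k + 1) s) atTop (𝓝 (1 + s ^ 2)) := by
  have h : ∀ k : ℕ, trunc (k + 1) s = (1 + s ^ 2) / (1 + (1 + s ^ 2) * (1 / ((k : ℝ) + 1))) := by
    intro k
    have : (k : ℝ) + 1 ≠ 0 := by positivity
    unfold trunc
    field_simp
  simp only [h]
  have := ((tendsto_one_div_add_atTop_nhds_zero_nat (𝕜 := ℝ)).const_mul (1 + s ^ 2)).const_add 1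
  have h2 := tendsto_const_nhds (x := 1 + s ^ 2) |>.div this (by simp)
  simpa [Pi.div_def] using h2

/-- The truncated power used as a test function, `s (1 + s²)^m` in the limit. -/
def testFun (M m s : ℝ) : ℝ := s * trunc M s ^ m

/-- The primitive of `testFun`. -/
def testPrim (M m s : ℝ) : ℝ := ∫ r in (0 : ℝ)..s, testFun M m r

section
variable {M m : ℝ} (hM : 0 < M) (hm : 0 ≤ m)

include hM in
lemma contDiff_testFun {k : WithTop ℕ∞} : ContDiff ℝ k (testFun M m) :=
  contDiff_id.mul (contDiff_trunc_rpow hM m)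

include hM in
lemma hasDerivAt_testFun (s : ℝ) :
    HasDerivAt (testFun M m) (trunc M s ^ m * (1 + m * (s * truncLog M s))) s := by
  have h : HasDerivAt (testFun M m) _ s :=
    (hasDerivAt_id s).mul (hasDerivAt_trunc_rpow hM s m)
  refine h.congr_deriv ?_
  rw [id]
  ring

include hM hm in
lemma le_deriv_testFun (s : ℝ) : trunc M s ^ m ≤ deriv (testFun M m) s := by
  rw [(hasDerivAt_testFun hM s).deriv]
  have := mul_nonneg hm (truncLog_mul_self_nonneg hM s)
  have := (Real.rpow_pos_of_pos (trunc_pos hM s) m).le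
  nlinarith

include hM hm in
lemma deriv_testFun_le (s : ℝ) : deriv (testFun M m) s ≤ M ^ m * (1 + 2 * m) := by
  rw [(hasDerivAt_testFun hM s).deriv]
  have h1 := mul_le_mul_of_nonneg_left (truncLog_mul_self_le hM s) hm
  have h2 := mul_nonneg hm (truncLog_mul_self_nonneg hM s)
  exact mul_le_mul (Real.rpow_le_rpow (trunc_pos hM s).le (trunc_le_left hM s) hm) (by linarith)
    (by linarith) (by positivity)

include hM hm in
lemma abs_deriv_testFun_le (s : ℝ) : |deriv (testFun M m) s| ≤ M ^ m * (1 + 2 * m) := by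
  rw [abs_of_nonneg]
  · exact deriv_testFun_le hM hm s
  · exact (Real.rpow_pos_of_pos (trunc_pos hM s) m).le.trans (le_deriv_testFun hM hm s)

include hM hm in
lemma monotone_testFun : Monotone (testFun M m) :=
  monotone_of_deriv_nonneg ((contDiff_testFun hM).differentiable (n := 1) one_ne_zero) fun s =>
    (Real.rpow_pos_of_pos (trunc_pos hM s) m).le.trans (le_deriv_testFun hM hm s)

include hM in
lemma hasDerivAt_testPrim (s : ℝ) : HasDerivAt (testPrim M m) (testFun M m s) s :=
  intervalIntegral.integral_hasDerivAt_right
    ((contDiff_testFun (k := 0) hM).continuous.intervalIntegrable _ _)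
    ((contDiff_testFun (k := 0) hM).continuous.stronglyMeasurableAtFilter _ _)
    (contDiff_testFun (k := 0) hM).continuous.continuousAt

include hM hm in
-- The primitive is convex because `testFun` is monotone. This one-sided inequality is what replaces
-- the chain rule in time.
lemma testPrim_sub_le (a b : ℝ) : testPrim M m b - testPrim M m a ≤ testFun M m b * (b - a) := by
  have hc := (contDiff_testFun (k := 0) (m := m) hM).continuous
  have h1 : testPrim M m b - testPrim M m a = ∫ r in a..b, testFun M m r := by
    unfold testPrim
    exact intervalIntegral.integral_interval_sub_left (hc.intervalIntegrable _ _)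
      (hc.intervalIntegrable _ _)
  rw [h1]
  rcases le_total a b with h | h
  · refine (intervalIntegral.integral_mono_on h (hc.intervalIntegrable _ _)
      (g := fun _ => testFun M m b)
      (continuous_const.intervalIntegrable _ _) fun x hx => monotone_testFun hM hm hx.2).trans
      (le_of_eq ?_)
    simp [mul_comm]
  · have := intervalIntegral.integral_mono_on (μ := volume) h (f := fun _ => testFun M m b)
      (continuous_const.intervalIntegrable _ _)
      (hc.intervalIntegrable _ _) fun x hx => monotone_testFun hM hm hx.1
    rw [intervalIntegral.integral_symm]
    simp only [intervalIntegral.integral_const, smul_eq_mul] at this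
    nlinarith

lemma testPrim_zero : testPrim M m 0 = 0 := by simp [testPrim]

lemma testFun_zero : testFun M m 0 = 0 := by simp [testFun]

include hM hm in
lemma testPrim_nonneg (s : ℝ) : 0 ≤ testPrim M m s := by
  have := testPrim_sub_le hM hm s 0
  rw [testPrim_zero, testFun_zero] at this
  linarith

include hM hm in
lemma testPrim_le (s : ℝ) : testPrim M m s ≤ (1 + s ^ 2) * trunc M s ^ m := by
  have h := testPrim_sub_le hM hm 0 s
  rw [testPrim_zero, sub_zero, sub_zero, testFun] at h
  have := (Real.rpow_pos_of_pos (trunc_pos hM s) m).le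
  nlinarith

lemma testFun_neg (s : ℝ) : testFun M m (-s) = -testFun M m s := by simp [testFun, trunc_neg]

lemma testPrim_neg (s : ℝ) : testPrim M m (-s) = testPrim M m s := by
  have := intervalIntegral.integral_comp_neg (a := 0) (b := s) (testFun M m)
  simp only [testFun_neg, intervalIntegral.integral_neg, neg_zero] at this
  unfold testPrim
  rw [intervalIntegral.integral_symm, ← this, neg_neg]

include hM hm in
-- By evenness it is enough to take $s\ge0$. There the right side grows faster:
-- $(wT^m)'=T^m(2s+m\,w\,T'/T)\le(2+2m)\,sT^m$, and at $0$ one has $T^m\le1$. The factor does not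
-- depend on $M$, so control of the energy $\int\Phi(u)\eta^2$ controls the density itself.
lemma one_add_sq_mul_trunc_rpow_le (s : ℝ) :
    (1 + s ^ 2) * trunc M s ^ m ≤ 1 + (2 + 2 * m) * testPrim M m s := by
  wlog hs : 0 ≤ s generalizing s
  · simpa [trunc_neg, testPrim_neg] using this (-s) (by linarith)
  have hd : ∀ r : ℝ, HasDerivAt (fun r => 1 + (2 + 2 * m) * testPrim M m r -
      (1 + r ^ 2) * trunc M r ^ m) ((2 + 2 * m) * testFun M m r -
      (2 * r * trunc M r ^ m + (1 + r ^ 2) * (trunc M r ^ m * (m * truncLog M r)))) r := by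
    intro r
    have h1 : HasDerivAt (fun s : ℝ => 1 + s ^ 2) (2 * r) r := by
      simpa using (hasDerivAt_pow 2 r).const_add 1
    exact (((hasDerivAt_testPrim hM r).const_mul _).const_add 1).sub
      (h1.mul (hasDerivAt_trunc_rpow hM r m))
  have hmono := monotoneOn_of_deriv_nonneg (convex_Ici (0 : ℝ))
    (fun r _ => (hd r).continuousAt.continuousWithinAt)
    (fun r _ => (hd r).differentiableAt.differentiableWithinAt) (fun r hr => ?_)
  · have := hmono (mem_Ici.2 le_rfl) (mem_Ici.2 hs) hs
    simp only [testPrim_zero] at this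
    have h1 : trunc M 0 ^ m ≤ 1 :=
      Real.rpow_le_one (trunc_pos hM 0).le (by simpa using trunc_le_right hM 0) hm
    simp only [ne_eq, OfNat.ofNat_ne_zero, not_false_eq_true, zero_pow, add_zero, one_mul] at this
    linarith
  · rw [(hd r).deriv, testFun]
    simp only [interior_Ici, mem_Ioi] at hr
    have h1 := mul_le_mul_of_nonneg_left (one_add_sq_mul_truncLog_le hM r hr.le) hm
    have h2 := mul_le_mul_of_nonneg_left h1 (Real.rpow_pos_of_pos (trunc_pos hM r) m).le
    nlinarith

end

/-- The truncation of `(1 + s²)^{1/2 + e}` to which the Sobolev inequality is applied. -/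
def sobFun (M e s : ℝ) : ℝ := √(1 + s ^ 2) * trunc M s ^ e

section
variable {M e : ℝ} (hM : 0 < M) (he : 0 ≤ e)

include hM in
lemma sobFun_pos (s : ℝ) : 0 < sobFun M e s := by
  have := Real.rpow_pos_of_pos (trunc_pos hM s) e
  unfold sobFun
  positivity

include hM in
lemma contDiff_sobFun {k : WithTop ℕ∞} : ContDiff ℝ k (sobFun M e) := by
  refine ContDiff.mul (ContDiff.sqrt (by fun_prop) fun s => ?_) (contDiff_trunc_rpow hM e)
  positivity

include hM in
lemma hasDerivAt_sobFun (s : ℝ) : HasDerivAt (sobFun M e)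
    (trunc M s ^ e * (s / √(1 + s ^ 2) + e * (√(1 + s ^ 2) * truncLog M s))) s := by
  have h1 : HasDerivAt (fun s : ℝ => 1 + s ^ 2) (2 * s) s := by
    simpa using (hasDerivAt_pow 2 s).const_add 1
  have h2 := h1.sqrt (by positivity)
  have h3 : HasDerivAt (sobFun M e) _ s := h2.mul (hasDerivAt_trunc_rpow hM s e)
  refine h3.congr_deriv ?_
  have : √(1 + s ^ 2) ≠ 0 := by positivity
  field_simp

include hM he in
-- Both $s/\sqrt w$ and $\sqrt w\,T'/T$ are bounded independently of $M$. With $e=m/p$ the $p$-th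
-- power of the bound is a multiple of $T^m$, the weight of $|\nabla u|^p$ in the energy.
lemma abs_deriv_sobFun_le (s : ℝ) :
    |deriv (sobFun M e) s| ≤ (1 + 2 * e) * trunc M s ^ e := by
  rw [(hasDerivAt_sobFun hM s).deriv, abs_mul,
    abs_of_pos (Real.rpow_pos_of_pos (trunc_pos hM s) e), mul_comm]
  refine mul_le_mul_of_nonneg_right ?_ (Real.rpow_pos_of_pos (trunc_pos hM s) e).le
  have hw : 0 < √(1 + s ^ 2) := by positivity
  have hsw : |s| ≤ √(1 + s ^ 2) := Real.abs_le_sqrt (by linarith)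
  have h1 : |s / √(1 + s ^ 2)| ≤ 1 := by
    rw [abs_div, abs_of_pos hw]
    exact (div_le_one hw).2 hsw
  have h2 : |√(1 + s ^ 2) * truncLog M s| ≤ 2 := by
    have : √(1 + s ^ 2) * truncLog M s = (s / √(1 + s ^ 2)) * (2 * (M / (M + (1 + s ^ 2)))) := by
      unfold truncLog
      have h3 := Real.sq_sqrt (show 0 ≤ 1 + s ^ 2 by positivity)
      have : M + (1 + s ^ 2) ≠ 0 := by positivity
      field_simp
      rw [h3]
    rw [this, abs_mul]
    have h4 : |2 * (M / (M + (1 + s ^ 2)))| ≤ 2 := by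
      rw [abs_of_nonneg (by positivity)]
      have : M / (M + (1 + s ^ 2)) ≤ 1 := (div_le_one (by positivity)).2 (by nlinarith)
      linarith
    calc _ ≤ 1 * 2 := mul_le_mul h1 h4 (abs_nonneg _) zero_le_one
      _ = 2 := by norm_num
  calc _ ≤ |s / √(1 + s ^ 2)| + |e * (√(1 + s ^ 2) * truncLog M s)| := abs_add_le _ _
    _ ≤ 1 + e * 2 := by
      rw [abs_mul e, abs_of_nonneg he]
      exact add_le_add h1 (mul_le_mul_of_nonneg_left h2 he)
    _ = 1 + 2 * e := by ring

include hM he in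
-- A Lipschitz bound that only makes the Sobolev chain rule applicable; its dependence on $M$ never
-- enters an estimate.
lemma abs_deriv_sobFun_le_const (s : ℝ) : |deriv (sobFun M e) s| ≤ (1 + 2 * e) * M ^ e :=
  (abs_deriv_sobFun_le hM he s).trans <| mul_le_mul_of_nonneg_left
    (Real.rpow_le_rpow (trunc_pos hM s).le (trunc_le_left hM s) he) (by positivity)

include hM in
lemma sobFun_rpow (p : ℝ) (s : ℝ) :
    sobFun M e s ^ p = (1 + s ^ 2) ^ (p / 2) * trunc M s ^ (e * p) := by
  unfold sobFun
  rw [Real.mul_rpow (by positivity) (Real.rpow_nonneg (trunc_pos hM s).le _), Real.sqrt_eq_rpow,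
    ← Real.rpow_mul (by positivity), ← Real.rpow_mul (trunc_pos hM s).le]
  ring_nf

end


/-! ### Structure of the vector field -/

lemma rpow_sub_one_mul_self {a p : ℝ} (ha : 0 ≤ a) (hp : 1 < p) : a ^ (p - 1) * a = a ^ p := by
  rcases ha.eq_or_lt with rfl | h
  · rw [mul_zero, Real.zero_rpow (by linarith)]
  · rw [Real.rpow_sub_one h.ne', div_mul_cancel₀ _ h.ne']

/-- A form of Young's inequality proved by comparing $e$ with $\varepsilon\eta a$. If $e$ is
smaller, the first term dominates; otherwise $\eta a\le e/\varepsilon$, and $\eta\le\eta^{p-1}$,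
valid since $\eta\le1$ and $p<2$, gives the second term. The weight $\eta^2$ is the one present in
the energy. -/
lemma absorb_le {p η a e ε : ℝ} (hp : 1 < p) (hp2 : p < 2) (h0 : 0 ≤ η) (h1 : η ≤ 1)
    (ha : 0 ≤ a) (he : 0 ≤ e) (hε : 0 < ε) :
    η * a ^ (p - 1) * e ≤ ε * η ^ 2 * a ^ p + ε ^ (1 - p) * e ^ p := by
  have hap : 0 ≤ a ^ (p - 1) := Real.rpow_nonneg ha _
  rcases le_total e (ε * η * a) with h | h
  · have h2 : η * a ^ (p - 1) * e ≤ η * a ^ (p - 1) * (ε * η * a) :=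
      mul_le_mul_of_nonneg_left h (by positivity)
    have h3 : η * a ^ (p - 1) * (ε * η * a) = ε * η ^ 2 * a ^ p := by
      rw [← rpow_sub_one_mul_self ha hp]
      ring
    have h4 : 0 ≤ ε ^ (1 - p) * e ^ p := by positivity
    linarith
  · have h2 : η * a ≤ e / ε := by
      rw [le_div_iff₀ hε]
      linarith
    have h3 : η * a ^ (p - 1) ≤ (e / ε) ^ (p - 1) := by
      refine le_trans ?_ (Real.rpow_le_rpow (by positivity) h2 (by linarith))
      rw [Real.mul_rpow h0 ha]
      refine mul_le_mul_of_nonneg_right ?_ hap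
      calc η = η ^ (1 : ℝ) := (Real.rpow_one η).symm
        _ ≤ η ^ (p - 1) := Real.rpow_le_rpow_of_exponent_ge_of_imp h0 h1 (by linarith)
          (fun _ h => absurd h (by linarith))
    have h4 : (e / ε) ^ (p - 1) * e = ε ^ (1 - p) * e ^ p := by
      rw [Real.div_rpow he hε.le, ← rpow_sub_one_mul_self he hp,
        show (1 - p) = -(p - 1) by ring, Real.rpow_neg hε.le]
      ring
    have h5 := mul_le_mul_of_nonneg_right h3 he
    have h6 : 0 ≤ ε * η ^ 2 * a ^ p := by positivity
    linarith

lemma abs_le_sqrt_one_add_sq (s : ℝ) : |s| ≤ √(1 + s ^ 2) := Real.abs_le_sqrt (by linarith)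

lemma one_add_sq_rpow_half_le {p : ℝ} (hp : p ≤ 2) (s : ℝ) : (1 + s ^ 2) ^ (p / 2) ≤ 1 + s ^ 2 := by
  calc (1 + s ^ 2) ^ (p / 2) ≤ (1 + s ^ 2) ^ (1 : ℝ) :=
        Real.rpow_le_rpow_of_exponent_le (by nlinarith [sq_nonneg s]) (by linarith)
    _ = _ := Real.rpow_one _

lemma abs_rpow_le_one_add_sq {p : ℝ} (hp0 : 0 ≤ p) (hp : p ≤ 2) (s : ℝ) :
    |s| ^ p ≤ 1 + s ^ 2 := by
  refine le_trans (Real.rpow_le_rpow (abs_nonneg s) (abs_le_sqrt_one_add_sq s) hp0) ?_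
  rw [Real.sqrt_eq_rpow, ← Real.rpow_mul (by positivity), one_div_mul_eq_div]
  exact one_add_sq_rpow_half_le hp s

section
variable {n : ℕ} {p lam Lam K : ℝ} {E₁ Ep : Eucl n → ℝ} (hE : IsDensityPair p lam Lam E₁ Ep)

include hE

/-- Compare $z$ with the origin in the subgradient inequality; homogeneity forces $E_1(0)=0$. -/
lemma inner_subdifferential_nonneg {z ζ : Eucl n} (h : ζ ∈ subdifferential E₁ z) :
    0 ≤ inner ℝ ζ z := by
  have h0 : E₁ 0 = 0 := by
    have := hE.homogeneous 2 0 two_pos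
    rw [smul_zero] at this
    linarith
  have h1 := h 0
  rw [zero_sub, inner_neg_right, h0] at h1
  linarith [hE.nonneg_one z]

lemma continuous_gradient_density : Continuous (gradient Ep) :=
  (InnerProductSpace.toDual ℝ (Eucl n)).symm.continuous.comp
    (hE.contDiff_p.continuous_fderiv one_ne_zero)

lemma differentiableAt_gradient_density {z : Eucl n} (hz : z ≠ 0) :
    DifferentiableAt ℝ (gradient Ep) z := by
  have h1 : ContDiffOn ℝ 1 (fderiv ℝ Ep) {0}ᶜ :=
    hE.contDiffOn_p.fderiv_of_isOpen isOpen_compl_singleton (by norm_num)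
  have h2 : DifferentiableAt ℝ (fderiv ℝ Ep) z :=
    (h1.differentiableOn one_ne_zero).differentiableAt (isOpen_compl_singleton.mem_nhds hz)
  exact ((InnerProductSpace.toDual ℝ (Eucl n)).symm.toContinuousLinearEquiv
    |>.toContinuousLinearMap.differentiableAt).comp z h2

/-- The lower Hessian bound is integrated along the ray $s\mapsto sz$. The singularity at the origin
is harmless, since monotonicity on $[0,1]$ needs derivatives only in the interior and continuity at
the ends. -/
lemma coercive_gradient_density (hp : 1 < p) (hp2 : p < 2) (hlam : 0 < lam) (z : Eucl n) :
    lam * ‖z‖ ^ p ≤ inner ℝ (gradient Ep z) z := by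
  rcases eq_or_ne z 0 with rfl | hz
  · simp [Real.zero_rpow (show p ≠ 0 by linarith)]
  have hn : 0 < ‖z‖ := norm_pos_iff.2 hz
  have hp1 : 0 < p - 1 := by linarith
  -- The subtracted term is the primitive in $s$ of $\lambda|sz|^{p-2}|z|^2$.
  set f : ℝ → ℝ := fun s => inner ℝ (gradient Ep (s • z)) z - lam / (p - 1) * ‖z‖ ^ p * s ^ (p - 1)
  have hfc : Continuous f := by
    have h1 := (continuous_gradient_density hE)
    have h2 : Continuous fun s : ℝ => s ^ (p - 1) := Real.continuous_rpow_const hp1.le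
    fun_prop
  have hd : ∀ s : ℝ, 0 < s → HasDerivAt f (inner ℝ (fderiv ℝ (gradient Ep) (s • z) z) z -
      lam / (p - 1) * ‖z‖ ^ p * ((p - 1) * s ^ (p - 1 - 1))) s := by
    intro s hs
    have h1 : HasDerivAt (fun s : ℝ => s • z) z s := by
      simpa using (hasDerivAt_id s).smul_const z
    have h4 : HasFDerivAt (gradient Ep) (fderiv ℝ (gradient Ep) (s • z)) (s • z) :=
      (differentiableAt_gradient_density hE (smul_ne_zero hs.ne' hz)).hasFDerivAt
    have h2 : HasDerivAt (fun s : ℝ => gradient Ep (s • z)) (fderiv ℝ (gradient Ep) (s • z) z) s := by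
      have := HasFDerivAt.comp_hasDerivAt s h4 h1
      exact this
    have h3 := h2.inner ℝ (hasDerivAt_const s z)
    simp only [inner_zero_right, zero_add] at h3
    exact h3.sub ((Real.hasDerivAt_rpow_const (Or.inl hs.ne')).const_mul _)
  have hmono := monotoneOn_of_deriv_nonneg (convex_Icc (0 : ℝ) 1) hfc.continuousOn
    (fun s hs => by
      rw [interior_Icc] at hs
      exact (hd s hs.1).differentiableAt.differentiableWithinAt)
    (fun s hs => ?_)
  · have h := hmono (left_mem_Icc.2 zero_le_one) (right_mem_Icc.2 zero_le_one) zero_le_one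
    have h0 : gradient Ep (0 : Eucl n) = 0 := by
      have := hE.gradient_bound 0
      rw [norm_zero, Real.zero_rpow hp1.ne', mul_zero] at this
      exact norm_le_zero_iff.1 this
    simp only [f, zero_smul, h0, inner_zero_left, Real.zero_rpow hp1.ne', mul_zero, sub_zero,
      one_smul, Real.one_rpow, mul_one] at h
    -- Integration yields the larger constant $\lambda/(p-1)$, which is lowered to $\lambda$ since
    -- $p-1<1$.
    have h1 : lam ≤ lam / (p - 1) := by
      rw [le_div_iff₀ hp1]
      nlinarith
    have h2 := mul_le_mul_of_nonneg_right h1 (Real.rpow_nonneg hn.le p)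
    linarith
  · rw [interior_Icc] at hs
    rw [(hd s hs.1).deriv]
    have h := hE.hessian_lower (s • z) (smul_ne_zero hs.1.ne' hz) z
    rw [norm_smul, Real.norm_of_nonneg hs.1.le, Real.mul_rpow hs.1.le hn.le] at h
    have h1 : ‖z‖ ^ (p - 2) * ‖z‖ ^ 2 = ‖z‖ ^ p := by
      rw [← Real.rpow_natCast, ← Real.rpow_add hn]
      norm_num
    have h2 : lam / (p - 1) * ‖z‖ ^ p * ((p - 1) * s ^ (p - 1 - 1)) =
        lam * (s ^ (p - 2) * ‖z‖ ^ (p - 2)) * ‖z‖ ^ 2 := by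
      rw [← h1, show p - 1 - 1 = p - 2 by ring]
      field_simp
    linarith

variable (hp : 1 < p) (hp2 : p < 2) (hlam : 0 < lam)
  (hK : ∀ z, ∀ ζ ∈ subdifferential E₁ z, ‖ζ‖ ≤ K)

include hK in
lemma norm_field_le {z ζ : Eucl n} (h : ζ ∈ subdifferential E₁ z) :
    ‖ζ + gradient Ep z‖ ≤ K + Lam * ‖z‖ ^ (p - 1) :=
  (norm_add_le _ _).trans (add_le_add (hK z ζ h) (hE.gradient_bound z))

include hp hp2 hlam in
lemma coercive_field {z ζ : Eucl n} (h : ζ ∈ subdifferential E₁ z) :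
    lam * ‖z‖ ^ p ≤ inner ℝ (ζ + gradient Ep z) z := by
  rw [inner_add_left]
  linarith [inner_subdifferential_nonneg hE h, coercive_gradient_density hE hp hp2 hlam z]

include hp hp2 hlam hK in
-- The pointwise core of the energy estimate. With $z=\nabla u$ and $e=\nabla\eta$ the vector on the
-- right is $\nabla(\Psi(u)\eta^2)$, where $P=T^m$ and $d=\Psi'(u)\ge P$. The cross terms are put
-- into $N^2(1+s^2)P$, at the cost of half of the coercive term.
lemma inner_field_test_ge (hLam : lam ≤ Lam) {z ζ e : Eucl n} (h : ζ ∈ subdifferential E₁ z)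
    {P d s η N : ℝ}
    (hP : 0 ≤ P) (hd : P ≤ d) (h0 : 0 ≤ η) (h1 : η ≤ 1) (hN : 1 ≤ N) (he : ‖e‖ ≤ N) :
    lam / 2 * (P * ‖z‖ ^ p * η ^ 2) -
      (2 * K + (lam / 2) ^ (1 - p) * (2 * Lam) ^ p) * N ^ 2 * ((1 + s ^ 2) * P) ≤
    inner ℝ (ζ + gradient Ep z) ((d * η ^ 2) • z + (s * P * (2 * η)) • e) := by
  have hK0 : 0 ≤ K := (norm_nonneg _).trans (hK z ζ h)
  have hLam0 : 0 < Lam := hlam.trans_le hLam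
  rw [inner_add_right, inner_smul_right, inner_smul_right]
  have hz : 0 ≤ ‖z‖ ^ p := Real.rpow_nonneg (norm_nonneg _) _
  have hz1 : 0 ≤ ‖z‖ ^ (p - 1) := Real.rpow_nonneg (norm_nonneg _) _
  have i1 : P * η ^ 2 * (lam * ‖z‖ ^ p) ≤ d * η ^ 2 * inner ℝ (ζ + gradient Ep z) z :=
    mul_le_mul (mul_le_mul_of_nonneg_right hd (sq_nonneg _)) (coercive_field hE hp hp2 hlam h)
      (by positivity) (mul_nonneg (hP.trans hd) (sq_nonneg _))
  have i2 : |s * P * (2 * η) * inner ℝ (ζ + gradient Ep z) e| ≤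
      |s| * P * (2 * η) * ((K + Lam * ‖z‖ ^ (p - 1)) * N) := by
    rw [abs_mul, abs_mul, abs_mul s, abs_of_nonneg hP, abs_of_nonneg (show 0 ≤ 2 * η by linarith)]
    refine mul_le_mul_of_nonneg_left ?_ (by positivity)
    refine (abs_real_inner_le_norm _ _).trans ?_
    exact mul_le_mul (norm_field_le hE hK h) he (norm_nonneg _) (by positivity)
  -- Weight $\varepsilon=\lambda/2$ and $e=2\Lambda|s|N$: the part of the cross term with
  -- $p$-growth.
  have i3 := absorb_le hp hp2 h0 h1 (norm_nonneg z)
    (show 0 ≤ 2 * Lam * (|s| * N) by positivity) (half_pos hlam)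
  have i4 : (2 * Lam * (|s| * N)) ^ p ≤ (2 * Lam) ^ p * ((1 + s ^ 2) * N ^ 2) := by
    rw [Real.mul_rpow (by positivity) (by positivity), Real.mul_rpow (abs_nonneg s) (by positivity)]
    refine mul_le_mul_of_nonneg_left ?_ (by positivity)
    refine mul_le_mul (abs_rpow_le_one_add_sq (by linarith) hp2.le s) ?_ (by positivity)
      (by positivity)
    rw [← Real.rpow_two]
    exact Real.rpow_le_rpow_of_exponent_le hN hp2.le
  have i5 : |s| * η * N ≤ (1 + s ^ 2) * N ^ 2 := by
    have a1 : |s| ≤ 1 + s ^ 2 := by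
      have := sq_abs s
      nlinarith [sq_nonneg (|s| - 1), abs_nonneg s]
    calc |s| * η * N ≤ (1 + s ^ 2) * 1 * N :=
          mul_le_mul_of_nonneg_right (mul_le_mul a1 h1 h0 (by positivity)) (by linarith)
      _ ≤ _ := by
        rw [mul_one]
        exact mul_le_mul_of_nonneg_left (by nlinarith) (by positivity)
  have i6 := mul_le_mul_of_nonneg_left i5 (show 0 ≤ 2 * K * P by positivity)
  have i7 := mul_le_mul_of_nonneg_left i4
    (show 0 ≤ (lam / 2) ^ (1 - p) by positivity)
  have i8 := mul_le_mul_of_nonneg_left (i3.trans (add_le_add le_rfl i7)) hP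
  have i9 := neg_abs_le (s * P * (2 * η) * inner ℝ (ζ + gradient Ep z) e)
  nlinarith

end


/-! ### Translations and mollification in `L^q` -/

lemma tendsto_eLpNorm_translate {G F : Type*} [NormedAddCommGroup G] [MeasurableSpace G]
    [BorelSpace G] [SecondCountableTopology G] [LocallyCompactSpace G]
    {μ : Measure G} [μ.IsAddHaarMeasure] [μ.InnerRegularCompactLTTop]
    [NormedAddCommGroup F] {q : ℝ≥0∞} [Fact (1 ≤ q)] (hq : q ≠ ⊤) {f : G → F} (hf : MemLp f q μ) :
    Tendsto (fun y : G => eLpNorm (fun x => f (x - y) - f x) q μ) (𝓝 0) (𝓝 0) := by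
  let τ : G → C(G, G) := fun y => ⟨fun x => x - y, by fun_prop⟩
  have hτ : ∀ y, MeasurePreserving (τ y) μ μ := fun y => measurePreserving_sub_right μ y
  have hc : Continuous τ := ContinuousMap.continuous_of_continuous_uncurry _ (by
    simp only [τ, Function.uncurry_def, ContinuousMap.coe_mk]
    fun_prop)
  have h := (continuous_const (y := hf.toLp f)).compMeasurePreservingLp hc hτ hq
  have h0 := h.tendsto 0
  have h1 := tendsto_iff_edist_tendsto_0.1 h0
  refine h1.congr fun y => ?_
  rw [Lp.edist_def]
  refine eLpNorm_congr_ae ?_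
  have e1 := (Lp.coeFn_compMeasurePreserving (hf.toLp f) (hτ y)).trans
    ((hτ y).quasiMeasurePreserving.ae_eq_comp hf.coeFn_toLp)
  have e2 := (Lp.coeFn_compMeasurePreserving (hf.toLp f) (hτ 0)).trans
    ((hτ 0).quasiMeasurePreserving.ae_eq_comp hf.coeFn_toLp)
  filter_upwards [e1, e2] with x h1 h2
  rw [Pi.sub_apply, h1, h2]
  simp [τ]

open ContinuousLinearMap Convolution in
-- The mollification error is an average of $f(\cdot-y)-f$ against the probability density
-- `ρ.normed`. Jensen's inequality and Tonelli's theorem bound its norm by the largest translation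
-- error.
lemma eLpNorm_convolution_sub_le {G F : Type*} [NormedAddCommGroup G] [NormedSpace ℝ G]
    [FiniteDimensional ℝ G] [MeasurableSpace G] [BorelSpace G]
    {μ : Measure G} [μ.IsAddHaarMeasure] [NormedAddCommGroup F] [NormedSpace ℝ F]
    [CompleteSpace F] {q : ℝ≥0∞} (hq1 : 1 ≤ q) (hq : q ≠ ⊤) {f : G → F} (hf : MemLp f q μ)
    (ρ : ContDiffBump (0 : G)) {C : ℝ≥0∞}
    (hC : ∀ y ∈ Metric.ball (0 : G) ρ.rOut, eLpNorm (fun x => f (x - y) - f x) q μ ≤ C) :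
    eLpNorm (ρ.normed μ ⋆[lsmul ℝ ℝ, μ] f - f) q μ ≤ C := by
  have hq0 : q ≠ 0 := (zero_lt_one.trans_le hq1).ne'
  have hqr : 0 < q.toReal := ENNReal.toReal_pos hq0 hq
  set g : G × G → F := fun z => f (z.1 - z.2) - f z.1 with hg
  have hgm : AEStronglyMeasurable g (μ.prod μ) :=
    (hf.1.comp_quasiMeasurePreserving (quasiMeasurePreserving_sub μ μ)).sub hf.1.comp_fst
  set r : G → ℝ≥0∞ := fun y => ENNReal.ofReal (ρ.normed μ y) with hr
  have hrc : Continuous r := ENNReal.continuous_ofReal.comp ρ.continuous_normed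
  have hr1 : ∫⁻ y, r y ∂μ = 1 := by
    rw [hr, ← ofReal_integral_eq_lintegral_ofReal ρ.integrable_normed
      (Eventually.of_forall ρ.nonneg_normed), ρ.integral_normed, ENNReal.ofReal_one]
  set ν : Measure G := μ.withDensity r
  have hν : IsProbabilityMeasure ν := ⟨by simp [ν, withDensity_apply, hr1]⟩
  have hνμ : ν ≪ μ := withDensity_absolutelyContinuous _ _
  have hloc : LocallyIntegrable f μ := hf.locallyIntegrable hq1
  have hcv : ConvolutionExists (ρ.normed μ) f (lsmul ℝ ℝ) μ :=
    ρ.hasCompactSupport_normed.convolutionExists_left _ ρ.continuous_normed hloc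
  have hpt : ∀ᵐ x ∂μ, ‖(ρ.normed μ ⋆[lsmul ℝ ℝ, μ] f - f) x‖ₑ ^ q.toReal ≤
      ∫⁻ y, r y * ‖g (x, y)‖ₑ ^ q.toReal ∂μ := by
    filter_upwards [hgm.prodMk_left] with x hx
    have hi : Integrable (fun y => ρ.normed μ y • f (x - y)) μ := hcv x
    have hi2 : Integrable (fun y => ρ.normed μ y • f x) μ := ρ.integrable_normed.smul_const _
    have e1 : (ρ.normed μ ⋆[lsmul ℝ ℝ, μ] f - f) x = ∫ y, ρ.normed μ y • g (x, y) ∂μ := by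
      simp only [hg, smul_sub, Pi.sub_apply]
      rw [integral_sub hi hi2, integral_smul_const, ρ.integral_normed, one_smul]
      rfl
    have e2 : ‖∫ y, ρ.normed μ y • g (x, y) ∂μ‖ₑ ≤ ∫⁻ y, ‖g (x, y)‖ₑ ∂ν := by
      rw [lintegral_withDensity_eq_lintegral_mul₀ hrc.measurable.aemeasurable hx.enorm]
      refine (enorm_integral_le_lintegral_enorm _).trans (lintegral_mono fun y => ?_)
      rw [enorm_smul, Real.enorm_eq_ofReal (ρ.nonneg_normed y), Pi.mul_apply]
    -- Jensen's inequality in the form $\|\cdot\|_{L^1}\le\|\cdot\|_{L^q}$ on a probability space.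
    have e3 := eLpNorm_le_eLpNorm_of_exponent_le hq1 (hx.mono_ac hνμ)
    rw [eLpNorm_one_eq_lintegral_enorm, eLpNorm_eq_lintegral_rpow_enorm_toReal hq0 hq] at e3
    rw [e1]
    refine (ENNReal.rpow_le_rpow (e2.trans e3) hqr.le).trans (le_of_eq ?_)
    rw [← ENNReal.rpow_mul, one_div_mul_cancel hqr.ne', ENNReal.rpow_one,
      lintegral_withDensity_eq_lintegral_mul₀ hrc.measurable.aemeasurable
        (hx.enorm.pow_const _)]
    rfl
  rw [eLpNorm_eq_lintegral_rpow_enorm_toReal hq0 hq, one_div, ENNReal.rpow_inv_le_iff hqr]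
  calc ∫⁻ x, ‖(ρ.normed μ ⋆[lsmul ℝ ℝ, μ] f - f) x‖ₑ ^ q.toReal ∂μ
      ≤ ∫⁻ x, ∫⁻ y, r y * ‖g (x, y)‖ₑ ^ q.toReal ∂μ ∂μ := lintegral_mono_ae hpt
    _ = ∫⁻ y, ∫⁻ x, r y * ‖g (x, y)‖ₑ ^ q.toReal ∂μ ∂μ :=
      lintegral_lintegral_swap
        ((hrc.measurable.comp measurable_snd).aemeasurable.mul (hgm.enorm.pow_const _))
    _ ≤ ∫⁻ y, r y * C ^ q.toReal ∂μ := by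
      refine lintegral_mono fun y => ?_
      rw [lintegral_const_mul' _ _ ENNReal.ofReal_ne_top]
      by_cases hy : y ∈ Metric.ball (0 : G) ρ.rOut
      · gcongr
        have := hC y hy
        rwa [eLpNorm_eq_lintegral_rpow_enorm_toReal hq0 hq, one_div,
          ENNReal.rpow_inv_le_iff hqr] at this
      · have : ρ.normed μ y = 0 := by
          rw [← ρ.support_normed_eq (μ := μ)] at hy
          simpa using hy
        simp [hr, this]
    _ = C ^ q.toReal := by
      rw [lintegral_mul_const _ hrc.measurable, hr1, one_mul]

open ContinuousLinearMap Convolution in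
lemma tendsto_eLpNorm_convolution_sub {G F : Type*} [NormedAddCommGroup G] [NormedSpace ℝ G]
    [FiniteDimensional ℝ G] [MeasurableSpace G] [BorelSpace G]
    {μ : Measure G} [μ.IsAddHaarMeasure] [NormedAddCommGroup F] [NormedSpace ℝ F]
    [CompleteSpace F] {q : ℝ≥0∞} [Fact (1 ≤ q)] (hq : q ≠ ⊤) {f : G → F} (hf : MemLp f q μ)
    {ρ : ℕ → ContDiffBump (0 : G)} (hρ : Tendsto (fun k => (ρ k).rOut) atTop (𝓝 0)) :
    Tendsto (fun k => eLpNorm ((ρ k).normed μ ⋆[lsmul ℝ ℝ, μ] f - f) q μ) atTop (𝓝 0) := by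
  have := FiniteDimensional.proper_real G
  rw [ENNReal.tendsto_nhds_zero]
  intro ε hε
  have h := ENNReal.tendsto_nhds_zero.1 (tendsto_eLpNorm_translate hq hf) ε hε
  obtain ⟨δ, hδ, hb⟩ := Metric.eventually_nhds_iff_ball.1 h
  filter_upwards [hρ.eventually (gt_mem_nhds hδ)] with k hk
  exact eLpNorm_convolution_sub_le Fact.out hq hf (ρ k) fun y hy =>
    hb y (Metric.ball_subset_ball hk.le hy)


/-! ### Sobolev functions -/

section
variable {n : ℕ} {Ω : Set (Eucl n)}

lemma gradient_inner (φ : Eucl n → ℝ) (x v : Eucl n) :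
    inner ℝ (gradient φ x) v = fderiv ℝ φ x v := by
  simp [gradient]

lemma norm_gradient (φ : Eucl n → ℝ) (x : Eucl n) : ‖gradient φ x‖ = ‖fderiv ℝ φ x‖ := by
  simp [gradient]

lemma support_gradient_subset (φ : Eucl n → ℝ) :
    Function.support (gradient φ) ⊆ tsupport φ := by
  intro x hx
  refine support_fderiv_subset ℝ (f := φ) ?_
  rw [Function.mem_support] at hx ⊢
  rwa [← norm_ne_zero_iff, ← norm_gradient, norm_ne_zero_iff]

lemma IsTest.mono_regularity {X : Type*} [NormedAddCommGroup X] [NormedSpace ℝ X]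
    {k l : WithTop ℕ∞} {Ω : Set X} {φ : X → ℝ} (h : IsTest l Ω φ) (hkl : k ≤ l) : IsTest k Ω φ :=
  ⟨h.1.of_le hkl, h.2⟩

lemma IsTest.integral_smul_gradient {φ θ : Eucl n → ℝ} (hφ : IsTest 1 Ω φ) (hθ : IsTest 1 Ω θ) :
    ∫ x in Ω, φ x • gradient θ x = - ∫ x in Ω, θ x • gradient φ x := by
  have a1 := hθ.continuous_gradient le_rfl
  have a2 := hφ.continuous_gradient le_rfl
  have i1 : Integrable (fun x => φ x • gradient θ x) :=
    (hφ.1.continuous.smul a1).integrable_of_hasCompactSupport hφ.2.1.smul_right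
  have i2 : Integrable (fun x => θ x • gradient φ x) :=
    (hθ.1.continuous.smul a2).integrable_of_hasCompactSupport hθ.2.1.smul_right
  have s1 : ∫ x in Ω, φ x • gradient θ x = ∫ x, φ x • gradient θ x := by
    refine setIntegral_eq_integral_of_forall_compl_eq_zero fun x hx => ?_
    rw [image_eq_zero_of_notMem_tsupport (fun h => hx (hφ.2.2 h)), zero_smul]
  have s2 : ∫ x in Ω, θ x • gradient φ x = ∫ x, θ x • gradient φ x := by
    refine setIntegral_eq_integral_of_forall_compl_eq_zero fun x hx => ?_
    rw [image_eq_zero_of_notMem_tsupport (fun h => hx (hθ.2.2 h)), zero_smul]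
  rw [s1, s2]
  refine ext_inner_left ℝ fun v => ?_
  rw [inner_neg_right, ← integral_inner i1, ← integral_inner i2]
  simp only [← real_inner_comm v]
  simp only [real_inner_smul_left, gradient_inner]
  have j1 : Integrable (fun x => φ x * fderiv ℝ θ x v) := by
    simpa [real_inner_smul_left, gradient_inner] using i1.inner_const (𝕜 := ℝ) v
  have j2 : Integrable (fun x => fderiv ℝ φ x v * θ x) := by
    simpa [real_inner_smul_left, gradient_inner, mul_comm] using i2.inner_const (𝕜 := ℝ) v
  have j3 : Integrable (fun x => φ x * θ x) :=
    (hφ.1.continuous.mul hθ.1.continuous).integrable_of_hasCompactSupport hφ.2.1.mul_right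
  rw [integral_mul_fderiv_eq_neg_fderiv_mul_of_integrable j2 j1 j3
    (fun x _ => hφ.1.differentiable one_ne_zero x) (fun x _ => hθ.1.differentiable one_ne_zero x)]
  simp only [mul_comm]

lemma tendsto_integral_smul_left {X F : Type*} [MeasurableSpace X] {μ : Measure X}
    [NormedAddCommGroup F] [NormedSpace ℝ F] {q q' : ℝ≥0∞} [q.HolderConjugate q']
    {f : X → ℝ} {φ : ℕ → X → ℝ} {h : X → F} (hf : MemLp f q μ) (hφ : ∀ k, MemLp (φ k) q μ)
    (hh : MemLp h q' μ) (hlim : Tendsto (fun k => eLpNorm (f - φ k) q μ) atTop (𝓝 0)) :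
    Tendsto (fun k => ∫ x, φ k x • h x ∂μ) atTop (𝓝 (∫ x, f x • h x ∂μ)) := by
  refine tendsto_integral_of_L1' (F := fun k => φ k • h) (f • h) (hf.1.smul hh.1)
    (Eventually.of_forall fun k => memLp_one_iff_integrable.1 (hh.smul (hφ k))) ?_
  refine tendsto_of_tendsto_of_tendsto_of_le_of_le tendsto_const_nhds
    (by simpa using ENNReal.Tendsto.mul_const hlim (Or.inr hh.eLpNorm_ne_top))
    (fun _ => zero_le) fun k => ?_
  rw [← sub_smul, eLpNorm_sub_comm f]
  exact eLpNorm_smul_le_mul_eLpNorm hh.1 ((hφ k).1.sub hf.1)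

lemma tendsto_integral_smul_right {X F : Type*} [MeasurableSpace X] {μ : Measure X}
    [NormedAddCommGroup F] [NormedSpace ℝ F] {q q' : ℝ≥0∞} [q.HolderConjugate q']
    {f : X → F} {φ : ℕ → X → F} {h : X → ℝ} (hf : MemLp f q μ) (hφ : ∀ k, MemLp (φ k) q μ)
    (hh : MemLp h q' μ) (hlim : Tendsto (fun k => eLpNorm (f - φ k) q μ) atTop (𝓝 0)) :
    Tendsto (fun k => ∫ x, h x • φ k x ∂μ) atTop (𝓝 (∫ x, h x • f x ∂μ)) := by
  have : q'.HolderConjugate q := ENNReal.HolderConjugate.symm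
  refine tendsto_integral_of_L1' (F := fun k => h • φ k) (h • f) (hh.1.smul hf.1)
    (Eventually.of_forall fun k => memLp_one_iff_integrable.1 ((hφ k).smul hh)) ?_
  refine tendsto_of_tendsto_of_tendsto_of_le_of_le tendsto_const_nhds
    (by simpa using ENNReal.Tendsto.const_mul hlim (Or.inr hh.eLpNorm_ne_top))
    (fun _ => zero_le) fun k => ?_
  rw [← smul_sub, eLpNorm_sub_comm f]
  exact eLpNorm_smul_le_mul_eLpNorm ((hφ k).1.sub hf.1) hh.1

lemma memLp_of_tendsto_eLpNorm_sub {X F : Type*} [MeasurableSpace X] {μ : Measure X}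
    [NormedAddCommGroup F] {q : ℝ≥0∞}
    {f : X → F} {φ : ℕ → X → F} (hf : AEStronglyMeasurable f μ) (hφ : ∀ k, MemLp (φ k) q μ)
    (hlim : Tendsto (fun k => eLpNorm (f - φ k) q μ) atTop (𝓝 0)) : MemLp f q μ := by
  obtain ⟨k, hk⟩ := (hlim.eventually (gt_mem_nhds ENNReal.zero_lt_top)).exists
  have : MemLp (f - φ k) q μ := ⟨hf.sub (hφ k).1, hk⟩
  simpa using this.add (hφ k)

lemma tendsto_eLpNorm_zero_of_dominated {X F : Type*} [MeasurableSpace X] {μ : Measure X}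
    [NormedAddCommGroup F] {q : ℝ≥0∞} (hq0 : q ≠ 0) (hq : q ≠ ⊤) {f : ℕ → X → F} {b : X → ℝ}
    (hf : ∀ k, AEStronglyMeasurable (f k) μ) (hb : MemLp b q μ) (hfb : ∀ k x, ‖f k x‖ ≤ b x)
    (hlim : ∀ᵐ x ∂μ, Tendsto (fun k => f k x) atTop (𝓝 0)) :
    Tendsto (fun k => eLpNorm (f k) q μ) atTop (𝓝 0) := by
  have hqr : 0 < q.toReal := ENNReal.toReal_pos hq0 hq
  have h := tendsto_lintegral_of_dominated_convergence' (μ := μ)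
    (F := fun k x => ‖f k x‖ₑ ^ q.toReal) (f := fun _ => 0) (fun x => ‖b x‖ₑ ^ q.toReal)
    (fun k => (hf k).enorm.pow_const _)
    (fun k => Eventually.of_forall fun x => ENNReal.rpow_le_rpow
      (enorm_le_iff_norm_le.2 ((hfb k x).trans (le_abs_self _))) hqr.le)
    (lintegral_rpow_enorm_lt_top_of_eLpNorm_lt_top hq0 hq hb.2).ne
    (by
      filter_upwards [hlim] with x hx
      have := (ENNReal.continuous_rpow_const (y := q.toReal)).tendsto _ |>.comp hx.enorm
      simpa [Function.comp_def, hqr] using this)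
  rw [lintegral_zero] at h
  have h2 := (ENNReal.continuous_rpow_const (y := 1 / q.toReal)).tendsto _ |>.comp h
  rw [ENNReal.zero_rpow_of_pos (by positivity)] at h2
  refine h2.congr fun k => ?_
  rw [eLpNorm_eq_lintegral_rpow_enorm_toReal hq0 hq]
  rfl

lemma IsTest.memLp {k : WithTop ℕ∞} {φ : Eucl n → ℝ} (hφ : IsTest k Ω φ) (q : ℝ≥0∞)
    (μ : Measure (Eucl n)) [IsFiniteMeasureOnCompacts μ] : MemLp φ q μ :=
  hφ.1.continuous.memLp_of_hasCompactSupport hφ.2.1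

lemma IsTest.memLp_gradient {k : WithTop ℕ∞} (hk : 1 ≤ k) {φ : Eucl n → ℝ} (hφ : IsTest k Ω φ)
    (q : ℝ≥0∞) (μ : Measure (Eucl n)) [IsFiniteMeasureOnCompacts μ] : MemLp (gradient φ) q μ :=
  (hφ.continuous_gradient hk).memLp_of_hasCompactSupport hφ.hasCompactSupport_gradient

/-- Membership in $W^{1,q}$ comes for free: integration by parts holds for the approximations and
both sides converge by Hölder's inequality, since test functions and their gradients lie in every
$L^{q'}$. -/
lemma memWZero_of_tendsto {q : ℝ≥0∞} (hq : 1 ≤ q) {f : Eucl n → ℝ} {g : Eucl n → Eucl n}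
    {φ : ℕ → Eucl n → ℝ} (hφ : ∀ k, IsTest 1 Ω (φ k))
    (hf : AEStronglyMeasurable f (volume.restrict Ω))
    (hg : AEStronglyMeasurable g (volume.restrict Ω))
    (h1 : Tendsto (fun k => eLpNorm (f - φ k) q (volume.restrict Ω)) atTop (𝓝 0))
    (h2 : Tendsto (fun k => eLpNorm (g - gradient (φ k)) q (volume.restrict Ω)) atTop (𝓝 0)) :
    MemWZero Ω q f g := by
  have : Fact (1 ≤ q) := ⟨hq⟩
  have m1 := memLp_of_tendsto_eLpNorm_sub hf (fun k => (hφ k).memLp q _) h1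
  have m2 := memLp_of_tendsto_eLpNorm_sub hg (fun k => (hφ k).memLp_gradient le_rfl q _) h2
  refine ⟨⟨m1, m2, fun θ hθ => ?_⟩, φ, hφ, h1, h2⟩
  have a1 := tendsto_integral_smul_left (q' := q.conjExponent) m1 (fun k => (hφ k).memLp q _)
    (hθ.memLp_gradient (by norm_cast) _ _) h1
  have a2 := tendsto_integral_smul_right (q' := q.conjExponent) m2
    (fun k => (hφ k).memLp_gradient le_rfl q _) (hθ.memLp _ _) h2
  refine tendsto_nhds_unique a1 (a2.neg.congr fun k => ?_)
  rw [(hφ k).integral_smul_gradient (hθ.mono_regularity (by norm_cast))]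

end


section
variable {n : ℕ} {Ω : Set (Eucl n)} {q : ℝ≥0∞} {f : Eucl n → ℝ} {g : Eucl n → Eucl n}

open ContinuousLinearMap Convolution in
-- If the closed ball about $x$ of the mollification radius lies in $\Omega$, the kernel
-- $t\mapsto\rho(x-t)$ is itself an admissible test function. The derivative can then be moved from
-- the kernel to $f$ by the definition of the weak gradient.
lemma MemW.hasGradientAt_convolution (hΩ : MeasurableSet Ω) (hq : 1 ≤ q) (h : MemW Ω q f g)
    (ρ : ContDiffBump (0 : Eucl n)) {x : Eucl n} (hx : Metric.closedBall x ρ.rOut ⊆ Ω) :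
    HasGradientAt (ρ.normed volume ⋆[lsmul ℝ ℝ, volume] Ω.indicator f)
      ((ρ.normed volume ⋆[lsmul ℝ ℝ, volume] Ω.indicator g) x) x := by
  have hf : LocallyIntegrable (Ω.indicator f) volume :=
    ((memLp_indicator_iff_restrict hΩ).2 h.1).locallyIntegrable hq
  have hg : LocallyIntegrable (Ω.indicator g) volume :=
    ((memLp_indicator_iff_restrict hΩ).2 h.2.1).locallyIntegrable hq
  have hρ1 : ContDiff ℝ 1 (ρ.normed volume) := ρ.contDiff_normed (n := 1)
  have hρc := ρ.hasCompactSupport_normed (μ := volume)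
  have hd := hρc.hasFDerivAt_convolution_right (lsmul ℝ ℝ).flip hf hρ1 x
  rw [convolution_flip] at hd
  rw [hasGradientAt_iff_hasFDerivAt]
  refine hd.congr_fderiv (ContinuousLinearMap.ext fun v => ?_)
  rw [convolution_precompR_apply _ hf (hρc.fderiv ℝ) (hρ1.continuous_fderiv one_ne_zero),
    InnerProductSpace.toDual_apply_apply]
  set θ : Eucl n → ℝ := fun t => ρ.normed volume (x - t) with hθ
  have hsupp : tsupport θ ⊆ Metric.closedBall x ρ.rOut := by
    refine closure_minimal (fun t ht => ?_) Metric.isClosed_closedBall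
    have : x - t ∈ Function.support (ρ.normed volume) := ht
    rw [ρ.support_normed_eq] at this
    rw [Metric.mem_closedBall, dist_comm, dist_eq_norm]
    exact (mem_ball_zero_iff.1 this).le
  have hθt : IsTest ∞ Ω θ := ⟨ρ.contDiff_normed.comp (contDiff_const.sub contDiff_id),
    HasCompactSupport.of_support_subset_isCompact (isCompact_closedBall x ρ.rOut)
      ((subset_tsupport _).trans hsupp), hsupp.trans hx⟩
  have hθg : ∀ t, gradient θ t = - gradient (ρ.normed volume) (x - t) := by
    intro t
    refine ext_inner_right ℝ fun v => ?_
    have h1 : HasFDerivAt (ρ.normed volume) (fderiv ℝ (ρ.normed volume) (x - t)) (x - t) :=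
      (hρ1.differentiable one_ne_zero _).hasFDerivAt
    have h2 := HasFDerivAt.comp t h1 ((hasFDerivAt_id t).const_sub x)
    rw [inner_neg_left, gradient_inner, gradient_inner, HasFDerivAt.fderiv (f := θ) h2]
    simp
  have hw := congrArg (fun z => inner ℝ z v) (h.2.2 θ hθt)
  have ib : Integrable (fun t => Ω.indicator f t • gradient θ t) :=
    hf.integrable_smul_right_of_hasCompactSupport (hθt.continuous_gradient (by norm_cast))
      hθt.hasCompactSupport_gradient
  have e1 : ∫ t in Ω, f t • gradient θ t = ∫ t, Ω.indicator f t • gradient θ t := by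
    rw [← integral_indicator hΩ]
    congr 1; ext1 t
    by_cases ht : t ∈ Ω <;> simp [ht]
  have e2 : ∫ t in Ω, θ t • g t = ∫ t, θ t • Ω.indicator g t := by
    rw [← integral_indicator hΩ]
    congr 1; ext1 t
    by_cases ht : t ∈ Ω <;> simp [ht]
  simp only [e1, e2] at hw
  rw [inner_neg_left, ← real_inner_comm, ← integral_inner ib] at hw
  rw [convolution_lsmul_swap]
  change _ = inner ℝ (∫ t, θ t • Ω.indicator g t) v
  rw [← neg_eq_iff_eq_neg.2 hw, ← integral_neg]
  unfold convolution
  congr 1; ext1 t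
  rw [hθg, ← real_inner_comm, inner_smul_left, inner_neg_left, gradient_inner]
  simp [mul_comm]

lemma tendsto_eLpNorm_zero_of_norm_le {X E E' : Type*} [MeasurableSpace X] {μ : Measure X}
    [NormedAddCommGroup E] [NormedAddCommGroup E'] {a : ℕ → X → E} {b : ℕ → X → E'} (C : ℝ)
    (hb : Tendsto (fun k => eLpNorm (b k) q μ) atTop (𝓝 0))
    (hab : ∀ k x, ‖a k x‖ ≤ C * ‖b k x‖) :
    Tendsto (fun k => eLpNorm (a k) q μ) atTop (𝓝 0) := by
  have h := ENNReal.Tendsto.const_mul (a := ENNReal.ofReal C) hb (Or.inr ENNReal.ofReal_ne_top)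
  rw [mul_zero] at h
  refine tendsto_of_tendsto_of_tendsto_of_le_of_le tendsto_const_nhds h (fun _ => zero_le)
    fun k => ?_
  exact eLpNorm_le_mul_eLpNorm_of_ae_le_mul (Eventually.of_forall (hab k)) q

lemma abs_sub_le_of_abs_deriv_le {Ψ : ℝ → ℝ} (hΨ : ContDiff ℝ 1 Ψ) {L : ℝ}
    (hL : ∀ s, |deriv Ψ s| ≤ L) (a b : ℝ) : |Ψ a - Ψ b| ≤ L * |a - b| :=
  Convex.norm_image_sub_le_of_norm_deriv_le (fun x _ => hΨ.differentiable one_ne_zero x)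
    (fun x _ => hL x) convex_univ (mem_univ b) (mem_univ a)

lemma gradient_comp_mul {Ψ : ℝ → ℝ} (hΨ : ContDiff ℝ 1 Ψ) {η F : Eucl n → ℝ}
    (hη : ContDiff ℝ 1 η) {G x : Eucl n} (hF : HasGradientAt F G x) :
    gradient (fun x => Ψ (F x) * η x) x =
      (deriv Ψ (F x) * η x) • G + Ψ (F x) • gradient η x := by
  have h1 := ((hΨ.differentiable one_ne_zero (F x)).hasDerivAt.comp_hasFDerivAt x
    hF.hasFDerivAt).mul (hη.differentiable one_ne_zero x).hasFDerivAt
  refine ext_inner_right ℝ fun v => ?_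
  rw [gradient_inner, HasFDerivAt.fderiv (f := fun x => Ψ (F x) * η x) h1, inner_add_left,
    real_inner_smul_left, real_inner_smul_left, gradient_inner]
  simp
  ring

open ContinuousLinearMap Convolution in
-- The functions $\Psi(F_k)\eta$, with $F_k$ the mollifications of $f$, are $C^1$ with compact
-- support in $\Omega$. The error in the gradient splits into three terms: two are controlled by the
-- $L^q$ convergence of $F_k$ and of the mollified gradients, and the third contains
-- $\Psi'(f)-\Psi'(F_k)$.
lemma MemW.memWZero_comp_mul [Fact (1 ≤ q)] (hq : q ≠ ⊤) (hΩ : IsOpen Ω) (h : MemW Ω q f g)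
    {Ψ : ℝ → ℝ} (hΨ : ContDiff ℝ 1 Ψ) {L : ℝ} (hL : ∀ s, |deriv Ψ s| ≤ L) {η : Eucl n → ℝ}
    (hη : IsTest 1 Ω η) :
    MemWZero Ω q (fun x => Ψ (f x) * η x)
      (fun x => (deriv Ψ (f x) * η x) • g x + Ψ (f x) • gradient η x) := by
  have hq1 : 1 ≤ q := Fact.out
  have hq0 : q ≠ 0 := (zero_lt_one.trans_le hq1).ne'
  have hL0 : 0 ≤ L := (abs_nonneg _).trans (hL 0)
  have hf : MemLp (Ω.indicator f) q volume :=
    (memLp_indicator_iff_restrict hΩ.measurableSet).2 h.1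
  have hg : MemLp (Ω.indicator g) q volume :=
    (memLp_indicator_iff_restrict hΩ.measurableSet).2 h.2.1
  obtain ⟨δ, hδ, hδΩ⟩ := hη.2.1.isCompact.exists_cthickening_subset_open hΩ hη.2.2
  have hηc := hη.continuous_gradient le_rfl
  obtain ⟨C₁, hC₁⟩ := hη.2.1.exists_bound_of_continuous hη.1.continuous
  obtain ⟨C₂, hC₂⟩ := hη.hasCompactSupport_gradient.exists_bound_of_continuous hηc
  have hΨ' : Continuous (deriv Ψ) := hΨ.continuous_deriv le_rfl
  -- Outer radii at most $\delta$ keep balls centred on the support of $\eta$ inside $\Omega$. The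
  -- inner radius is half the outer one because almost everywhere convergence needs comparable
  -- radii, here with ratio at most $K=2$.
  let ρ : ℕ → ContDiffBump (0 : Eucl n) := fun k =>
    ⟨δ / (k + 1) / 2, δ / (k + 1), by positivity, half_lt_self (by positivity)⟩
  have hρ : Tendsto (fun k => (ρ k).rOut) atTop (𝓝 0) := by
    have := (tendsto_one_div_add_atTop_nhds_zero_nat (𝕜 := ℝ)).const_mul δ
    simpa [ρ, div_eq_mul_inv] using this
  set F : ℕ → Eucl n → ℝ := fun k =>
    (ρ k).normed volume ⋆[lsmul ℝ ℝ, volume] Ω.indicator f with hF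
  set G : ℕ → Eucl n → Eucl n := fun k =>
    (ρ k).normed volume ⋆[lsmul ℝ ℝ, volume] Ω.indicator g with hG
  have hFc : ∀ k, ContDiff ℝ 1 (F k) := fun k =>
    (ρ k).hasCompactSupport_normed.contDiff_convolution_left (n := 1) _
      (ρ k).contDiff_normed (hf.locallyIntegrable hq1)
  have hGc : ∀ k, Continuous (G k) := fun k =>
    (ρ k).hasCompactSupport_normed.continuous_convolution_left _
      (ρ k).continuous_normed (hg.locallyIntegrable hq1)
  have hF1 : Tendsto (fun k => eLpNorm (F k - Ω.indicator f) q volume) atTop (𝓝 0) :=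
    tendsto_eLpNorm_convolution_sub hq hf hρ
  have hG1 : Tendsto (fun k => eLpNorm (G k - Ω.indicator g) q volume) atTop (𝓝 0) :=
    tendsto_eLpNorm_convolution_sub hq hg hρ
  have hFae : ∀ᵐ x ∂volume, Tendsto (fun k => F k x) atTop (𝓝 (Ω.indicator f x)) :=
    ContDiffBump.ae_convolution_tendsto_right_of_locallyIntegrable (K := 2) hρ
      (Eventually.of_forall fun k => by simp only [ρ]; linarith) (hf.locallyIntegrable hq1)
  have hF2 : Tendsto (fun k => eLpNorm (F k - f) q (volume.restrict Ω)) atTop (𝓝 0) := by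
    refine tendsto_of_tendsto_of_tendsto_of_le_of_le tendsto_const_nhds hF1 (fun _ => zero_le)
      fun k => ?_
    refine le_trans (le_of_eq ?_) 
      (eLpNorm_mono_measure _ (Measure.restrict_le_self (s := Ω)))
    refine eLpNorm_congr_ae ?_
    filter_upwards [ae_restrict_mem hΩ.measurableSet] with x hx
    simp [hx]
  have hG2 : Tendsto (fun k => eLpNorm (G k - g) q (volume.restrict Ω)) atTop (𝓝 0) := by
    refine tendsto_of_tendsto_of_tendsto_of_le_of_le tendsto_const_nhds hG1 (fun _ => zero_le)
      fun k => ?_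
    refine le_trans (le_of_eq ?_) 
      (eLpNorm_mono_measure _ (Measure.restrict_le_self (s := Ω)))
    refine eLpNorm_congr_ae ?_
    filter_upwards [ae_restrict_mem hΩ.measurableSet] with x hx
    simp [hx]
  have hFae' : ∀ᵐ x ∂(volume.restrict Ω), Tendsto (fun k => F k x) atTop (𝓝 (f x)) := by
    filter_upwards [ae_restrict_of_ae hFae, ae_restrict_mem hΩ.measurableSet] with x hx hxΩ
    simpa [hxΩ] using hx
  have hsub : ∀ k, tsupport (fun x => Ψ (F k x) * η x) ⊆ tsupport η := fun k =>
    tsupport_mul_subset_right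
  have htest : ∀ k, IsTest 1 Ω (fun x => Ψ (F k x) * η x) := fun k =>
    ⟨(hΨ.comp (hFc k)).mul hη.1, hη.2.1.mul_left, (hsub k).trans hη.2.2⟩
  have hgrad : ∀ k x, gradient (fun x => Ψ (F k x) * η x) x =
      (deriv Ψ (F k x) * η x) • G k x + Ψ (F k x) • gradient η x := by
    intro k x
    by_cases hx : x ∈ tsupport η
    · refine gradient_comp_mul hΨ hη.1 (h.hasGradientAt_convolution hΩ.measurableSet hq1 (ρ k) ?_)
      refine (Metric.closedBall_subset_closedBall ?_).trans
        ((Metric.closedBall_subset_cthickening hx δ).trans hδΩ)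
      exact div_le_self hδ.le (by simp)
    · have h1 : gradient η x = 0 := by
        by_contra hne
        exact hx (support_gradient_subset η hne)
      have h2 : gradient (fun x => Ψ (F k x) * η x) x = 0 := by
        by_contra hne
        exact hx (hsub k (support_gradient_subset _ hne))
      rw [h1, h2, image_eq_zero_of_notMem_tsupport hx]
      simp
  have mf := h.1.1
  have mg := h.2.1.1
  have mF : ∀ k, AEStronglyMeasurable (F k) (volume.restrict Ω) := fun k =>
    (hFc k).continuous.aestronglyMeasurable
  have mG : ∀ k, AEStronglyMeasurable (G k) (volume.restrict Ω) := fun k =>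
    (hGc k).aestronglyMeasurable
  have mη : AEStronglyMeasurable η (volume.restrict Ω) := hη.1.continuous.aestronglyMeasurable
  have mη' : AEStronglyMeasurable (gradient η) (volume.restrict Ω) := hηc.aestronglyMeasurable
  have mΨ {u : Eucl n → ℝ} (hu : AEStronglyMeasurable u (volume.restrict Ω)) :
      AEStronglyMeasurable (fun x => Ψ (u x)) (volume.restrict Ω) :=
    hΨ.continuous.comp_aestronglyMeasurable hu
  have mΨ' {u : Eucl n → ℝ} (hu : AEStronglyMeasurable u (volume.restrict Ω)) :
      AEStronglyMeasurable (fun x => deriv Ψ (u x)) (volume.restrict Ω) :=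
    hΨ'.comp_aestronglyMeasurable hu
  refine memWZero_of_tendsto hq1 htest ((mΨ mf).mul mη)
    ((((mΨ' mf).mul mη).smul mg).add ((mΨ mf).smul mη')) ?_ ?_
  · refine tendsto_eLpNorm_zero_of_norm_le (L * C₁) hF2 fun k x => ?_
    have h1 := abs_sub_le_of_abs_deriv_le hΨ hL (f x) (F k x)
    rw [Pi.sub_apply, Pi.sub_apply, ← sub_mul, norm_mul, ← norm_neg (F k x - f x), neg_sub]
    calc _ ≤ (L * ‖f x - F k x‖) * C₁ :=
          mul_le_mul h1 (hC₁ x) (norm_nonneg _) (by positivity)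
      _ = _ := by ring
  · have t1 : Tendsto (fun k => eLpNorm (fun x => (deriv Ψ (F k x) * η x) • (g x - G k x)) q
        (volume.restrict Ω)) atTop (𝓝 0) := by
      refine tendsto_eLpNorm_zero_of_norm_le (L * C₁) hG2 fun k x => ?_
      rw [norm_smul, norm_mul, norm_sub_rev, Pi.sub_apply]
      gcongr
      · exact hL _
      · exact hC₁ x
    -- Since $\Psi'$ is merely continuous and bounded, this term needs almost everywhere convergence
    -- and the majorant $2LC_1|g|$.
    have t2 : Tendsto (fun k => eLpNorm (fun x => ((deriv Ψ (f x) - deriv Ψ (F k x)) * η x) • g x) q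
        (volume.restrict Ω)) atTop (𝓝 0) := by
      refine tendsto_eLpNorm_zero_of_dominated hq0 hq (b := fun x => 2 * L * C₁ * ‖g x‖)
        (fun k => (((mΨ' mf).sub (mΨ' (mF k))).mul mη).smul mg) (h.2.1.norm.const_mul _) ?_ ?_
      · intro k x
        rw [norm_smul, norm_mul]
        have := (norm_sub_le (deriv Ψ (f x)) (deriv Ψ (F k x))).trans
          (add_le_add (hL _) (hL _))
        gcongr
        · linarith
        · exact hC₁ x
      · filter_upwards [hFae'] with x hx
        have h1 := ((hΨ'.tendsto _).comp hx).const_sub (deriv Ψ (f x))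
        rw [sub_self] at h1
        simpa using (h1.mul_const (η x)).smul_const (g x)
    have t3 : Tendsto (fun k => eLpNorm (fun x => (Ψ (f x) - Ψ (F k x)) • gradient η x) q
        (volume.restrict Ω)) atTop (𝓝 0) := by
      refine tendsto_eLpNorm_zero_of_norm_le (L * C₂) hF2 fun k x => ?_
      have h1 := abs_sub_le_of_abs_deriv_le hΨ hL (f x) (F k x)
      rw [norm_smul, Pi.sub_apply, ← norm_neg (F k x - f x), neg_sub]
      calc _ ≤ (L * ‖f x - F k x‖) * C₂ :=
            mul_le_mul h1 (hC₂ x) (norm_nonneg _) (by positivity)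
        _ = _ := by ring
    refine tendsto_of_tendsto_of_tendsto_of_le_of_le tendsto_const_nhds
      (by simpa using (t1.add t2).add t3) (fun _ => zero_le) fun k => ?_
    have e : (fun x => (deriv Ψ (f x) * η x) • g x + Ψ (f x) • gradient η x) -
        gradient (fun x => Ψ (F k x) * η x) =
        ((fun x => (deriv Ψ (F k x) * η x) • (g x - G k x)) +
        fun x => ((deriv Ψ (f x) - deriv Ψ (F k x)) * η x) • g x) +
        fun x => (Ψ (f x) - Ψ (F k x)) • gradient η x := by
      ext1 x
      simp only [Pi.sub_apply, Pi.add_apply, hgrad]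
      module
    rw [e]
    refine (eLpNorm_add_le ?_ ?_ hq1).trans (add_le_add (eLpNorm_add_le ?_ ?_ hq1) le_rfl)
    · exact (((mΨ' (mF k)).mul mη).smul (mg.sub (mG k))).add
        ((((mΨ' mf).sub (mΨ' (mF k))).mul mη).smul mg)
    · exact ((mΨ mf).sub (mΨ (mF k))).smul mη'
    · exact ((mΨ' (mF k)).mul mη).smul (mg.sub (mG k))
    · exact (((mΨ' mf).sub (mΨ' (mF k))).mul mη).smul mg

end


/-! ### The Sobolev inequality on $W^{1,p}_0(\Omega)$. -/

/-- The constant of the Sobolev inequality in `ℝⁿ`. -/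
def sobolevConst (n : ℕ) (p : ℝ) : NNReal :=
  SNormLESNormFDerivOfEqConst ℝ (volume : Measure (Eucl n)) p

lemma IsTest.eLpNorm_le_gradient {n : ℕ} {p : ℝ} (hp : 1 ≤ p) (hpn : p < n) {Ω : Set (Eucl n)}
    {φ : Eucl n → ℝ} (hφ : IsTest 1 Ω φ) :
    eLpNorm φ (ENNReal.ofReal (n * p / (n - p))) (volume.restrict Ω) ≤
      sobolevConst n p *
        eLpNorm (gradient φ) (ENNReal.ofReal p) (volume.restrict Ω) := by
  have hn : (0 : ℝ) < n := by linarith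
  have h := eLpNorm_le_eLpNorm_fderiv_of_eq (volume : Measure (Eucl n)) hφ.1 hφ.2.1
    (p := p.toNNReal) (p' := (n * p / (n - p)).toNNReal) (by simpa using hp)
    (by rw [finrank_euclideanSpace_fin]; exact_mod_cast hn) (by
      have h1 : 0 ≤ n * p / (n - p) := div_nonneg (by positivity) (by linarith)
      have : (n : ℝ) - p ≠ 0 := by linarith
      rw [finrank_euclideanSpace_fin, Real.coe_toNNReal _ h1, NNReal.coe_inv,
        Real.coe_toNNReal p (by linarith)]
      field_simp)
  rw [Real.coe_toNNReal p (by linarith)] at h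
  refine (eLpNorm_mono_measure _ Measure.restrict_le_self).trans (h.trans (le_of_eq ?_))
  congr 1
  rw [eLpNorm_restrict_eq_of_support_subset ((support_gradient_subset φ).trans hφ.2.2)]
  refine eLpNorm_congr_norm_ae (Eventually.of_forall fun x => ?_)
  exact (norm_gradient φ x).symm

/-- Convergence in $L^p$ gives an almost everywhere convergent subsequence, and Fatou's lemma passes
the inequality for $C^1$ functions to the limit without assuming convergence in the larger exponent.
-/
lemma MemWZero.eLpNorm_le {n : ℕ} {p : ℝ} (hp : 1 ≤ p) (hpn : p < n) {Ω : Set (Eucl n)}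
    {f : Eucl n → ℝ} {g : Eucl n → Eucl n} (h : MemWZero Ω (ENNReal.ofReal p) f g) :
    eLpNorm f (ENNReal.ofReal (n * p / (n - p))) (volume.restrict Ω) ≤
      sobolevConst n p *
        eLpNorm g (ENNReal.ofReal p) (volume.restrict Ω) := by
  obtain ⟨⟨hf, hg, -⟩, φ, hφ, h1, h2⟩ := h
  have hp0 : ENNReal.ofReal p ≠ 0 := by simp; linarith
  have m1 : ∀ k, AEStronglyMeasurable (φ k) (volume.restrict Ω) := fun k =>
    (hφ k).1.continuous.aestronglyMeasurable
  have hm := tendstoInMeasure_of_tendsto_eLpNorm hp0 m1 hf.1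
    (h1.congr fun k => eLpNorm_sub_comm _ _ _ _)
  obtain ⟨v, hv, hae⟩ := hm.exists_seq_tendsto_ae
  set C := (sobolevConst n p : ℝ≥0∞)
  have hC : C ≠ ⊤ := ENNReal.coe_ne_top
  have hlim : Tendsto (fun k => C * (eLpNorm g (ENNReal.ofReal p) (volume.restrict Ω) +
      eLpNorm (g - gradient (φ (v k))) (ENNReal.ofReal p) (volume.restrict Ω))) atTop
      (𝓝 (C * eLpNorm g (ENNReal.ofReal p) (volume.restrict Ω))) := by
    have := (h2.comp hv.tendsto_atTop).const_add (eLpNorm g (ENNReal.ofReal p) (volume.restrict Ω))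
    rw [add_zero] at this
    exact ENNReal.Tendsto.const_mul this (Or.inr hC)
  rw [← hlim.liminf_eq]
  refine (Lp.eLpNorm_lim_le_liminf_eLpNorm (fun k => m1 (v k)) f hae).trans
    (liminf_le_liminf (Eventually.of_forall fun k => ?_))
  refine ((hφ (v k)).eLpNorm_le_gradient hp hpn).trans ?_
  gcongr
  have e : gradient (φ (v k)) = g - (g - gradient (φ (v k))) := by simp
  conv_lhs => rw [e]
  exact eLpNorm_sub_le hg.1 (hg.1.sub ((hφ _).continuous_gradient le_rfl).aestronglyMeasurable)
    (by simpa using hp)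


/-! ### The equation in integrated form -/

section
variable {ρ : ContDiffBump (0 : ℝ)} {t₁ t₂ : ℝ}

/-- A smooth approximation of the indicator function of `[t₁, t₂]`. -/
def timeCutoff (ρ : ContDiffBump (0 : ℝ)) (t₁ t₂ t : ℝ) : ℝ :=
  ∫ r in (t - t₂)..(t - t₁), ρ.normed volume r

lemma hasDerivAt_timeCutoff (t : ℝ) :
    HasDerivAt (timeCutoff ρ t₁ t₂) (ρ.normed volume (t - t₁) - ρ.normed volume (t - t₂)) t := by
  have hc := ρ.continuous_normed (μ := volume)
  have h : ∀ a : ℝ, HasDerivAt (fun t => ∫ r in (0 : ℝ)..(t - a), ρ.normed volume r)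
      (ρ.normed volume (t - a)) t := by
    intro a
    have h1 : HasDerivAt (fun x => ∫ r in (0 : ℝ)..x, ρ.normed volume r)
        (ρ.normed volume (t - a)) (t - a) :=
      intervalIntegral.integral_hasDerivAt_right (hc.intervalIntegrable _ _)
        (hc.stronglyMeasurableAtFilter _ _) hc.continuousAt
    have h2 := HasDerivAt.comp t h1 ((hasDerivAt_id t).sub_const a)
    rw [mul_one] at h2
    exact h2
  refine ((h t₁).sub (h t₂)).congr_of_eventuallyEq (Eventually.of_forall fun x => ?_)
  exact (intervalIntegral.integral_interval_sub_left (hc.intervalIntegrable _ _)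
    (hc.intervalIntegrable _ _)).symm

lemma deriv_timeCutoff (t : ℝ) : deriv (timeCutoff ρ t₁ t₂) t =
    ρ.normed volume (t - t₁) - ρ.normed volume (t - t₂) := (hasDerivAt_timeCutoff t).deriv

lemma contDiff_timeCutoff : ContDiff ℝ ∞ (timeCutoff ρ t₁ t₂) := by
  refine contDiff_infty_iff_deriv.2 ⟨fun t => (hasDerivAt_timeCutoff t).differentiableAt, ?_⟩
  rw [funext deriv_timeCutoff]
  exact (ρ.contDiff_normed.comp (contDiff_id.sub contDiff_const)).sub
    (ρ.contDiff_normed.comp (contDiff_id.sub contDiff_const))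

lemma abs_timeCutoff_le (t : ℝ) : |timeCutoff ρ t₁ t₂ t| ≤ 1 := by
  have h := intervalIntegral.norm_integral_le_integral_norm_uIoc (f := ρ.normed volume)
    (a := t - t₂) (b := t - t₁) (μ := volume)
  refine h.trans ((setIntegral_le_integral ρ.integrable_normed.norm
    (Eventually.of_forall fun _ => norm_nonneg _)).trans (le_of_eq ?_))
  simp_rw [Real.norm_of_nonneg (ρ.nonneg_normed _)]
  exact ρ.integral_normed

lemma timeCutoff_eq_zero (h : t₁ ≤ t₂) {t : ℝ} (ht : t ≤ t₁ - ρ.rOut ∨ t₂ + ρ.rOut ≤ t) :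
    timeCutoff ρ t₁ t₂ t = 0 := by
  unfold timeCutoff
  rw [intervalIntegral.integral_congr (g := fun _ => (0 : ℝ)), intervalIntegral.integral_zero]
  intro r hr
  rw [uIcc_of_le (by linarith)] at hr
  by_contra hne
  have : r ∈ Function.support (ρ.normed volume) := hne
  rw [ρ.support_normed_eq, mem_ball_zero_iff, Real.norm_eq_abs, abs_lt] at this
  rcases ht with ht | ht <;> linarith [hr.1, hr.2]

lemma timeCutoff_eq_one {t : ℝ} (h1 : t₁ + ρ.rOut ≤ t) (h2 : t ≤ t₂ - ρ.rOut) :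
    timeCutoff ρ t₁ t₂ t = 1 := by
  unfold timeCutoff
  rw [intervalIntegral.integral_eq_integral_of_support_subset, ρ.integral_normed]
  rw [ρ.support_normed_eq]
  intro r hr
  rw [mem_ball_zero_iff, Real.norm_eq_abs, abs_lt] at hr
  exact ⟨by linarith, by linarith⟩

lemma tsupport_timeCutoff_subset (h : t₁ ≤ t₂) :
    tsupport (timeCutoff ρ t₁ t₂) ⊆ Icc (t₁ - ρ.rOut) (t₂ + ρ.rOut) := by
  refine closure_minimal (fun t ht => ?_) isClosed_Icc
  by_contra hne
  refine ht (timeCutoff_eq_zero h ?_)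
  rw [mem_Icc, not_and_or, not_le, not_le] at hne
  exact hne.imp le_of_lt le_of_lt

end

open Convolution ContinuousLinearMap in
-- The hypothesis says $g'=-f$ weakly. Test it with a mollified indicator of $[t_1,t_2]$: its
-- derivative is a difference of two approximate Dirac masses, which act on the continuous $g$ in
-- the limit.
lemma sub_eq_integral_of_weak_deriv {T : ℝ} {g f : ℝ → ℝ} (hg : ContinuousOn g (Icc 0 T))
    (hf : IntegrableOn f (Ioo 0 T))
    (h : ∀ ζ : ℝ → ℝ, IsTest ∞ (Ioo 0 T) ζ →
      ∫ t in Ioo 0 T, deriv ζ t * g t = ∫ t in Ioo 0 T, ζ t * f t)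
    {t₁ t₂ : ℝ} (h1 : 0 < t₁) (h12 : t₁ ≤ t₂) (h2 : t₂ < T) :
    g t₁ - g t₂ = ∫ t in t₁..t₂, f t := by
  have hT : 0 ≤ T := by linarith
  -- Constant extension beyond $[0,T]$ makes the convergence theorem for mollifiers of continuous
  -- functions on $\mathbb R$ available.
  set G : ℝ → ℝ := IccExtend hT ((Icc 0 T).domRestrict g) with hG
  have hGc : Continuous G := hg.domRestrict.Icc_extend'
  have hGg : ∀ t ∈ Icc 0 T, G t = g t := fun t ht => IccExtend_of_mem hT _ ht
  -- Half the distance of $t_1,t_2$ to the ends of the interval, so that the cutoffs are supported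
  -- in $(0,T)$.
  set δ := min t₁ (T - t₂) / 2
  have hδ : 0 < δ := half_pos (lt_min h1 (by linarith))
  have hδ1 : δ < t₁ := (half_lt_self (lt_min h1 (by linarith))).trans_le (min_le_left _ _)
  have hδ2 : δ < T - t₂ := (half_lt_self (lt_min h1 (by linarith))).trans_le (min_le_right _ _)
  let ρ : ℕ → ContDiffBump (0 : ℝ) := fun k =>
    ⟨δ / (k + 1) / 2, δ / (k + 1), by positivity, half_lt_self (by positivity)⟩
  have hρ : Tendsto (fun k => (ρ k).rOut) atTop (𝓝 0) := by
    have := (tendsto_one_div_add_atTop_nhds_zero_nat (𝕜 := ℝ)).const_mul δ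
    simpa [ρ, div_eq_mul_inv] using this
  have hρδ : ∀ k, (ρ k).rOut ≤ δ := fun k => div_le_self hδ.le (by simp)
  have htest : ∀ k, IsTest ∞ (Ioo 0 T) (timeCutoff (ρ k) t₁ t₂) := fun k =>
    ⟨contDiff_timeCutoff, HasCompactSupport.of_support_subset_isCompact isCompact_Icc
      ((subset_tsupport _).trans (tsupport_timeCutoff_subset h12)),
      (tsupport_timeCutoff_subset h12).trans (Icc_subset_Ioo (by linarith [hρδ k])
        (by linarith [hρδ k]))⟩
  have hmol : ∀ a : ℝ, Tendsto (fun k => ∫ t, (ρ k).normed volume (t - a) * G t) atTop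
      (𝓝 (G a)) := by
    intro a
    refine (ContDiffBump.convolution_tendsto_right_of_continuous (μ := volume) hρ hGc a).congr
      fun k => ?_
    rw [convolution_lsmul_swap]
    refine integral_congr_ae (Eventually.of_forall fun t => ?_)
    simp only [smul_eq_mul]
    rw [← (ρ k).normed_neg, neg_sub]
  have hL : Tendsto (fun k => ∫ t in Ioo 0 T, deriv (timeCutoff (ρ k) t₁ t₂) t * g t) atTop
      (𝓝 (G t₁ - G t₂)) := by
    refine ((hmol t₁).sub (hmol t₂)).congr fun k => ?_
    have i : ∀ a, Integrable (fun t => (ρ k).normed volume (t - a) * G t) := fun a => by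
      refine Continuous.integrable_of_hasCompactSupport
        (((ρ k).continuous_normed.comp (continuous_id.sub continuous_const)).mul hGc) ?_
      exact HasCompactSupport.mul_right
        ((ρ k).hasCompactSupport_normed.comp_homeomorph (Homeomorph.subRight a))
    rw [← integral_sub (i _) (i _)]
    have hz : ∀ t, t ∉ Ioo 0 T → deriv (timeCutoff (ρ k) t₁ t₂) t * G t = 0 := by
      intro t ht
      rw [image_eq_zero_of_notMem_tsupport (f := deriv (timeCutoff (ρ k) t₁ t₂)), zero_mul]
      exact fun h => ht ((htest k).2.2 (tsupport_deriv_subset h))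
    rw [setIntegral_congr_fun measurableSet_Ioo (g := fun t =>
      deriv (timeCutoff (ρ k) t₁ t₂) t * G t)
      (fun t ht => by simp only [hGg t (Ioo_subset_Icc_self ht)]),
      setIntegral_eq_integral_of_forall_compl_eq_zero hz]
    refine integral_congr_ae (Eventually.of_forall fun t => ?_)
    simp only [deriv_timeCutoff]
    ring
  have hR : Tendsto (fun k => ∫ t in Ioo 0 T, timeCutoff (ρ k) t₁ t₂ t * f t) atTop
      (𝓝 (∫ t in Ioo 0 T, (Ioc t₁ t₂).indicator f t)) := by
    refine tendsto_integral_of_dominated_convergence (fun t => ‖f t‖)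
      (fun k => contDiff_timeCutoff.continuous.aestronglyMeasurable.mul hf.1) hf.norm
      (fun k => Eventually.of_forall fun t => ?_) ?_
    · rw [norm_mul]
      exact mul_le_of_le_one_left (norm_nonneg _) (abs_timeCutoff_le t)
    · have hne : ∀ᵐ t : ℝ ∂(volume.restrict (Ioo 0 T)), t ≠ t₁ ∧ t ≠ t₂ :=
        (ae_restrict_of_ae (Measure.ae_ne volume t₁)).and (ae_restrict_of_ae (Measure.ae_ne volume t₂))
      filter_upwards [hne] with t ht
      by_cases hm : t ∈ Ioc t₁ t₂
      · rw [indicator_of_mem hm]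
        have e1 := hρ.eventually (gt_mem_nhds (show 0 < t - t₁ by linarith [hm.1]))
        have e2 := hρ.eventually (gt_mem_nhds (show 0 < t₂ - t by
          linarith [lt_of_le_of_ne hm.2 ht.2]))
        refine tendsto_const_nhds.congr' ?_
        filter_upwards [e1, e2] with k k1 k2
        rw [timeCutoff_eq_one (by linarith) (by linarith), one_mul]
      · rw [indicator_of_notMem hm]
        refine tendsto_const_nhds.congr' ?_
        rw [mem_Ioc, not_and_or, not_lt, not_le] at hm
        rcases hm with hm | hm
        · have e1 := hρ.eventually (gt_mem_nhds (show 0 < t₁ - t by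
            linarith [lt_of_le_of_ne hm ht.1]))
          filter_upwards [e1] with k k1
          rw [timeCutoff_eq_zero h12 (Or.inl (by linarith)), zero_mul]
        · have e1 := hρ.eventually (gt_mem_nhds (show 0 < t - t₂ by linarith))
          filter_upwards [e1] with k k1
          rw [timeCutoff_eq_zero h12 (Or.inr (by linarith)), zero_mul]
  have := tendsto_nhds_unique hL (hR.congr fun k => (h _ (htest k)).symm)
  rw [hGg t₁ ⟨h1.le, by linarith⟩, hGg t₂ ⟨by linarith, h2.le⟩] at this
  rw [this, setIntegral_indicator measurableSet_Ioc, intervalIntegral.integral_of_le h12]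
  congr 2
  exact inter_eq_right.2 fun t ht => ⟨h1.trans ht.1, ht.2.trans_lt h2⟩


section
variable {n : ℕ} {Ω : Set (Eucl n)} {q : ℝ≥0∞} [Fact (1 ≤ q)]

/-- The continuous inclusion of `V₀` into `L²(Ω)`. -/
def VZero.fnL : VZero Ω q →L[ℝ] LTwo Ω :=
  (ContinuousLinearMap.fst ℝ (LTwo Ω) (Lp (Eucl n) q (volume.restrict Ω))).comp
    (submoduleVZero Ω q).subtypeL

lemma VZero.fn_smul (a : ℝ) (v : VZero Ω q) : (a • v).fn = a • v.fn := rfl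

lemma VZero.grad_smul (a : ℝ) (v : VZero Ω q) : (a • v).grad = a • v.grad := rfl

lemma V.norm_grad_le (v : V Ω q) : ‖v.grad‖ ≤ ‖v‖ := le_max_right _ _

/-- The embedding of `L²(Ω)` into `V₀'`. -/
def VZeroDual.ofLTwo (f : LTwo Ω) : VZeroDual Ω q :=
  show StrongDual ℝ (VZero Ω q) from (innerSL ℝ f).comp VZero.fnL

lemma VZeroDual.pairing_ofLTwo (f : LTwo Ω) (v : VZero Ω q) :
    (VZeroDual.ofLTwo f : VZeroDual Ω q).pairing v = inner ℝ f v.fn := rfl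

lemma VZeroDual.pairing_smul_left (a : ℝ) (w : VZeroDual Ω q) (v : VZero Ω q) :
    (a • w).pairing v = a * w.pairing v := rfl

lemma VZeroDual.pairing_smul_right (a : ℝ) (w : VZeroDual Ω q) (v : VZero Ω q) :
    w.pairing (a • v) = a * w.pairing v :=
  map_smul (show StrongDual ℝ (VZero Ω q) from w) a v

lemma IsTest.setIntegral_deriv_mul {T : ℝ} {ζ θ : ℝ → ℝ} (hζ : IsTest ∞ (Ioo 0 T) ζ)
    (hθ : IsTest ∞ (Ioo 0 T) θ) :
    ∫ t in Ioo 0 T, deriv ζ t * θ t = - ∫ t in Ioo 0 T, ζ t * deriv θ t := by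
  have hc {φ : ℝ → ℝ} (h : IsTest ∞ (Ioo 0 T) φ) : Continuous (deriv φ) :=
    h.1.continuous_deriv (by norm_cast)
  have z1 : ∫ t in Ioo 0 T, deriv ζ t * θ t = ∫ t, deriv ζ t * θ t := by
    refine setIntegral_eq_integral_of_forall_compl_eq_zero fun t ht => ?_
    rw [image_eq_zero_of_notMem_tsupport (fun h => ht (hθ.2.2 h)), mul_zero]
  have z2 : ∫ t in Ioo 0 T, ζ t * deriv θ t = ∫ t, ζ t * deriv θ t := by
    refine setIntegral_eq_integral_of_forall_compl_eq_zero fun t ht => ?_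
    rw [image_eq_zero_of_notMem_tsupport (fun h => ht (hζ.2.2 h)), zero_mul]
  rw [z1, z2, integral_mul_deriv_eq_deriv_mul_of_integrable (u := ζ) (v := θ)
    (fun t _ => (hζ.1.differentiable (by norm_cast) t).hasDerivAt)
    (fun t _ => (hθ.1.differentiable (by norm_cast) t).hasDerivAt)
    ((hζ.1.continuous.mul (hc hθ)).integrable_of_hasCompactSupport hζ.2.1.mul_right)
    (((hc hζ).mul hθ.1.continuous).integrable_of_hasCompactSupport hθ.2.1.mul_left)
    ((hζ.1.continuous.mul hθ.1.continuous).integrable_of_hasCompactSupport hζ.2.1.mul_right),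
    neg_neg]

/-- Separated functions $\zeta(t)v$ are the only test functions taken from the definition of a weak
solution. Their time derivative is $\zeta'v\in L^2(\Omega)\subseteq V_0'$. -/
lemma memXZero_smul {p T : ℝ} [Fact (1 ≤ ENNReal.ofReal p)] {ζ : ℝ → ℝ}
    (hζ : IsTest ∞ (Ioo 0 T) ζ) (v : VZero Ω (ENNReal.ofReal p)) :
    MemXZero Ω p T (fun t => ζ t • v) := by
  have hc : Continuous (deriv ζ) := hζ.1.continuous_deriv (by norm_cast)
  refine ⟨?_, fun t => deriv ζ t • VZeroDual.ofLTwo v.fn, ?_, fun θ hθ v' => ?_⟩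
  · exact (hζ.1.continuous.smul continuous_const).memLp_of_hasCompactSupport hζ.2.1.smul_right
  · exact (hc.smul continuous_const).memLp_of_hasCompactSupport hζ.2.1.deriv.smul_right
  · simp only [VZero.fn_smul, inner_smul_left, VZeroDual.pairing_smul_left,
      VZeroDual.pairing_ofLTwo, ← mul_assoc, integral_mul_const]
    rw [← neg_mul, ← hθ.setIntegral_deriv_mul hζ]
    rfl

end

section
variable {n : ℕ} {Ω : Set (Eucl n)} {p T : ℝ} [Fact (1 ≤ ENNReal.ofReal p)]

lemma prod_restrict_spaceTime (Ω : Set (Eucl n)) (T : ℝ) :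
    (volume.restrict Ω).prod (timeMeasure T) = volume.restrict (spaceTime Ω T) :=
  Measure.prod_restrict _ _

lemma Represents.memLp {G : Type*} [NormedAddCommGroup G] {r : ℝ≥0∞} (hr0 : r ≠ 0) (hr : r ≠ ⊤)
    {f : Eucl n × ℝ → G} {F : ℝ → Lp G r (volume.restrict Ω)}
    (h : Represents Ω T f (fun t => F t))
    (hF : ∫⁻ t, ‖F t‖ₑ ^ r.toReal ∂(timeMeasure T) < ⊤) :
    MemLp f r (volume.restrict (spaceTime Ω T)) := by
  refine ⟨h.1, ?_⟩
  have hm := h.1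
  rw [← prod_restrict_spaceTime] at hm ⊢
  rw [eLpNorm_lt_top_iff_lintegral_rpow_enorm_lt_top hr0 hr,
    lintegral_prod_symm _ (hm.enorm.pow_const _)]
  refine lt_of_le_of_lt (le_of_eq (lintegral_congr_ae ?_)) hF
  filter_upwards [h.2] with t ht
  have e : ‖F t‖ₑ = eLpNorm (F t) r (volume.restrict Ω) := Lp.enorm_def _
  rw [e, ← eLpNorm_congr_ae ht, eLpNorm_eq_lintegral_rpow_enorm_toReal hr0 hr, ← ENNReal.rpow_mul,
    one_div_mul_cancel (ENNReal.toReal_pos hr0 hr).ne', ENNReal.rpow_one]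

end


/-- A weak solution in the form in which it is used below: measurable representatives of `u`, of
its gradient `D` and of the field `A`, the continuous representative `c`, and the equation
integrated in time. -/
structure WeakData {n : ℕ} (Ω : Set (Eucl n)) (p T : ℝ) [Fact (1 ≤ ENNReal.ofReal p)]
    (E₁ Ep : Eucl n → ℝ) (u : Eucl n × ℝ → ℝ) (U : ℝ → V Ω (ENNReal.ofReal p))
    (c : ℝ → LTwo Ω) (D A : Eucl n × ℝ → Eucl n) : Prop where
  isOpen : IsOpen Ω
  isBounded : Bornology.IsBounded Ω
  measurable_u : StronglyMeasurable u
  measurable_D : StronglyMeasurable D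
  measurable_A : StronglyMeasurable A
  memLp_u : MemLp u 2 (volume.restrict (spaceTime Ω T))
  memLp_D : MemLp D (ENNReal.ofReal p) (volume.restrict (spaceTime Ω T))
  memLp_A : MemLp A (ENNReal.ofReal p.conjExponent) volume
  continuousOn : ContinuousOn c (Icc 0 T)
  slice : ∀ᵐ t ∂(timeMeasure T), c t = (U t).fn ∧
    (fun x => u (x, t)) =ᵐ[volume.restrict Ω] c t ∧
    (fun x => D (x, t)) =ᵐ[volume.restrict Ω] (U t).grad
  field : ∀ᵐ y ∂(volume.restrict (spaceTime Ω T)), ∃ ζ ∈ subdifferential E₁ (D y),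
    A y = ζ + gradient Ep (D y)
  weak : ∀ (v : VZero Ω (ENNReal.ofReal p)) (t₁ t₂ : ℝ), 0 < t₁ → t₁ ≤ t₂ → t₂ < T →
    inner ℝ (c t₁) v.fn - inner ℝ (c t₂) v.fn =
      ∫ t in t₁..t₂, ∫ x in Ω, inner ℝ (A (x, t)) (v.grad x)

section
variable {n : ℕ} {Ω : Set (Eucl n)} {p T : ℝ}

lemma ae_slice_of_ae_spaceTime {P : Eucl n × ℝ → Prop}
    (h : ∀ᵐ y ∂(volume.restrict (spaceTime Ω T)), P y) :
    ∀ᵐ t ∂(timeMeasure T), ∀ᵐ x ∂(volume.restrict Ω), P (x, t) := by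
  rw [← prod_restrict_spaceTime] at h
  have h2 := Measure.measurePreserving_swap (μ := timeMeasure T) (ν := volume.restrict Ω)
    |>.quasiMeasurePreserving.ae h
  exact Measure.ae_ae_of_ae_prod h2

lemma integrable_inner_of_memLp {q q' : ℝ≥0∞} [q'.HolderConjugate q] {X : Type*}
    [MeasurableSpace X] {μ : Measure X}
    {A B : X → Eucl n} (hA : MemLp A q' μ) (hB : MemLp B q μ) :
    Integrable (fun x => inner ℝ (A x) (B x)) μ := by
  have h := memLp_one_iff_integrable.1 (hB.norm.mul' hA.norm (r := 1))
  exact h.mono (hA.1.inner hB.1) (Eventually.of_forall fun x => by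
    simpa using abs_real_inner_le_norm (A x) (B x))

lemma holderConjugate_ofReal {p : ℝ} (hp : 1 < p) :
    (ENNReal.ofReal p.conjExponent).HolderConjugate (ENNReal.ofReal p) :=
  (Real.HolderConjugate.conjExponent hp).symm.ennrealOfReal

/-- The field has growth $K+\Lambda|D|^{p-1}$, and $|D|^{p-1}\in L^{p/(p-1)}=L^{p'}$. The constant
is integrable because the measure is finite. -/
lemma memLp_field {lam Lam K : ℝ} {E₁ Ep : Eucl n → ℝ} (hE : IsDensityPair p lam Lam E₁ Ep)
    (hK : ∀ z, ∀ ζ ∈ subdifferential E₁ z, ‖ζ‖ ≤ K) (hp : 1 < p) {X : Type*}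
    [MeasurableSpace X] {μ : Measure X} [IsFiniteMeasure μ]
    {D Z : X → Eucl n} (hD : MemLp D (ENNReal.ofReal p) μ) (hZm : AEStronglyMeasurable Z μ)
    (hZ : ∀ᵐ y ∂μ, Z y ∈ subdifferential E₁ (D y)) :
    MemLp (fun y => Z y + gradient Ep (D y)) (ENNReal.ofReal p.conjExponent) μ := by
  have h1 := hD.norm_rpow_div (ENNReal.ofReal (p - 1))
  rw [ENNReal.toReal_ofReal (by linarith), ← ENNReal.ofReal_div_of_pos (by linarith)] at h1
  have h2 : MemLp (fun y => K + Lam * ‖D y‖ ^ (p - 1)) (ENNReal.ofReal p.conjExponent) μ :=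
    (memLp_const K).add (h1.const_mul Lam)
  refine h2.mono (hZm.add ((continuous_gradient_density hE).comp_aestronglyMeasurable hD.1)) ?_
  filter_upwards [hZ] with y hy
  exact (norm_field_le hE hK hy).trans (le_abs_self _)

lemma IsWeakSolution.exists_weakData [Fact (1 ≤ ENNReal.ofReal p)] {lam Lam K : ℝ} {E₁ Ep : Eucl n → ℝ}
    (hE : IsDensityPair p lam Lam E₁ Ep)
    (hK : ∀ z, ∀ ζ ∈ subdifferential E₁ z, ‖ζ‖ ≤ K) (hp : 1 < p) (hΩ : IsOpen Ω)
    (hΩb : Bornology.IsBounded Ω) {u : Eucl n × ℝ → ℝ} (h : IsWeakSolution Ω p T E₁ Ep u) :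
    ∃ u' U c D A, u' =ᵐ[volume.restrict (spaceTime Ω T)] u ∧ WeakData Ω p T E₁ Ep u' U c D A := by
  obtain ⟨U, w, Du, Z, ⟨hU, hw, hder⟩, ⟨c, hc, hcU⟩, hu, hDu, hZ, hZE, heq⟩ := h
  have hp0 : 0 < p := by linarith
  have hS : MeasurableSet (spaceTime Ω T) := hΩ.measurableSet.prod measurableSet_Ioo
  have hfin : IsFiniteMeasure (volume.restrict Ω) :=
    isFiniteMeasure_restrict.2 hΩb.measure_lt_top.ne
  have hfin2 : IsFiniteMeasure (volume.restrict (spaceTime Ω T)) := by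
    rw [← prod_restrict_spaceTime]
    infer_instance
  -- Space-time square integrability comes from the bound of the continuous representative on the
  -- compact interval $[0,T]$.
  have hu2 : MemLp u 2 (volume.restrict (spaceTime Ω T)) := by
    refine hu.memLp two_ne_zero ENNReal.ofNat_ne_top ?_
    obtain ⟨M, hM⟩ := isCompact_Icc.exists_bound_of_continuousOn hc
    refine lt_of_le_of_lt (lintegral_mono_ae (g := fun _ => ENNReal.ofReal M ^ 2) ?_) ?_
    · filter_upwards [hcU, ae_restrict_mem measurableSet_Ioo] with t ht htT
      rw [← ht, ENNReal.toReal_ofNat, ENNReal.rpow_ofNat]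
      gcongr
      rw [← ofReal_norm]
      exact ENNReal.ofReal_le_ofReal (hM t (Ioo_subset_Icc_self htT))
    · rw [lintegral_const]
      exact ENNReal.mul_lt_top (by simp) (measure_lt_top _ _)
  have hpE0 : ENNReal.ofReal p ≠ 0 := by simpa using hp0
  have hD2 : MemLp Du (ENNReal.ofReal p) (volume.restrict (spaceTime Ω T)) := by
    refine hDu.memLp hpE0 ENNReal.ofReal_ne_top (F := fun t => (U t).grad) ?_
    refine lt_of_le_of_lt (lintegral_mono fun t => ?_)
      (lintegral_rpow_enorm_lt_top_of_eLpNorm_lt_top hpE0 ENNReal.ofReal_ne_top hU.2)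
    refine ENNReal.rpow_le_rpow ?_ ENNReal.toReal_nonneg
    rw [← ofReal_norm, ← ofReal_norm]
    exact ENNReal.ofReal_le_ofReal (V.norm_grad_le _)
  have hA2 := memLp_field hE hK hp hD2 hZ.1 hZE
  set A₀ : Eucl n × ℝ → Eucl n := fun y => Z y + gradient Ep (Du y) with hA₀
  -- Strongly measurable representatives extended by zero. In particular $A\in L^{p'}(\mathbb
  -- R^n\times\mathbb R)$, so $A$ can be translated in time without boundary effects.
  set u' := (spaceTime Ω T).indicator (hu2.1.mk u) with hu'
  set D := (spaceTime Ω T).indicator (hD2.1.mk Du) with hD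
  set A := (spaceTime Ω T).indicator (hA2.1.mk A₀) with hA
  have eu : u' =ᵐ[volume.restrict (spaceTime Ω T)] u :=
    (indicator_ae_eq_restrict hS).trans hu2.1.ae_eq_mk.symm
  have eD : D =ᵐ[volume.restrict (spaceTime Ω T)] Du :=
    (indicator_ae_eq_restrict hS).trans hD2.1.ae_eq_mk.symm
  have eA : A =ᵐ[volume.restrict (spaceTime Ω T)] A₀ :=
    (indicator_ae_eq_restrict hS).trans hA2.1.ae_eq_mk.symm
  refine ⟨u', U, c, D, A, eu, ?_⟩
  have hAv : MemLp A (ENNReal.ofReal p.conjExponent) volume :=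
    (memLp_indicator_iff_restrict hS).2 (hA2.ae_eq hA2.1.ae_eq_mk)
  refine ⟨hΩ, hΩb, hu2.1.stronglyMeasurable_mk.indicator hS, hD2.1.stronglyMeasurable_mk.indicator hS,
    hA2.1.stronglyMeasurable_mk.indicator hS, hu2.ae_eq eu.symm, hD2.ae_eq eD.symm, hAv, hc, ?_,
    ?_, ?_⟩
  · filter_upwards [hcU, hu.2, hDu.2, ae_slice_of_ae_spaceTime eu, ae_slice_of_ae_spaceTime eD]
      with t h1 h2 h3 h4 h5
    rw [h1]
    exact ⟨rfl, EventuallyEq.trans h4 h2, EventuallyEq.trans h5 h3⟩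
  · filter_upwards [hZE, eD, eA] with y h1 h2 h3
    exact ⟨Z y, by rwa [h2], by rw [h3, h2]⟩
  · intro v t₁ t₂ ht1 ht12 ht2
    have := holderConjugate_ofReal hp
    have hint : Integrable (fun y : Eucl n × ℝ => inner ℝ (A y) (v.grad y.1))
        ((volume.restrict Ω).prod (timeMeasure T)) := by
      refine integrable_inner_of_memLp (q := ENNReal.ofReal p)
        (q' := ENNReal.ofReal p.conjExponent) ?_ ((Lp.memLp v.grad).comp_fst _)
      rw [prod_restrict_spaceTime]
      exact hAv.restrict _
    refine sub_eq_integral_of_weak_deriv (T := T) (g := fun t => inner ℝ (c t) v.fn)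
      (hc.inner continuousOn_const) hint.integral_prod_right (fun ζ hζ => ?_) ht1 ht12 ht2
    have e1 := heq _ (memXZero_smul hζ v)
    have e2 := hder ζ hζ v
    have e3 : ∫ t in Ioo 0 T, deriv ζ t * inner ℝ (c t) v.fn =
        ∫ t in Ioo 0 T, deriv ζ t * inner ℝ (U t).fn v.fn := by
      refine integral_congr_ae ?_
      filter_upwards [hcU] with t ht
      rw [ht]
    have e4 : ∫ t in Ioo 0 T, ∫ x in Ω, inner ℝ (Z (x, t) + gradient Ep (Du (x, t)))
        ((ζ t • v).grad x) =
        ∫ t in Ioo 0 T, ζ t * ∫ x in Ω, inner ℝ (A (x, t)) (v.grad x) := by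
      refine integral_congr_ae ?_
      filter_upwards [ae_slice_of_ae_spaceTime eA] with t ht
      rw [← integral_const_mul]
      refine integral_congr_ae ?_
      filter_upwards [ht, Lp.coeFn_smul (ζ t) v.grad] with x hx hx2
      rw [VZero.grad_smul, hx2, Pi.smul_apply, inner_smul_right, hx]
    simp only [VZeroDual.pairing_smul_right] at e1
    rw [e3]
    linarith

end


/-! ### The energy inequality -/

/-- The mean over $[t_1,t_2]$ telescopes:
$\int_{t_1}^{t_2}(f(t)-f(t-h))\,dt=\int_{t_2-h}^{t_2}f-\int_{t_1-h}^{t_1}f$. Divided by $h$ it tends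
to $f(t_2)-f(t_1)$. -/
lemma sub_le_of_integral_sub_translate_le {f : ℝ → ℝ} {T C t₁ t₂ : ℝ}
    (hf : ContinuousOn f (Icc 0 T)) (h1 : 0 < t₁) (h12 : t₁ ≤ t₂) (h2 : t₂ < T)
    (H : ∀ᶠ h in 𝓝[>] 0, ∫ t in t₁..t₂, (f t - f (t - h)) ≤ h * C) : f t₂ - f t₁ ≤ C := by
  have hT : 0 ≤ T := by linarith
  set F : ℝ → ℝ := IccExtend hT ((Icc 0 T).domRestrict f) with hF
  have hFc : Continuous F := hf.domRestrict.Icc_extend'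
  have hFf : ∀ t ∈ Icc 0 T, F t = f t := fun t ht => IccExtend_of_mem hT _ ht
  set P : ℝ → ℝ := fun x => ∫ t in (0 : ℝ)..x, F t
  have hP : ∀ x, HasDerivAt P (F x) x := fun x =>
    intervalIntegral.integral_hasDerivAt_right (hFc.intervalIntegrable _ _)
      (hFc.stronglyMeasurableAtFilter _ _) hFc.continuousAt
  have hPs : ∀ a : ℝ, HasDerivAt (fun h => P (a - h)) (-F a) 0 := by
    intro a
    have h3 : HasDerivAt P (F a) (a - 0) := by simpa using hP a
    have := HasDerivAt.comp (0 : ℝ) h3 ((hasDerivAt_id (0 : ℝ)).const_sub a)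
    rw [mul_neg_one] at this
    exact this
  have hk := ((hPs t₁).sub (hPs t₂)).tendsto_slope_zero_right
  rw [← hFf t₁ ⟨h1.le, by linarith⟩, ← hFf t₂ ⟨by linarith, h2.le⟩]
  have e : -F t₁ - -F t₂ = F t₂ - F t₁ := by ring
  rw [e] at hk
  refine le_of_tendsto hk ?_
  filter_upwards [H, self_mem_nhdsWithin, nhdsWithin_le_nhds (gt_mem_nhds h1)] with h hh hpos hlt
  have hpos : 0 < h := hpos
  have hint : ∀ a b, IntervalIntegrable F volume a b := fun a b => hFc.intervalIntegrable a b
  have e1 : ∫ t in t₁..t₂, (f t - f (t - h)) = (P t₂ - P t₁) - (P (t₂ - h) - P (t₁ - h)) := by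
    have a1 : ∀ a b, P b - P a = ∫ t in a..b, F t := fun a b =>
      intervalIntegral.integral_interval_sub_left (hint _ _) (hint _ _)
    have i1 : IntervalIntegrable (fun x => F (x - h)) volume t₁ t₂ :=
      (hFc.comp (continuous_id.sub continuous_const)).intervalIntegrable _ _
    rw [a1, a1, ← intervalIntegral.integral_comp_sub_right (f := F),
      ← intervalIntegral.integral_sub (hint _ _) i1]
    refine intervalIntegral.integral_congr fun t ht => ?_
    rw [uIcc_of_le h12] at ht
    rw [hFf t ⟨by linarith [ht.1], by linarith [ht.2]⟩,
      hFf (t - h) ⟨by linarith [ht.1], by linarith [ht.2]⟩]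
  rw [e1] at hh
  simp only [Pi.sub_apply, zero_add, sub_zero, smul_eq_mul]
  rw [inv_mul_le_iff₀ hpos]
  linarith

section
variable {n : ℕ} {Ω : Set (Eucl n)} {Ψ Φ : ℝ → ℝ} {L : ℝ} {θ : Eucl n → ℝ}

/-- A convex function `Φ` with derivative `Ψ`, where `Ψ` is Lipschitz and `Φ(0) = Ψ(0) = 0`. -/
structure IsConvexPair (Ψ Φ : ℝ → ℝ) (L : ℝ) : Prop where
  contDiff : ContDiff ℝ 1 Ψ
  abs_deriv_le : ∀ s, |deriv Ψ s| ≤ L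
  fun_zero : Ψ 0 = 0
  continuous_prim : Continuous Φ
  prim_zero : Φ 0 = 0
  prim_sub_le : ∀ a b, Φ b - Φ a ≤ Ψ b * (b - a)

namespace IsConvexPair

variable (h : IsConvexPair Ψ Φ L)
include h

lemma abs_fun_le (s : ℝ) : |Ψ s| ≤ L * |s| := by
  simpa [h.fun_zero] using abs_sub_le_of_abs_deriv_le h.contDiff h.abs_deriv_le s 0

lemma prim_nonneg (s : ℝ) : 0 ≤ Φ s := by
  have := h.prim_sub_le s 0
  rw [h.prim_zero, h.fun_zero] at this
  linarith

lemma prim_le (s : ℝ) : Φ s ≤ L * s ^ 2 := by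
  have h1 := h.prim_sub_le 0 s
  rw [h.prim_zero, sub_zero, sub_zero] at h1
  have h2 := le_abs_self (Ψ s * s)
  rw [abs_mul] at h2
  have h3 := mul_le_mul_of_nonneg_right (h.abs_fun_le s) (abs_nonneg s)
  rw [← sq_abs]
  nlinarith

lemma memLp_fun_mul {X : Type*} [MeasurableSpace X] {μ : Measure X} {q : ℝ≥0∞} {f η : X → ℝ}
    (hf : MemLp f q μ) (hη : AEStronglyMeasurable η μ) {C : ℝ} (hC : ∀ x, ‖η x‖ ≤ C) :
    MemLp (fun x => Ψ (f x) * η x) q μ := by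
  refine (hf.const_mul (L * C)).mono
    ((h.contDiff.continuous.comp_aestronglyMeasurable hf.1).mul hη) (Eventually.of_forall fun x => ?_)
  have hL : 0 ≤ L := (abs_nonneg _).trans (h.abs_deriv_le 0)
  rw [norm_mul, norm_mul, norm_mul, Real.norm_of_nonneg hL,
    Real.norm_of_nonneg ((norm_nonneg _).trans (hC x))]
  calc ‖Ψ (f x)‖ * ‖η x‖ ≤ (L * ‖f x‖) * C :=
        mul_le_mul (h.abs_fun_le _) (hC x) (norm_nonneg _) (by positivity)
    _ = _ := by ring

lemma integrable_prim_mul {X : Type*} [MeasurableSpace X] {μ : Measure X} {f η : X → ℝ}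
    (hf : MemLp f 2 μ) (hη : AEStronglyMeasurable η μ) {C : ℝ} (hC : ∀ x, ‖η x‖ ≤ C) :
    Integrable (fun x => Φ (f x) * η x) μ := by
  refine (hf.integrable_sq.const_mul (L * C)).mono
    ((h.continuous_prim.comp_aestronglyMeasurable hf.1).mul hη) (Eventually.of_forall fun x => ?_)
  have hL : 0 ≤ L := (abs_nonneg _).trans (h.abs_deriv_le 0)
  have hC0 : 0 ≤ C := (norm_nonneg _).trans (hC x)
  rw [norm_mul, Real.norm_of_nonneg (h.prim_nonneg _),
    Real.norm_of_nonneg (show 0 ≤ L * C * f x ^ 2 by positivity)]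
  calc Φ (f x) * ‖η x‖ ≤ (L * f x ^ 2) * C :=
        mul_le_mul (h.prim_le _) (hC x) (norm_nonneg _) (by positivity)
    _ = _ := by ring

/-- `Ψ(b) θ` as an element of `L²(Ω)`. -/
lemma memLp_two (hθ : IsTest 1 Ω θ) (b : LTwo Ω) :
    MemLp (fun x => Ψ (b x) * θ x) 2 (volume.restrict Ω) := by
  obtain ⟨C, hC⟩ := hθ.2.1.exists_bound_of_continuous hθ.1.continuous
  exact h.memLp_fun_mul (Lp.memLp b) hθ.1.continuous.aestronglyMeasurable hC

lemma integral_prim_sub_le (hθ : IsTest 1 Ω θ) (hθ0 : ∀ x, 0 ≤ θ x) (a b : LTwo Ω) :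
    (∫ x in Ω, Φ (b x) * θ x) - (∫ x in Ω, Φ (a x) * θ x) ≤
      inner ℝ (b - a) ((h.memLp_two hθ b).toLp _) := by
  obtain ⟨C, hC⟩ := hθ.2.1.exists_bound_of_continuous hθ.1.continuous
  have hm : AEStronglyMeasurable θ (volume.restrict Ω) := hθ.1.continuous.aestronglyMeasurable
  have i1 := h.integrable_prim_mul (Lp.memLp b) hm hC
  have i2 := h.integrable_prim_mul (Lp.memLp a) hm hC
  rw [← integral_sub i1 i2, L2.inner_def]
  refine integral_mono_ae (i1.sub i2) (L2.integrable_inner _ _) ?_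
  filter_upwards [Lp.coeFn_sub b a, (h.memLp_two hθ b).coeFn_toLp] with x h1 h2
  rw [h1, h2, Pi.sub_apply]
  have := mul_le_mul_of_nonneg_right (h.prim_sub_le (a x) (b x)) (hθ0 x)
  simp only [RCLike.inner_apply, conj_trivial]
  linarith

/-- The convexity inequality used in both directions, with the Cauchy–Schwarz inequality, makes
$v\mapsto\int\Phi(v)\theta$ Lipschitz on bounded subsets of $L^2(\Omega)$. -/
lemma continuousOn_integral_prim (hθ : IsTest 1 Ω θ) (hθ0 : ∀ x, 0 ≤ θ x) {T : ℝ}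
    {c : ℝ → LTwo Ω} (hc : ContinuousOn c (Icc 0 T)) :
    ContinuousOn (fun t => ∫ x in Ω, Φ (c t x) * θ x) (Icc 0 T) := by
  obtain ⟨C, hC⟩ := hθ.2.1.exists_bound_of_continuous hθ.1.continuous
  have hC0 : 0 ≤ C := (norm_nonneg _).trans (hC 0)
  have hL : 0 ≤ L := (abs_nonneg _).trans (h.abs_deriv_le 0)
  obtain ⟨M, hM⟩ := isCompact_Icc.exists_bound_of_continuousOn hc
  have hb : ∀ b : LTwo Ω, ‖(h.memLp_two hθ b).toLp _‖ ≤ L * C * ‖b‖ := by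
    intro b
    refine Lp.norm_le_mul_norm_of_ae_le_mul ?_
    filter_upwards [(h.memLp_two hθ b).coeFn_toLp] with x hx
    rw [hx, norm_mul]
    calc ‖Ψ (b x)‖ * ‖θ x‖ ≤ (L * ‖b x‖) * C :=
          mul_le_mul (h.abs_fun_le _) (hC x) (norm_nonneg _) (by positivity)
      _ = _ := by ring
  have key : ∀ t ∈ Icc 0 T, ∀ s ∈ Icc 0 T, (∫ x in Ω, Φ (c t x) * θ x) -
      (∫ x in Ω, Φ (c s x) * θ x) ≤
      L * C * M * ‖c t - c s‖ := by
    intro t ht s hs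
    refine (h.integral_prim_sub_le hθ hθ0 (c s) (c t)).trans ((real_inner_le_norm _ _).trans ?_)
    rw [mul_comm]
    exact mul_le_mul_of_nonneg_right ((hb _).trans
      (mul_le_mul_of_nonneg_left (hM t ht) (by positivity))) (norm_nonneg _)
  intro t ht
  have hct : Tendsto (fun s => L * C * M * ‖c s - c t‖) (𝓝[Icc 0 T] t) (𝓝 0) := by
    have : Tendsto (fun s => c s) (𝓝[Icc 0 T] t) (𝓝 (c t)) := hc t ht
    simpa using (this.sub_const (c t)).norm.const_mul (L * C * M)
  refine tendsto_iff_norm_sub_tendsto_zero.2 (squeeze_zero' (Eventually.of_forall fun _ =>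
    norm_nonneg _) ?_ hct)
  filter_upwards [self_mem_nhdsWithin] with s hs
  rw [Real.norm_eq_abs, abs_le]
  constructor
  · have := key t ht s hs
    rw [norm_sub_rev] at this
    linarith
  · exact key s hs t ht

end IsConvexPair

end


/-! ### Time translations of the field. -/

section
variable {n : ℕ} {Ω : Set (Eucl n)}

lemma integral_norm_inner_le {q q' : ℝ≥0∞} [q'.HolderConjugate q] {X : Type*}
    [MeasurableSpace X] {μ : Measure X} {A B : X → Eucl n} (hA : MemLp A q' μ) (hB : MemLp B q μ) :
    ∫ x, ‖(inner ℝ (A x) (B x) : ℝ)‖ ∂μ ≤ (eLpNorm A q' μ).toReal * (eLpNorm B q μ).toReal := by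
  rw [integral_norm_eq_lintegral_enorm (hA.1.inner hB.1), ← ENNReal.toReal_mul]
  refine ENNReal.toReal_mono (ENNReal.mul_ne_top hA.eLpNorm_ne_top hB.eLpNorm_ne_top) ?_
  rw [← eLpNorm_one_eq_lintegral_enorm]
  have h := eLpNorm_le_eLpNorm_mul_eLpNorm_of_nnnorm (p := q') (q := q) (r := 1) hA.1 hB.1
    (fun a b => (inner ℝ a b : ℝ)) 1 (Eventually.of_forall fun x => by
      simpa using nnnorm_inner_le_nnnorm (𝕜 := ℝ) (A x) (B x))
  simpa using h

lemma abs_integral_inner_le {q q' : ℝ≥0∞} [q'.HolderConjugate q] {X : Type*}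
    [MeasurableSpace X] {μ : Measure X} {A B : X → Eucl n} (hA : MemLp A q' μ) (hB : MemLp B q μ) :
    |∫ x, inner ℝ (A x) (B x) ∂μ| ≤ (eLpNorm A q' μ).toReal * (eLpNorm B q μ).toReal :=
  (norm_integral_le_integral_norm _).trans (integral_norm_inner_le hA hB)

instance : (volume : Measure (Eucl n × ℝ)).IsAddHaarMeasure := by
  rw [Measure.volume_eq_prod]
  infer_instance

/-- The translate of `A` by `r` in time. -/
def timeShift (A : Eucl n × ℝ → Eucl n) (r : ℝ) (y : Eucl n × ℝ) : Eucl n := A (y.1, y.2 - r)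

lemma timeShift_eq (A : Eucl n × ℝ → Eucl n) (r : ℝ) :
    timeShift A r = fun y => A (y - (0, r)) := by
  ext1 y
  simp only [timeShift]
  congr 1
  ext1 <;> simp

lemma measurePreserving_timeShift (r : ℝ) :
    MeasurePreserving (fun y : Eucl n × ℝ => y - (0, r)) volume volume :=
  measurePreserving_sub_right volume _

variable {q q' : ℝ≥0∞} [q'.HolderConjugate q] {A G : Eucl n × ℝ → Eucl n} {t₁ t₂ : ℝ}
  (hAm : StronglyMeasurable A) (hA : MemLp A q' volume) (hGm : StronglyMeasurable G)
  (hG : MemLp G q (volume.restrict (Ω ×ˢ Ioc t₁ t₂)))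

include hA in
lemma memLp_timeShift (r : ℝ) : MemLp (timeShift A r) q' volume := by
  rw [timeShift_eq]
  exact hA.comp_measurePreserving (measurePreserving_timeShift r)

include hA in
lemma eLpNorm_timeShift (r : ℝ) : eLpNorm (timeShift A r) q' volume = eLpNorm A q' volume := by
  rw [timeShift_eq]
  exact eLpNorm_comp_measurePreserving hA.1 (measurePreserving_timeShift r)

lemma tendsto_eLpNorm_timeShift_sub [Fact (1 ≤ q')] (hq : q' ≠ ⊤) (hA : MemLp A q' volume) :
    Tendsto (fun r => eLpNorm (timeShift A r - A) q' volume) (𝓝 0) (𝓝 0) := by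
  have h := tendsto_eLpNorm_translate hq hA
  have h2 : Tendsto (fun r : ℝ => ((0, r) : Eucl n × ℝ)) (𝓝 0) (𝓝 0) :=
    (Continuous.prodMk_right (0 : Eucl n)).tendsto' _ _ rfl
  refine (h.comp h2).congr fun r => ?_
  rw [timeShift_eq]
  rfl

include hA hG in
lemma abs_integral_timeShift_sub_le (r : ℝ) :
    |(∫ y in Ω ×ˢ Ioc t₁ t₂, inner ℝ (timeShift A r y) (G y)) -
      (∫ y in Ω ×ˢ Ioc t₁ t₂, inner ℝ (A y) (G y))| ≤
    (eLpNorm (timeShift A r - A) q' volume).toReal *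
      (eLpNorm G q (volume.restrict (Ω ×ˢ Ioc t₁ t₂))).toReal := by
  have h1 := (memLp_timeShift hA r).restrict (Ω ×ˢ Ioc t₁ t₂)
  have h2 := hA.restrict (Ω ×ˢ Ioc t₁ t₂)
  rw [← integral_sub (integrable_inner_of_memLp h1 hG) (integrable_inner_of_memLp h2 hG)]
  simp_rw [← inner_sub_left]
  refine (abs_integral_inner_le (h1.sub h2) hG).trans ?_
  exact mul_le_mul_of_nonneg_right (ENNReal.toReal_mono
    ((memLp_timeShift hA r).sub hA).eLpNorm_ne_top
    (eLpNorm_mono_measure _ Measure.restrict_le_self)) ENNReal.toReal_nonneg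

include hAm hA hGm hG in
lemma integrable_timeShift_inner (h : ℝ) :
    Integrable (fun z : ℝ × (Eucl n × ℝ) => inner ℝ (timeShift A (h * z.1) z.2) (G z.2))
      ((volume.restrict (Ioc 0 1)).prod (volume.restrict (Ω ×ˢ Ioc t₁ t₂))) := by
  have hm : StronglyMeasurable fun z : ℝ × (Eucl n × ℝ) =>
      (inner ℝ (timeShift A (h * z.1) z.2) (G z.2) : ℝ) := by
    refine StronglyMeasurable.inner ?_ (hGm.comp_measurable measurable_snd)
    exact hAm.comp_measurable (g := fun z : ℝ × (Eucl n × ℝ) => (z.2.1, z.2.2 - h * z.1))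
      (by fun_prop)
  rw [integrable_prod_iff hm.aestronglyMeasurable]
  refine ⟨Eventually.of_forall fun σ =>
    integrable_inner_of_memLp (q := q) (q' := q') ((memLp_timeShift hA (h * σ)).restrict _) hG, ?_⟩
  refine Integrable.of_bound hm.norm.aestronglyMeasurable.integral_prod_right'
    ((eLpNorm A q' volume).toReal * (eLpNorm G q (volume.restrict (Ω ×ˢ Ioc t₁ t₂))).toReal)
    (Eventually.of_forall fun σ => ?_)
  have h1 := (memLp_timeShift hA (h * σ)).restrict (Ω ×ˢ Ioc t₁ t₂)
  rw [Real.norm_of_nonneg (integral_nonneg fun _ => norm_nonneg _)]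
  refine (integral_norm_inner_le h1 hG).trans ?_
  refine mul_le_mul_of_nonneg_right (ENNReal.toReal_mono hA.eLpNorm_ne_top ?_)
    ENNReal.toReal_nonneg
  rw [← eLpNorm_timeShift hA (h * σ)]
  exact eLpNorm_mono_measure _ Measure.restrict_le_self

include hAm hA hGm hG in
-- Fubini's theorem moves the average over $\sigma\in(0,1]$ outside. For fixed $\sigma$ the inner
-- integral pairs the translate of $A$ by $h\sigma$ with the untranslated $G$, so only $A$ must be
-- close to its translates.
lemma integral_integral_timeShift (h : ℝ) :
    Integrable (fun t => ∫ σ in Ioc (0 : ℝ) 1, ∫ x in Ω, inner ℝ (A (x, t - h * σ)) (G (x, t)))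
      (volume.restrict (Ioc t₁ t₂)) ∧
    Integrable (fun σ => ∫ y in Ω ×ˢ Ioc t₁ t₂, inner ℝ (timeShift A (h * σ) y) (G y))
      (volume.restrict (Ioc (0 : ℝ) 1)) ∧
    ∫ t in Ioc t₁ t₂, ∫ σ in Ioc (0 : ℝ) 1, ∫ x in Ω, inner ℝ (A (x, t - h * σ)) (G (x, t)) =
      ∫ σ in Ioc (0 : ℝ) 1, ∫ y in Ω ×ˢ Ioc t₁ t₂, inner ℝ (timeShift A (h * σ) y) (G y) := by
  have hi := integrable_timeShift_inner hAm hA hGm hG h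
  have hi1 := hi
  rw [Measure.volume_eq_prod, ← Measure.prod_restrict] at hi1
  have hi2 := (measurePreserving_prodAssoc (volume.restrict (Ioc (0 : ℝ) 1)) (volume.restrict Ω)
    (volume.restrict (Ioc t₁ t₂))).integrable_comp_of_integrable hi1
  have e : (fun t => ∫ z : ℝ × Eucl n, inner ℝ (A (z.2, t - h * z.1)) (G (z.2, t))
      ∂((volume.restrict (Ioc (0 : ℝ) 1)).prod (volume.restrict Ω))) =ᵐ[volume.restrict (Ioc t₁ t₂)]
      fun t => ∫ σ in Ioc (0 : ℝ) 1, ∫ x in Ω, inner ℝ (A (x, t - h * σ)) (G (x, t)) := by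
    filter_upwards [hi2.prod_left_ae] with t ht
    exact integral_prod _ ht
  refine ⟨hi2.integral_prod_right.congr e, hi.integral_prod_left, ?_⟩
  rw [← integral_congr_ae e, ← integral_prod _ hi, Measure.volume_eq_prod (Eucl n) ℝ,
    ← Measure.prod_restrict, ← (measurePreserving_prodAssoc _ _ _).integral_comp'
      (f := MeasurableEquiv.prodAssoc)]
  exact (integral_prod_symm _ hi2).symm

end


/-- The spatial gradient of `Ψ(u) θ`. -/
def testGrad {n : ℕ} (Ψ : ℝ → ℝ) (θ : Eucl n → ℝ) (u : Eucl n × ℝ → ℝ) (D : Eucl n × ℝ → Eucl n)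
    (y : Eucl n × ℝ) : Eucl n :=
  (deriv Ψ (u y) * θ y.1) • D y + Ψ (u y) • gradient θ y.1

namespace WeakData

variable {n : ℕ} {Ω : Set (Eucl n)} {p T : ℝ} [Fact (1 ≤ ENNReal.ofReal p)]
    {E₁ Ep : Eucl n → ℝ} {u : Eucl n × ℝ → ℝ} {U : ℝ → V Ω (ENNReal.ofReal p)}
    {c : ℝ → LTwo Ω} {D A : Eucl n × ℝ → Eucl n} (d : WeakData Ω p T E₁ Ep u U c D A)
    {Ψ Φ : ℝ → ℝ} {L : ℝ} {θ : Eucl n → ℝ}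

include d

lemma isFiniteMeasure_restrict : IsFiniteMeasure (volume.restrict Ω) :=
  MeasureTheory.isFiniteMeasure_restrict.2 d.isBounded.measure_lt_top.ne

lemma isFiniteMeasure_restrict_spaceTime :
    IsFiniteMeasure (volume.restrict (spaceTime Ω T)) := by
  have := d.isFiniteMeasure_restrict
  rw [← prod_restrict_spaceTime]
  infer_instance

lemma stronglyMeasurable_testGrad (hΨ : ContDiff ℝ 1 Ψ) (hθ : IsTest 1 Ω θ) :
    StronglyMeasurable (testGrad Ψ θ u D) := by
  have h1 : StronglyMeasurable fun y : Eucl n × ℝ => θ y.1 :=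
    (hθ.1.continuous.comp continuous_fst).stronglyMeasurable
  have h2 : StronglyMeasurable fun y : Eucl n × ℝ => gradient θ y.1 :=
    ((hθ.continuous_gradient le_rfl).comp continuous_fst).stronglyMeasurable
  exact ((((hΨ.continuous_deriv le_rfl).comp_stronglyMeasurable d.measurable_u).mul h1).smul
    d.measurable_D).add ((hΨ.continuous.comp_stronglyMeasurable d.measurable_u).smul h2)

lemma memLp_testGrad (hp2 : p ≤ 2) (h : IsConvexPair Ψ Φ L) (hθ : IsTest 1 Ω θ) :
    MemLp (testGrad Ψ θ u D) (ENNReal.ofReal p) (volume.restrict (spaceTime Ω T)) := by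
  have := d.isFiniteMeasure_restrict_spaceTime
  obtain ⟨C₁, hC₁⟩ := hθ.2.1.exists_bound_of_continuous hθ.1.continuous
  obtain ⟨C₂, hC₂⟩ := hθ.hasCompactSupport_gradient.exists_bound_of_continuous
    (hθ.continuous_gradient le_rfl)
  have hL : 0 ≤ L := (abs_nonneg _).trans (h.abs_deriv_le 0)
  have hu : MemLp u (ENNReal.ofReal p) (volume.restrict (spaceTime Ω T)) :=
    d.memLp_u.mono_exponent (by
      rw [← ENNReal.ofReal_ofNat 2]
      exact ENNReal.ofReal_le_ofReal hp2)
  refine ((d.memLp_D.norm.const_mul (L * C₁)).add (hu.norm.const_mul (L * C₂))).mono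
    (d.stronglyMeasurable_testGrad h.contDiff hθ).aestronglyMeasurable
    (Eventually.of_forall fun y => ?_)
  refine le_trans ?_ (le_abs_self _)
  refine (norm_add_le _ _).trans (add_le_add ?_ ?_)
  · rw [norm_smul, norm_mul]
    refine mul_le_mul_of_nonneg_right ?_ (norm_nonneg _)
    exact mul_le_mul (h.abs_deriv_le _) (hC₁ _) (norm_nonneg _) hL
  · rw [norm_smul]
    calc ‖Ψ (u y)‖ * ‖gradient θ y.1‖ ≤ (L * |u y|) * C₂ :=
          mul_le_mul (h.abs_fun_le _) (hC₂ _) (norm_nonneg _) (by positivity)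
      _ = L * C₂ * ‖u y‖ := by rw [Real.norm_eq_abs]; ring

lemma ae_memWZero (hΨ : ContDiff ℝ 1 Ψ) (hL : ∀ s, |deriv Ψ s| ≤ L)
    (hθ : IsTest 1 Ω θ) : ∀ᵐ t ∂(timeMeasure T),
    MemWZero Ω (ENNReal.ofReal p) (fun x => Ψ (u (x, t)) * θ x)
      (fun x => testGrad Ψ θ u D (x, t)) := by
  filter_upwards [d.slice] with t ⟨h1, h2, h3⟩
  have hm : MemW Ω (ENNReal.ofReal p) (U t).fn (U t).grad := (U t).2
  refine (hm.memWZero_comp_mul ENNReal.ofReal_ne_top d.isOpen hΨ hL hθ).congr ?_ ?_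
  · filter_upwards [h2] with x hx
    rw [hx, h1]
  · filter_upwards [h2, h3] with x hx hx3
    rw [testGrad, hx, h1, hx3]

/-- For fixed $t$ the slice $\Psi(u(t))\theta$ belongs to $V_0$ and is used as a time-independent
test function in the equation integrated over $(s,t)$. The exceptional null set concerns $t$ only
and not $s$. -/
lemma ae_sub_le (h : IsConvexPair Ψ Φ L) (hθ : IsTest 1 Ω θ) (hθ0 : ∀ x, 0 ≤ θ x) :
    ∀ᵐ t ∂(timeMeasure T), ∀ s, 0 < s → s ≤ t →
      (∫ x in Ω, Φ (c t x) * θ x) - (∫ x in Ω, Φ (c s x) * θ x) ≤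
        - ∫ r in s..t, ∫ x in Ω, inner ℝ (A (x, r)) (testGrad Ψ θ u D (x, t)) := by
  filter_upwards [d.slice, d.ae_memWZero h.contDiff h.abs_deriv_le hθ,
    ae_restrict_mem measurableSet_Ioo] with t ⟨h1, h2, h3⟩ hW htT s hs hst
  have hGm := hW.1.2.1
  let v : VZero Ω (ENNReal.ofReal p) := ⟨((h.memLp_two hθ (c t)).toLp _, hGm.toLp _), by
    refine hW.congr ?_ hGm.coeFn_toLp.symm
    filter_upwards [(h.memLp_two hθ (c t)).coeFn_toLp, h2] with x hx hx2
    rw [hx, hx2]⟩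
  have hv := d.weak v s t hs hst htT.2
  refine (h.integral_prim_sub_le hθ hθ0 (c s) (c t)).trans (le_of_eq ?_)
  have e1 : inner ℝ (c t - c s) ((h.memLp_two hθ (c t)).toLp _) =
      -(inner ℝ (c s) v.fn - inner ℝ (c t) v.fn) := by
    rw [inner_sub_left]
    change _ - _ = -(inner ℝ (c s) ((h.memLp_two hθ (c t)).toLp _) -
      inner ℝ (c t) ((h.memLp_two hθ (c t)).toLp _))
    ring
  rw [e1, hv]
  congr 1
  refine intervalIntegral.integral_congr fun r _ => integral_congr_ae ?_
  have e2 : v.grad =ᵐ[volume.restrict Ω] fun x => testGrad Ψ θ u D (x, t) := hGm.coeFn_toLp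
  filter_upwards [e2] with x hx
  rw [hx]

/-- Take $s=t-a$ in `ae_sub_le`, integrate over $t\in(t_1,t_2]$ and divide by $a$. The right side is
then an average of pairings of translates of $A$ with the test gradient, and tends to the pairing
with $A$ as $a\to0$. -/
theorem energy_le (hp : 1 < p) (hp2 : p ≤ 2) (h : IsConvexPair Ψ Φ L) (hθ : IsTest 1 Ω θ)
    (hθ0 : ∀ x, 0 ≤ θ x) {t₁ t₂ : ℝ} (h1 : 0 < t₁) (h12 : t₁ ≤ t₂) (h2 : t₂ < T) :
    (∫ x in Ω, Φ (c t₂ x) * θ x) - (∫ x in Ω, Φ (c t₁ x) * θ x) ≤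
      - ∫ y in Ω ×ˢ Ioc t₁ t₂, inner ℝ (A y) (testGrad Ψ θ u D y) := by
  have hpq := holderConjugate_ofReal hp
  set q := ENNReal.ofReal p
  set q' := ENNReal.ofReal p.conjExponent
  have hq' : Fact (1 ≤ q') := ⟨ENNReal.one_le_ofReal.2
    (Real.HolderConjugate.conjExponent hp).symm.lt.le⟩
  set G := testGrad Ψ θ u D with hGdef
  have hGm := d.stronglyMeasurable_testGrad h.contDiff hθ
  have hIoc : Ioc t₁ t₂ ⊆ Ioo 0 T := fun t ht => ⟨h1.trans ht.1, ht.2.trans_lt h2⟩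
  have hG : MemLp G q (volume.restrict (Ω ×ˢ Ioc t₁ t₂)) :=
    (d.memLp_testGrad hp2 h hθ).mono_measure (Measure.restrict_mono_set _
      (prod_mono_right hIoc))
  set f : ℝ → ℝ := fun t => ∫ x in Ω, Φ (c t x) * θ x with hf
  have hfc : ContinuousOn f (Icc 0 T) := h.continuousOn_integral_prim hθ hθ0 d.continuousOn
  set N := (eLpNorm G q (volume.restrict (Ω ×ˢ Ioc t₁ t₂))).toReal
  have hN : 0 ≤ N := ENNReal.toReal_nonneg
  -- The error at step $a$ is at most $\varepsilon N$, where $N$ is the $L^p$ norm of the test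
  -- gradient and $\varepsilon$ bounds the translation error of $A$ in $L^{p'}$.
  suffices H : ∀ ε > 0, f t₂ - f t₁ ≤
      - (∫ y in Ω ×ˢ Ioc t₁ t₂, inner ℝ (A y) (G y)) + ε * N by
    refine le_of_forall_pos_le_add fun ε hε => ?_
    refine (H (ε / (N + 1)) (by positivity)).trans (add_le_add le_rfl ?_)
    rw [div_mul_eq_mul_div]
    exact div_le_of_le_mul₀ (by positivity) hε.le (by nlinarith)
  intro ε hε
  refine sub_le_of_integral_sub_translate_le hfc h1 h12 h2 ?_
  have hτ := (ENNReal.tendsto_nhds_zero.1 (tendsto_eLpNorm_timeShift_sub ENNReal.ofReal_ne_top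
    d.memLp_A)) (ENNReal.ofReal ε) (by simpa using hε)
  obtain ⟨δ, hδ, hb⟩ := Metric.eventually_nhds_iff_ball.1 hτ
  filter_upwards [self_mem_nhdsWithin, nhdsWithin_le_nhds (gt_mem_nhds hδ),
    nhdsWithin_le_nhds (gt_mem_nhds h1)] with a ha0 haδ hat
  have ha0 : 0 < a := ha0
  obtain ⟨i1, i2, i3⟩ := integral_integral_timeShift d.measurable_A d.memLp_A hGm hG a
  have s1 : ∀ᵐ t ∂(volume.restrict (Ioc t₁ t₂)), f t - f (t - a) ≤
      -(a * ∫ σ in Ioc (0 : ℝ) 1, ∫ x in Ω, inner ℝ (A (x, t - a * σ)) (G (x, t))) := by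
    have := ae_restrict_of_ae_restrict_of_subset hIoc (d.ae_sub_le h hθ hθ0)
    filter_upwards [this, ae_restrict_mem measurableSet_Ioc] with t ht htI
    refine (ht (t - a) (by linarith [htI.1]) (by linarith)).trans (le_of_eq ?_)
    -- Substitution $r=t-a\sigma$, which puts all step sizes on the common interval $(0,1]$.
    rw [← intervalIntegral.integral_of_le zero_le_one, intervalIntegral.integral_comp_sub_mul
      (f := fun r => ∫ x in Ω, inner ℝ (A (x, r)) (G (x, t))) ha0.ne']
    simp only [mul_one, mul_zero, sub_zero, smul_eq_mul]
    rw [mul_inv_cancel_left₀ ha0.ne']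
  have c1 : ContinuousOn f (Icc t₁ t₂) :=
    hfc.mono (Icc_subset_Icc h1.le h2.le)
  have c2 : ContinuousOn (fun t => f (t - a)) (Icc t₁ t₂) :=
    hfc.comp (continuous_id.sub continuous_const).continuousOn
      fun t ht => ⟨sub_nonneg.2 (by linarith [ht.1]), by
        have := ht.2
        exact (sub_le_self t ha0.le).trans (by linarith)⟩
  have c3 : IntegrableOn (fun t => f t - f (t - a)) (Ioc t₁ t₂) :=
    ((c1.sub c2).integrableOn_Icc).mono_set Ioc_subset_Icc_self
  rw [intervalIntegral.integral_of_le h12]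
  refine (integral_mono_ae c3 (i1.const_mul a).neg s1).trans ?_
  rw [integral_neg', integral_const_mul, i3]
  set J := ∫ y in Ω ×ˢ Ioc t₁ t₂, inner ℝ (A y) (G y)
  have s2 : J - ε * N ≤ ∫ σ in Ioc (0 : ℝ) 1,
      ∫ y in Ω ×ˢ Ioc t₁ t₂, inner ℝ (timeShift A (a * σ) y) (G y) := by
    have e : ∫ σ in Ioc (0 : ℝ) 1, (J - ε * N) = J - ε * N := by simp
    rw [← e]
    refine setIntegral_mono_on (integrable_const _) i2 measurableSet_Ioc fun σ hσ => ?_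
    have k1 := abs_integral_timeShift_sub_le d.memLp_A hG (a * σ)
    have k2 : (eLpNorm (timeShift A (a * σ) - A) q' volume).toReal ≤ ε := by
      refine ENNReal.toReal_le_of_le_ofReal hε.le (hb _ ?_)
      rw [mem_ball_zero_iff, Real.norm_of_nonneg (mul_nonneg ha0.le hσ.1.le)]
      nlinarith [hσ.1, hσ.2]
    have k3 := (abs_le.1 (k1.trans (mul_le_mul_of_nonneg_right k2 hN))).1
    linarith
  nlinarith [mul_le_mul_of_nonneg_left s2 ha0.le]

end WeakData


/-! ### Spatial cutoff functions. -/

lemma exists_bound_deriv_smoothTransition :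
    ∃ B : ℝ, 1 ≤ B ∧ ∀ s, |deriv Real.smoothTransition s| ≤ B := by
  have hc : Continuous (deriv Real.smoothTransition) :=
    (Real.smoothTransition.contDiff (n := 1)).continuous_deriv le_rfl
  obtain ⟨B, hB⟩ := (isCompact_Icc (a := (0 : ℝ)) (b := 1)).exists_bound_of_continuousOn
    hc.continuousOn
  refine ⟨max B 1, le_max_right _ _, fun s => ?_⟩
  have h0 : ∀ {c : ℝ}, Real.smoothTransition =ᶠ[𝓝 s] (fun _ => c) →
      |deriv Real.smoothTransition s| ≤ max B 1 := by
    intro c h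
    rw [h.deriv_eq, deriv_const, abs_zero]
    exact zero_le_one.trans (le_max_right _ _)
  rcases lt_or_ge s 0 with h | h
  · exact h0 ((gt_mem_nhds h).mono fun r hr => Real.smoothTransition.zero_of_nonpos (le_of_lt hr))
  rcases lt_or_ge 1 s with h' | h'
  · exact h0 ((lt_mem_nhds h').mono fun r hr => Real.smoothTransition.one_of_one_le (le_of_lt hr))
  · exact (hB s ⟨h, h'⟩).trans (le_max_left _ _)

/-- Smooth cutoff functions between concentric balls. -/
lemma exists_ball_cutoff : ∃ B : ℝ, 1 ≤ B ∧ ∀ (n : ℕ) (x₀ : Eucl n) (ρ₁ ρ₂ : ℝ), 0 ≤ ρ₂ →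
    ρ₂ < ρ₁ → ∃ η : Eucl n → ℝ, IsTest 1 (Metric.closedBall x₀ ρ₁) η ∧ (∀ x, 0 ≤ η x) ∧
      (∀ x, η x ≤ 1) ∧ (∀ x ∈ Metric.ball x₀ ρ₂, η x = 1) ∧
      (∀ x ∉ Metric.ball x₀ ρ₁, η x = 0) ∧ ∀ x, ‖gradient η x‖ ≤ B / (ρ₁ - ρ₂) := by
  obtain ⟨B, hB1, hB⟩ := exists_bound_deriv_smoothTransition
  refine ⟨2 * B, by linarith, fun n x₀ ρ₁ ρ₂ h0 h => ?_⟩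
  have hd : 0 < ρ₁ ^ 2 - ρ₂ ^ 2 := by nlinarith
  have hr : 0 < ρ₁ - ρ₂ := sub_pos.2 h
  -- The squared norm makes $g$ smooth at the centre. Its slope on the ball is at most
  -- $2\rho_1/(\rho_1^2-\rho_2^2)\le2/(\rho_1-\rho_2)$.
  set g : Eucl n → ℝ := fun x => (ρ₁ ^ 2 - ‖x - x₀‖ ^ 2) / (ρ₁ ^ 2 - ρ₂ ^ 2) with hg
  have hgc : ContDiff ℝ 1 g :=
    (contDiff_const.sub ((contDiff_id.sub contDiff_const).norm_sq ℝ)).div_const _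
  have hz : ∀ x ∉ Metric.ball x₀ ρ₁, Real.smoothTransition (g x) = 0 := by
    intro x hx
    rw [mem_ball_iff_norm, not_lt] at hx
    refine Real.smoothTransition.zero_of_nonpos (div_nonpos_of_nonpos_of_nonneg ?_ hd.le)
    nlinarith
  have hts : tsupport (fun x => Real.smoothTransition (g x)) ⊆ Metric.closedBall x₀ ρ₁ := by
    refine closure_minimal (fun x hx => ?_) Metric.isClosed_closedBall
    by_contra hx'
    exact hx (hz x fun hb => hx' (Metric.ball_subset_closedBall hb))
  have hη1 : ContDiff ℝ 1 fun x => Real.smoothTransition (g x) :=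
    (Real.smoothTransition.contDiff (n := 1)).comp hgc
  refine ⟨fun x => Real.smoothTransition (g x), ⟨hη1, ?_, hts⟩,
    fun x => Real.smoothTransition.nonneg _, fun x => Real.smoothTransition.le_one _, ?_, hz, ?_⟩
  · exact (isCompact_closedBall x₀ ρ₁).of_isClosed_subset (isClosed_tsupport _) hts
  · intro x hx
    rw [mem_ball_iff_norm] at hx
    refine Real.smoothTransition.one_of_one_le ((one_le_div hd).2 ?_)
    nlinarith [norm_nonneg (x - x₀)]
  · intro x
    rw [norm_gradient]
    by_cases hx : x ∈ Metric.closedBall x₀ ρ₁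
    · rw [mem_closedBall_iff_norm] at hx
      have hgd : HasFDerivAt g ((ρ₁ ^ 2 - ρ₂ ^ 2)⁻¹ • -((2 : ℝ) • (innerSL ℝ (x - x₀)))) x := by
        have h1 : HasFDerivAt (fun x : Eucl n => ‖x - x₀‖ ^ 2) ((2 : ℝ) • (innerSL ℝ (x - x₀))) x := by
          simpa [ofNat_smul_eq_nsmul] using ((hasFDerivAt_id x).sub_const x₀).norm_sq
        have h2 := (h1.const_sub (ρ₁ ^ 2)).const_mul (ρ₁ ^ 2 - ρ₂ ^ 2)⁻¹
        refine h2.congr_of_eventuallyEq (Eventually.of_forall fun y => ?_)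
        simp only [hg, div_eq_inv_mul]
      have hS := ((Real.smoothTransition.contDiff (n := 1)).differentiable one_ne_zero
        (g x)).hasDerivAt
      have h3 := hS.comp_hasFDerivAt x hgd
      have h4 : fderiv ℝ (fun x => Real.smoothTransition (g x)) x = _ := h3.fderiv
      rw [h4, norm_smul, norm_smul, norm_neg, norm_smul, innerSL_apply_norm,
        Real.norm_of_nonneg (inv_nonneg.2 hd.le)]
      calc ‖deriv Real.smoothTransition (g x)‖ *
            ((ρ₁ ^ 2 - ρ₂ ^ 2)⁻¹ * (‖(2 : ℝ)‖ * ‖x - x₀‖))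
          ≤ B * ((ρ₁ ^ 2 - ρ₂ ^ 2)⁻¹ * (2 * ρ₁)) := by
            have h5 : ‖(2 : ℝ)‖ = 2 := by norm_num
            rw [h5]
            refine mul_le_mul (hB _) ?_ (by positivity) (by linarith)
            gcongr
        _ ≤ 2 * B / (ρ₁ - ρ₂) := by
            rw [← div_eq_inv_mul, ← mul_div_assoc, div_le_div_iff₀ hd hr]
            have : 0 ≤ B * ((ρ₁ - ρ₂) * ρ₂) := by positivity
            nlinarith
    · have : gradient (fun x => Real.smoothTransition (g x)) x = 0 := by
        by_contra hne
        exact hx (hts (support_gradient_subset _ hne))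
      rw [← norm_gradient, this, norm_zero]
      positivity

/-- The square of a test function is a test function. -/
lemma IsTest.sq {n : ℕ} {Ω : Set (Eucl n)} {η : Eucl n → ℝ} (h : IsTest 1 Ω η) :
    IsTest 1 Ω (fun x => η x ^ 2) := by
  have hs : tsupport (fun x => η x ^ 2) ⊆ tsupport η := by
    refine closure_mono fun x hx hx' => hx ?_
    simp only [hx', ne_eq, OfNat.ofNat_ne_zero, not_false_eq_true, zero_pow]
  exact ⟨h.1.pow 2, h.2.1.of_isClosed_subset (isClosed_tsupport _) hs, hs.trans h.2.2⟩

lemma gradient_sq {n : ℕ} {η : Eucl n → ℝ} (h : Differentiable ℝ η) (x : Eucl n) :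
    gradient (fun x => η x ^ 2) x = (2 * η x) • gradient η x := by
  have := ((h x).hasFDerivAt.pow 2).fderiv
  simp only [gradient]
  rw [this]
  simp


/-! ### Energy estimates for truncated powers. -/

lemma isConvexPair_test {M m : ℝ} (hM : 0 < M) (hm : 0 ≤ m) :
    IsConvexPair (testFun M m) (testPrim M m) (M ^ m * (1 + 2 * m)) where
  contDiff := contDiff_testFun hM
  abs_deriv_le := abs_deriv_testFun_le hM hm
  fun_zero := testFun_zero
  continuous_prim := continuous_iff_continuousAt.2 fun s => (hasDerivAt_testPrim hM s).continuousAt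
  prim_zero := testPrim_zero
  prim_sub_le := testPrim_sub_le hM hm

/-- The density of the energy of level `2 + 2 m`, truncated at height `M`. -/
def truncDensity (M m s : ℝ) : ℝ := (1 + s ^ 2) * trunc M s ^ m

lemma truncDensity_nonneg {M m : ℝ} (hM : 0 < M) (s : ℝ) : 0 ≤ truncDensity M m s :=
  mul_nonneg (by positivity) (Real.rpow_nonneg (trunc_pos hM s).le m)

lemma continuous_truncDensity {M m : ℝ} (hM : 0 < M) : Continuous (truncDensity M m) :=
  (by fun_prop : Continuous fun s : ℝ => 1 + s ^ 2).mul
    (contDiff_trunc_rpow (k := 0) hM m).continuous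

lemma truncDensity_le {M m : ℝ} (hM : 0 < M) (hm : 0 ≤ m) (s : ℝ) :
    truncDensity M m s ≤ (1 + s ^ 2) ^ (1 + m) := by
  rw [Real.rpow_one_add' (by positivity) (by positivity)]
  exact mul_le_mul_of_nonneg_left (Real.rpow_le_rpow (trunc_pos hM s).le
    (trunc_le_right hM s) hm) (by positivity)

namespace WeakData

variable {n : ℕ} {Ω : Set (Eucl n)} {p T : ℝ} [Fact (1 ≤ ENNReal.ofReal p)]
    {E₁ Ep : Eucl n → ℝ} {u : Eucl n × ℝ → ℝ} {U : ℝ → V Ω (ENNReal.ofReal p)}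
    {c : ℝ → LTwo Ω} {D A : Eucl n × ℝ → Eucl n} (d : WeakData Ω p T E₁ Ep u U c D A)
    {M m : ℝ} {η : Eucl n → ℝ}

include d

lemma integrable_truncDensity (hM : 0 < M) (hm : 0 ≤ m) :
    Integrable (fun y => truncDensity M m (u y)) (volume.restrict (spaceTime Ω T)) := by
  have := d.isFiniteMeasure_restrict_spaceTime
  refine (((integrable_const 1).add d.memLp_u.integrable_sq).mul_const (M ^ m)).mono
    ((continuous_truncDensity hM).comp_stronglyMeasurable d.measurable_u).aestronglyMeasurable
    (Eventually.of_forall fun y => ?_)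
  rw [Real.norm_of_nonneg (truncDensity_nonneg hM _)]
  exact (mul_le_mul_of_nonneg_left (Real.rpow_le_rpow (trunc_pos hM _).le (trunc_le_left hM _) hm)
    (by positivity)).trans (le_abs_self _)

lemma integrable_trunc_mul_norm (hM : 0 < M) (hm : 0 ≤ m) (hp : 1 < p)
    (hη : Continuous η) (h0 : ∀ x, 0 ≤ η x) (h1 : ∀ x, η x ≤ 1) :
    Integrable (fun y => trunc M (u y) ^ m * ‖D y‖ ^ p * η y.1 ^ 2)
      (volume.restrict (spaceTime Ω T)) := by
  have hI : Integrable (fun y => ‖D y‖ ^ p) (volume.restrict (spaceTime Ω T)) := by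
    have := d.memLp_D.integrable_norm_rpow (by simpa using by linarith) ENNReal.ofReal_ne_top
    rwa [ENNReal.toReal_ofReal (by linarith)] at this
  refine (hI.const_mul (M ^ m)).mono ?_ (Eventually.of_forall fun y => ?_)
  · exact ((((contDiff_trunc_rpow (k := 0) hM m).continuous.comp_stronglyMeasurable
      d.measurable_u).mul ((Real.continuous_rpow_const (by linarith)).comp_stronglyMeasurable
      d.measurable_D.norm)).mul
      ((hη.comp continuous_fst).pow 2).stronglyMeasurable).aestronglyMeasurable
  · have t0 := (trunc_pos hM (u y)).le
    have e0 := h0 y.1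
    have := Real.rpow_le_rpow t0 (trunc_le_left hM (u y)) hm
    have := Real.rpow_nonneg t0 m
    rw [Real.norm_of_nonneg (by positivity), Real.norm_of_nonneg (by positivity)]
    have e1 : η y.1 ^ 2 ≤ 1 := pow_le_one₀ e0 (h1 _)
    calc trunc M (u y) ^ m * ‖D y‖ ^ p * η y.1 ^ 2 ≤ trunc M (u y) ^ m * ‖D y‖ ^ p * 1 := by gcongr
      _ ≤ _ := by rw [mul_one]; gcongr

/-- The energy inequality for the pair `testFun`, `testPrim` with $\theta=\eta^2$, the field term
being bounded below pointwise by `inner_field_test_ge`. Off $B$ both $\eta$ and the test gradient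
vanish, so the error is integrated only over $B$. -/
lemma energy_cutoff_le {lam Lam K N : ℝ} (hE : IsDensityPair p lam Lam E₁ Ep)
    (hK : ∀ z, ∀ ζ ∈ subdifferential E₁ z, ‖ζ‖ ≤ K) (hlam : 0 < lam) (hLam : lam ≤ Lam)
    (hp : 1 < p) (hp2 : p < 2)
    (hM : 0 < M) (hm : 0 ≤ m) (hη : IsTest 1 Ω η) (h0 : ∀ x, 0 ≤ η x) (h1 : ∀ x, η x ≤ 1)
    {B : Set (Eucl n)} (hBm : MeasurableSet B) (hB : B ⊆ Ω) (hB0 : ∀ x ∉ B, η x = 0)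
    (hN : 1 ≤ N) (hg : ∀ x, ‖gradient η x‖ ≤ N) {t₁ t₂ : ℝ} (ht1 : 0 < t₁) (ht12 : t₁ ≤ t₂)
    (ht2 : t₂ < T) :
    (∫ x in Ω, testPrim M m (c t₂ x) * η x ^ 2) +
      lam / 2 * (∫ y in Ω ×ˢ Ioc t₁ t₂, trunc M (u y) ^ m * ‖D y‖ ^ p * η y.1 ^ 2) ≤
    (∫ x in Ω, testPrim M m (c t₁ x) * η x ^ 2) +
      (2 * K + (lam / 2) ^ (1 - p) * (2 * Lam) ^ p) * N ^ 2 *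
        ∫ y in B ×ˢ Ioc t₁ t₂, truncDensity M m (u y) := by
  have hpair := isConvexPair_test hM hm
  have hen := d.energy_le hp hp2.le hpair hη.sq (fun x => sq_nonneg (η x)) ht1 ht12 ht2
  have hIoc : Ioc t₁ t₂ ⊆ Ioo 0 T := fun t ht => ⟨ht1.trans ht.1, ht.2.trans_lt ht2⟩
  have hsub : Ω ×ˢ Ioc t₁ t₂ ⊆ spaceTime Ω T := prod_mono_right hIoc
  have hmeas : MeasurableSet (Ω ×ˢ Ioc t₁ t₂) := d.isOpen.measurableSet.prod measurableSet_Ioc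
  have hBIm : MeasurableSet (B ×ˢ Ioc t₁ t₂) := hBm.prod measurableSet_Ioc
  set C₀ := 2 * K + (lam / 2) ^ (1 - p) * (2 * Lam) ^ p with hC₀
  have hG := (d.memLp_testGrad hp2.le hpair hη.sq).mono_measure
    (Measure.restrict_mono_set _ hsub)
  have hpq := holderConjugate_ofReal hp
  have i1 : Integrable (fun y => inner ℝ (A y) (testGrad (testFun M m) (fun x => η x ^ 2) u D y))
      (volume.restrict (Ω ×ˢ Ioc t₁ t₂)) :=
    integrable_inner_of_memLp (d.memLp_A.restrict _) hG
  have i2 : IntegrableOn (fun y => trunc M (u y) ^ m * ‖D y‖ ^ p * η y.1 ^ 2)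
      (Ω ×ˢ Ioc t₁ t₂) :=
    IntegrableOn.mono_set (d.integrable_trunc_mul_norm hM hm hp hη.1.continuous h0 h1) hsub
  have i3 : IntegrableOn (fun y => truncDensity M m (u y)) (Ω ×ˢ Ioc t₁ t₂) :=
    IntegrableOn.mono_set (d.integrable_truncDensity hM hm) hsub
  have e3 : ∫ y in B ×ˢ Ioc t₁ t₂, truncDensity M m (u y) = ∫ y in Ω ×ˢ Ioc t₁ t₂,
      (B ×ˢ Ioc t₁ t₂).indicator (fun y => truncDensity M m (u y)) y := by
    rw [setIntegral_indicator hBIm, inter_eq_self_of_subset_right (prod_mono_left hB)]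
  have key : lam / 2 * (∫ y in Ω ×ˢ Ioc t₁ t₂, trunc M (u y) ^ m * ‖D y‖ ^ p * η y.1 ^ 2) -
      C₀ * N ^ 2 * (∫ y in B ×ˢ Ioc t₁ t₂, truncDensity M m (u y)) ≤
      ∫ y in Ω ×ˢ Ioc t₁ t₂, inner ℝ (A y) (testGrad (testFun M m) (fun x => η x ^ 2) u D y) := by
    rw [e3, ← integral_const_mul, ← integral_const_mul,
      ← integral_sub (i2.const_mul _) ((i3.indicator hBIm).const_mul _)]
    refine integral_mono_ae ((i2.const_mul _).sub ((i3.indicator hBIm).const_mul _)) i1 ?_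
    filter_upwards [ae_restrict_of_ae_restrict_of_subset hsub d.field,
      ae_restrict_mem hmeas] with y ⟨ζ, hζ, hA⟩ hy
    simp only [testGrad, gradient_sq (hη.1.differentiable one_ne_zero)]
    by_cases hyB : y.1 ∈ B
    · rw [indicator_of_mem (show y ∈ B ×ˢ Ioc t₁ t₂ from ⟨hyB, hy.2⟩), hA, smul_smul]
      exact inner_field_test_ge hE hp hp2 hlam hK hLam hζ
        (Real.rpow_nonneg (trunc_pos hM (u y)).le m) (le_deriv_testFun hM hm _) (h0 _) (h1 _) hN
        (hg _)
    · rw [indicator_of_notMem (fun h : y ∈ B ×ˢ Ioc t₁ t₂ => hyB h.1), hB0 _ hyB]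
      simp
  linarith

end WeakData

lemma subdifferential_bound_nonneg {n : ℕ} {p lam Lam K : ℝ} {E₁ Ep : Eucl n → ℝ}
    (hE : IsDensityPair p lam Lam E₁ Ep)
    (hK : ∀ z, ∀ ζ ∈ subdifferential E₁ z, ‖ζ‖ ≤ K) : 0 ≤ K :=
  (norm_nonneg _).trans (hK 0 0 fun w => by
    have h0 : E₁ 0 = 0 := by
      have := hE.homogeneous 2 0 two_pos
      rw [smul_zero] at this
      linarith
    simpa [h0] using hE.nonneg_one w)

lemma integrable_testPrim_mul {n : ℕ} {Ω : Set (Eucl n)} {M m : ℝ} {η : Eucl n → ℝ} (hM : 0 < M)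
    (hm : 0 ≤ m) (hη : IsTest 1 Ω η) (f : LTwo Ω) :
    Integrable (fun x => testPrim M m (f x) * η x ^ 2) (volume.restrict Ω) := by
  obtain ⟨C, hC⟩ := hη.sq.2.1.exists_bound_of_continuous hη.sq.1.continuous
  exact (isConvexPair_test hM hm).integrable_prim_mul (Lp.memLp f)
    hη.sq.1.continuous.aestronglyMeasurable hC

namespace WeakData

variable {n : ℕ} {Ω : Set (Eucl n)} {p T : ℝ} [Fact (1 ≤ ENNReal.ofReal p)]
    {E₁ Ep : Eucl n → ℝ} {u : Eucl n × ℝ → ℝ} {U : ℝ → V Ω (ENNReal.ofReal p)}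
    {c : ℝ → LTwo Ω} {D A : Eucl n × ℝ → Eucl n} (d : WeakData Ω p T E₁ Ep u U c D A)
    {M m : ℝ} {η : Eucl n → ℝ} {B : Set (Eucl n)}

include d

lemma ae_integrable_truncDensity (hM : 0 < M) (hm : 0 ≤ m) :
    ∀ᵐ t ∂(timeMeasure T), Integrable (fun x => truncDensity M m (u (x, t)))
      (volume.restrict Ω) := by
  have := d.integrable_truncDensity hM hm
  rw [← prod_restrict_spaceTime] at this
  exact this.prod_left_ae

lemma ae_integral_testPrim_le (hM : 0 < M) (hm : 0 ≤ m) (hη : IsTest 1 Ω η)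
    (h0 : ∀ x, 0 ≤ η x) (h1 : ∀ x, η x ≤ 1) (hBm : MeasurableSet B) (hB : B ⊆ Ω)
    (hB0 : ∀ x ∉ B, η x = 0) :
    ∀ᵐ t ∂(timeMeasure T), (∫ x in Ω, testPrim M m (c t x) * η x ^ 2) ≤
      ∫ x in B, truncDensity M m (u (x, t)) := by
  filter_upwards [d.slice, d.ae_integrable_truncDensity hM hm] with t ⟨_, h2, _⟩ hI
  rw [← inter_eq_self_of_subset_right hB, ← setIntegral_indicator hBm]
  refine integral_mono_ae (integrable_testPrim_mul hM hm hη (c t)) (hI.indicator hBm) ?_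
  filter_upwards [h2] with x hx
  rw [← hx]
  by_cases hxB : x ∈ B
  · rw [indicator_of_mem hxB]
    have e1 : η x ^ 2 ≤ 1 := pow_le_one₀ (h0 x) (h1 x)
    calc testPrim M m (u (x, t)) * η x ^ 2 ≤ testPrim M m (u (x, t)) * 1 :=
          mul_le_mul_of_nonneg_left e1 (testPrim_nonneg hM hm _)
      _ ≤ _ := by rw [mul_one]; exact testPrim_le hM hm _
  · rw [indicator_of_notMem hxB, hB0 x hxB]
    simp

/-- The volume of $B$ accounts for the additive $1$ in `one_add_sq_mul_trunc_rpow_le`. -/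
lemma ae_integral_truncDensity_le (hM : 0 < M) (hm : 0 ≤ m) (hη : IsTest 1 Ω η)
    (hBm : MeasurableSet B) (hB : B ⊆ Ω) (hB1 : ∀ x ∈ B, η x = 1) :
    ∀ᵐ t ∂(timeMeasure T), (∫ x in B, truncDensity M m (u (x, t))) ≤
      volume.real B + (2 + 2 * m) * ∫ x in Ω, testPrim M m (c t x) * η x ^ 2 := by
  have := d.isFiniteMeasure_restrict
  filter_upwards [d.slice, d.ae_integrable_truncDensity hM hm] with t ⟨_, h2, _⟩ hI
  have i1 := integrable_testPrim_mul hM hm hη (c t)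
  have e1 : volume.real B = ∫ x in Ω, B.indicator (fun _ => (1 : ℝ)) x := by
    rw [setIntegral_indicator hBm, inter_eq_self_of_subset_right hB]
    simp
  have i2 : Integrable (B.indicator (fun _ => (1 : ℝ))) (volume.restrict Ω) :=
    (integrable_const 1).indicator hBm
  rw [e1, ← inter_eq_self_of_subset_right hB, ← setIntegral_indicator hBm,
    inter_eq_self_of_subset_right hB, ← integral_const_mul, ← integral_add i2 (i1.const_mul _)]
  refine integral_mono_ae (hI.indicator hBm) (i2.add (i1.const_mul _)) ?_
  filter_upwards [h2] with x hx
  rw [← hx]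
  by_cases hxB : x ∈ B
  · simp only [indicator_of_mem hxB, hB1 x hxB, one_pow, mul_one]
    exact one_add_sq_mul_trunc_rpow_le hM hm _
  · simp only [indicator_of_notMem hxB]
    have := testPrim_nonneg hM hm (u (x, t))
    positivity

/-- Averaging the estimate over the initial time $\tau\in(a,b]$ replaces a cutoff in time. Some
control of the initial energy is needed only in the mean, where it is at most $X/(b-a)$. -/
lemma energy_average_le {lam Lam K N : ℝ} (hE : IsDensityPair p lam Lam E₁ Ep)
    (hK : ∀ z, ∀ ζ ∈ subdifferential E₁ z, ‖ζ‖ ≤ K) (hlam : 0 < lam) (hLam : lam ≤ Lam)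
    (hp : 1 < p) (hp2 : p < 2)
    (hM : 0 < M) (hm : 0 ≤ m) (hη : IsTest 1 Ω η) (h0 : ∀ x, 0 ≤ η x) (h1 : ∀ x, η x ≤ 1)
    (hBm : MeasurableSet B) (hB : B ⊆ Ω) (hB0 : ∀ x ∉ B, η x = 0)
    (hN : 1 ≤ N) (hg : ∀ x, ‖gradient η x‖ ≤ N) {a b t₀ X : ℝ} (ha : 0 < a) (hab : a < b)
    (ht0 : t₀ < T) (hX : ∫ y in B ×ˢ Ioc a t₀, truncDensity M m (u y) ≤ X) {t : ℝ}
    (ht : t ∈ Icc b t₀) :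
    (∫ x in Ω, testPrim M m (c t x) * η x ^ 2) +
      lam / 2 * (∫ y in Ω ×ˢ Ioc b t, trunc M (u y) ^ m * ‖D y‖ ^ p * η y.1 ^ 2) ≤
    ((b - a)⁻¹ + (2 * K + (lam / 2) ^ (1 - p) * (2 * Lam) ^ p) * N ^ 2) * X := by
  set C₀ := 2 * K + (lam / 2) ^ (1 - p) * (2 * Lam) ^ p with hC₀
  have hK0 := subdifferential_bound_nonneg hE hK
  have hC0 : 0 ≤ C₀ := by
    have : 0 < Lam := hlam.trans_le hLam
    positivity
  set f : ℝ → ℝ := fun t => ∫ x in Ω, testPrim M m (c t x) * η x ^ 2 with hf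
  have hfc : ContinuousOn f (Icc 0 T) := (isConvexPair_test hM hm).continuousOn_integral_prim
    hη.sq (fun x => sq_nonneg (η x)) d.continuousOn
  have hIoo : ∀ {s r : ℝ}, a ≤ s → r ≤ t₀ → Ioc s r ⊆ Ioo 0 T := fun hs hr t ht =>
    ⟨(ha.trans_le hs).trans ht.1, (ht.2.trans hr).trans_lt ht0⟩
  have hi : ∀ {s r : ℝ}, a ≤ s → r ≤ t₀ → IntegrableOn (fun y => truncDensity M m (u y))
      (B ×ˢ Ioc s r) := fun hs hr =>
    IntegrableOn.mono_set (d.integrable_truncDensity hM hm) (prod_mono hB (hIoo hs hr))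
  have hmono : ∀ {s r : ℝ}, a ≤ s → r ≤ t₀ →
      ∫ y in B ×ˢ Ioc s r, truncDensity M m (u y) ≤ X := fun hs hr =>
    (setIntegral_mono_set (hi le_rfl le_rfl) (Eventually.of_forall fun y =>
      truncDensity_nonneg hM _)
      (LE.le.eventuallyLE (prod_mono_right (Ioc_subset_Ioc hs hr)))).trans hX
  have hbt0 : b ≤ t₀ := ht.1.trans ht.2
  set Z := f t + lam / 2 * (∫ y in Ω ×ˢ Ioc b t, trunc M (u y) ^ m * ‖D y‖ ^ p * η y.1 ^ 2)
    with hZ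
  -- The left side does not depend on $\tau$: the gradient integral over $(\tau,t]$ is reduced to
  -- $(b,t]$ and the density integral enlarged to $(a,t_0]$.
  have hstep : ∀ τ ∈ Ioc a b, Z - C₀ * N ^ 2 * X ≤ f τ := by
    intro τ hτ
    have h2 := d.energy_cutoff_le hE hK hlam hLam hp hp2 hM hm hη h0 h1 hBm hB hB0 hN hg
      (ha.trans hτ.1) (hτ.2.trans ht.1) (ht.2.trans_lt ht0)
    have h3 : (∫ y in Ω ×ˢ Ioc b t, trunc M (u y) ^ m * ‖D y‖ ^ p * η y.1 ^ 2) ≤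
        ∫ y in Ω ×ˢ Ioc τ t, trunc M (u y) ^ m * ‖D y‖ ^ p * η y.1 ^ 2 := by
      refine setIntegral_mono_set (IntegrableOn.mono_set
        (d.integrable_trunc_mul_norm hM hm hp hη.1.continuous h0 h1)
        (prod_mono_right (hIoo hτ.1.le ht.2))) (Eventually.of_forall fun y => ?_)
        (LE.le.eventuallyLE (prod_mono_right (Ioc_subset_Ioc_left hτ.2)))
      have := Real.rpow_nonneg (trunc_pos hM (u y)).le m
      have := h0 y.1
      simp only [Pi.zero_apply]
      positivity
    have h4 := mul_le_mul_of_nonneg_left (hmono hτ.1.le ht.2)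
      (show 0 ≤ C₀ * N ^ 2 by positivity)
    have h5 := mul_le_mul_of_nonneg_left h3 (half_pos hlam).le
    simp only [hZ, hf]
    linarith
  have hae := ae_restrict_of_ae_restrict_of_subset (hIoo le_rfl hbt0)
    (d.ae_integral_testPrim_le hM hm hη h0 h1 hBm hB hB0)
  have hIB : Integrable (fun y => truncDensity M m (u y))
      ((volume.restrict B).prod (volume.restrict (Ioc a b))) := by
    rw [Measure.prod_restrict]
    exact hi le_rfl hbt0
  have havg : ∫ τ in Ioc a b, (Z - C₀ * N ^ 2 * X) ≤ X := by
    refine le_trans ?_ (hmono le_rfl hbt0)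
    have e : ∫ y in B ×ˢ Ioc a b, truncDensity M m (u y) =
        ∫ τ in Ioc a b, ∫ x in B, truncDensity M m (u (x, τ)) := by
      rw [← integral_prod_symm _ hIB, Measure.prod_restrict]
      rfl
    rw [e]
    refine integral_mono_ae (integrable_const _) hIB.integral_prod_right ?_
    filter_upwards [hae, ae_restrict_mem measurableSet_Ioc] with τ h2 h3
    exact (hstep τ h3).trans h2
  rw [setIntegral_const, measureReal_def, Real.volume_Ioc, ENNReal.toReal_ofReal
    (sub_nonneg.2 hab.le), smul_eq_mul] at havg
  have hba : 0 < b - a := sub_pos.2 hab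
  rw [mul_comm, ← le_div_iff₀ hba, div_eq_inv_mul] at havg
  linarith

end WeakData


/-! ### Sobolev and Hölder inequalities on time slices. -/

/-- Hölder's inequality with exponents $r/(r-p)$ and $r/p$. For $r=n$ the power of $H$ on the right
is the Sobolev exponent $np/(n-p)$. -/
lemma lintegral_rpow_mul_rpow_le {X : Type*} [MeasurableSpace X] {μ : Measure X} {p r : ℝ}
    (hp : 0 < p) (hpr : p < r) {H W : X → ℝ≥0∞} (hH : AEMeasurable H μ) (hW : AEMeasurable W μ) :
    ∫⁻ x, H x ^ p * W x ^ (p / r) ∂μ ≤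
      (∫⁻ x, H x ^ (r * p / (r - p)) ∂μ) ^ ((r - p) / r) * (∫⁻ x, W x ∂μ) ^ (p / r) := by
  have hr : 0 < r := hp.trans hpr
  have hrp : 0 < r - p := sub_pos.2 hpr
  have hc : (r / (r - p)).HolderConjugate (r / p) := by
    rw [Real.holderConjugate_iff]
    refine ⟨(one_lt_div hrp).2 (by linarith), ?_⟩
    field_simp
    ring
  have := ENNReal.lintegral_mul_le_Lp_mul_Lq μ hc (hH.pow_const p) (hW.pow_const (p / r))
  refine this.trans (le_of_eq ?_)
  have e1 : p * (r / (r - p)) = r * p / (r - p) := by ring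
  have e2 : p / r * (r / p) = 1 := by field_simp
  simp only [← ENNReal.rpow_mul, e1, e2, ENNReal.rpow_one, one_div_div]

lemma add_rpow_le_four_mul {x y p : ℝ} (hx : 0 ≤ x) (hy : 0 ≤ y) (hp : 0 ≤ p) (hp2 : p ≤ 2) :
    (x + y) ^ p ≤ 4 * (x ^ p + y ^ p) := by
  wlog h : y ≤ x generalizing x y
  · rw [add_comm x, add_comm (x ^ p)]
    exact this hy hx (le_of_not_ge h)
  have h1 : (x + y) ^ p ≤ (2 * x) ^ p := Real.rpow_le_rpow (by positivity) (by linarith) hp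
  rw [Real.mul_rpow two_pos.le hx] at h1
  have h2 : (2 : ℝ) ^ p ≤ 2 ^ (2 : ℝ) := Real.rpow_le_rpow_of_exponent_le one_le_two hp2
  rw [Real.rpow_two] at h2
  have h3 := Real.rpow_nonneg hx p
  have h4 := Real.rpow_nonneg hy p
  nlinarith

lemma rpow_le_sq_of_one_le {x p : ℝ} (hx : 1 ≤ x) (hp2 : p ≤ 2) : x ^ p ≤ x ^ 2 := by
  rw [← Real.rpow_two]
  exact Real.rpow_le_rpow_of_exponent_le hx hp2

lemma sobFun_rpow_le {M m p : ℝ} (hM : 0 < M) (hp : 1 < p) (hp2 : p ≤ 2) (s : ℝ) :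
    sobFun M (m / p) s ^ p ≤ truncDensity M m s := by
  rw [sobFun_rpow hM, div_mul_cancel₀ _ (by positivity)]
  exact mul_le_mul_of_nonneg_right (one_add_sq_rpow_half_le hp2 s)
    (Real.rpow_nonneg (trunc_pos hM s).le m)

/-- The exponent $m/p$ in `sobFun` turns into $m$ after raising to the power $p$, so the gradient
term matches the energy density; $(\eta^2)^p\le\eta^2$ restores the cutoff. The constants grow only
quadratically in $m$, which the iteration tolerates. -/
lemma norm_testGrad_sobFun_rpow_le {n : ℕ} {M m p N : ℝ} (hM : 0 < M) (hm : 0 ≤ m) (hp : 1 < p)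
    (hp2 : p ≤ 2) {η : Eucl n → ℝ} (hη : Differentiable ℝ η) {u : Eucl n × ℝ → ℝ}
    {D : Eucl n × ℝ → Eucl n} {y : Eucl n × ℝ} (h0 : 0 ≤ η y.1) (h1 : η y.1 ≤ 1) (hN : 1 ≤ N)
    (hg : ‖gradient η y.1‖ ≤ N) :
    ‖testGrad (sobFun M (m / p)) (fun x => η x ^ 2) u D y‖ ^ p ≤
      4 * ((1 + 2 * m) ^ 2 * (trunc M (u y) ^ m * ‖D y‖ ^ p * η y.1 ^ 2) +
        4 * N ^ 2 * truncDensity M m (u y)) := by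
  have hp0 : 0 < p := by linarith
  have he : 0 ≤ m / p := by positivity
  have hem : m / p ≤ m := div_le_self hm hp.le
  have hH := (sobFun_pos (e := m / p) hM (u y)).le
  have hP := Real.rpow_nonneg (trunc_pos hM (u y)).le (m / p)
  set x₁ := (1 + 2 * m) * trunc M (u y) ^ (m / p) * ‖D y‖ * η y.1 ^ 2 with hx₁
  set x₂ := sobFun M (m / p) (u y) * (2 * N) with hx₂
  have hx1 : 0 ≤ x₁ := by positivity
  have hx2 : 0 ≤ x₂ := by positivity
  have hle : ‖testGrad (sobFun M (m / p)) (fun x => η x ^ 2) u D y‖ ≤ x₁ + x₂ := by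
    refine (norm_add_le _ _).trans (add_le_add ?_ ?_)
    · rw [norm_smul, norm_mul, Real.norm_eq_abs, Real.norm_of_nonneg (sq_nonneg _)]
      calc |deriv (sobFun M (m / p)) (u y)| * η y.1 ^ 2 * ‖D y‖
          ≤ ((1 + 2 * (m / p)) * trunc M (u y) ^ (m / p)) * η y.1 ^ 2 * ‖D y‖ := by
            gcongr
            exact abs_deriv_sobFun_le hM he (u y)
        _ ≤ ((1 + 2 * m) * trunc M (u y) ^ (m / p)) * η y.1 ^ 2 * ‖D y‖ := by gcongr
        _ = x₁ := by rw [hx₁]; ring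
    · rw [gradient_sq hη, norm_smul, norm_smul, Real.norm_of_nonneg hH,
        Real.norm_of_nonneg (by positivity)]
      refine mul_le_mul_of_nonneg_left ?_ hH
      calc 2 * η y.1 * ‖gradient η y.1‖ ≤ 2 * 1 * N := by gcongr
        _ = 2 * N := by ring
  have e1 : x₁ ^ p ≤ (1 + 2 * m) ^ 2 * (trunc M (u y) ^ m * ‖D y‖ ^ p * η y.1 ^ 2) := by
    rw [hx₁, Real.mul_rpow (by positivity) (by positivity),
      Real.mul_rpow (by positivity) (by positivity), Real.mul_rpow (by positivity) hP,
      ← Real.rpow_mul (trunc_pos hM (u y)).le, div_mul_cancel₀ _ hp0.ne']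
    have a1 : (1 + 2 * m) ^ p ≤ (1 + 2 * m) ^ 2 := rpow_le_sq_of_one_le (by linarith) hp2
    have a2 : (η y.1 ^ 2) ^ p ≤ η y.1 ^ 2 :=
      Real.rpow_le_self_of_le_one (sq_nonneg _) (pow_le_one₀ h0 h1) hp.le
    have a3 := Real.rpow_nonneg (trunc_pos hM (u y)).le m
    calc (1 + 2 * m) ^ p * trunc M (u y) ^ m * ‖D y‖ ^ p * (η y.1 ^ 2) ^ p
        ≤ (1 + 2 * m) ^ 2 * trunc M (u y) ^ m * ‖D y‖ ^ p * η y.1 ^ 2 := by gcongr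
      _ = _ := by ring
  have e2 : x₂ ^ p ≤ 4 * N ^ 2 * truncDensity M m (u y) := by
    rw [hx₂, Real.mul_rpow hH (by positivity)]
    have a1 : (2 * N) ^ p ≤ (2 * N) ^ 2 := rpow_le_sq_of_one_le (by linarith) hp2
    calc sobFun M (m / p) (u y) ^ p * (2 * N) ^ p ≤ truncDensity M m (u y) * (2 * N) ^ 2 :=
          mul_le_mul (sobFun_rpow_le hM hp hp2 _) a1 (by positivity) (truncDensity_nonneg hM _)
      _ = _ := by ring
  refine (Real.rpow_le_rpow (norm_nonneg _) hle hp0.le).trans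
    ((add_rpow_le_four_mul hx1 hx2 hp0.le hp2).trans ?_)
  exact mul_le_mul_of_nonneg_left (add_le_add e1 e2) (by norm_num)

namespace WeakData

variable {n : ℕ} {Ω : Set (Eucl n)} {p T : ℝ} [Fact (1 ≤ ENNReal.ofReal p)]
    {E₁ Ep : Eucl n → ℝ} {u : Eucl n × ℝ → ℝ} {U : ℝ → V Ω (ENNReal.ofReal p)}
    {c : ℝ → LTwo Ω} {D A : Eucl n × ℝ → Eucl n} (d : WeakData Ω p T E₁ Ep u U c D A)
    {M m : ℝ} {η : Eucl n → ℝ} {B B' : Set (Eucl n)}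

include d

lemma lintegral_testGrad_sobFun_le {N : ℝ} (hp : 1 < p) (hp2 : p ≤ 2)
    (hM : 0 < M) (hm : 0 ≤ m) (hη : IsTest 1 Ω η) (h0 : ∀ x, 0 ≤ η x) (h1 : ∀ x, η x ≤ 1)
    (hBm : MeasurableSet B) (hB : B ⊆ Ω) (hB0 : ∀ x ∉ B, η x = 0)
    (hN : 1 ≤ N) (hg : ∀ x, ‖gradient η x‖ ≤ N) {I : Set ℝ} (hI : I ⊆ Ioo 0 T)
    (hIm : MeasurableSet I) :
    ∫⁻ y in Ω ×ˢ I, ‖testGrad (sobFun M (m / p)) (fun x => η x ^ 2) u D y‖ₑ ^ p ≤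
      ENNReal.ofReal (4 * ((1 + 2 * m) ^ 2 *
        (∫ y in Ω ×ˢ I, trunc M (u y) ^ m * ‖D y‖ ^ p * η y.1 ^ 2) +
        4 * N ^ 2 * ∫ y in B ×ˢ I, truncDensity M m (u y))) := by
  have hBI : MeasurableSet (B ×ˢ I) := hBm.prod hIm
  have hsub : Ω ×ˢ I ⊆ spaceTime Ω T := prod_mono_right hI
  have hi1 : IntegrableOn (fun y => trunc M (u y) ^ m * ‖D y‖ ^ p * η y.1 ^ 2) (Ω ×ˢ I) :=
    IntegrableOn.mono_set (d.integrable_trunc_mul_norm hM hm hp hη.1.continuous h0 h1) hsub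
  have hi2 : IntegrableOn ((B ×ˢ I).indicator fun y => truncDensity M m (u y)) (Ω ×ˢ I) :=
    (IntegrableOn.mono_set (d.integrable_truncDensity hM hm) hsub).indicator hBI
  set F : Eucl n × ℝ → ℝ := fun y =>
    4 * ((1 + 2 * m) ^ 2 * (trunc M (u y) ^ m * ‖D y‖ ^ p * η y.1 ^ 2) +
      4 * N ^ 2 * (B ×ˢ I).indicator (fun y => truncDensity M m (u y)) y) with hF
  have hFi : IntegrableOn F (Ω ×ˢ I) := ((hi1.const_mul _).add (hi2.const_mul _)).const_mul 4
  have hF0 : ∀ y, 0 ≤ F y := by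
    intro y
    have a1 := Real.rpow_nonneg (trunc_pos hM (u y)).le m
    have a2 := indicator_nonneg (s := B ×ˢ I) (f := fun y => truncDensity M m (u y))
      (fun y _ => truncDensity_nonneg hM _) y
    simp only [hF]
    positivity
  have hFe : ∫ y in Ω ×ˢ I, F y = 4 * ((1 + 2 * m) ^ 2 *
        (∫ y in Ω ×ˢ I, trunc M (u y) ^ m * ‖D y‖ ^ p * η y.1 ^ 2) +
        4 * N ^ 2 * ∫ y in B ×ˢ I, truncDensity M m (u y)) := by
    simp only [hF]
    rw [integral_const_mul, integral_add (hi1.const_mul _) (hi2.const_mul _), integral_const_mul,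
      integral_const_mul, setIntegral_indicator hBI,
      inter_eq_self_of_subset_right (show B ×ˢ I ⊆ Ω ×ˢ I from prod_mono_left hB)]
  rw [← hFe, ofReal_integral_eq_lintegral_ofReal hFi (Eventually.of_forall hF0)]
  refine lintegral_mono_ae ?_
  filter_upwards [ae_restrict_mem (d.isOpen.measurableSet.prod hIm)] with y hyI
  rw [← ofReal_norm, ENNReal.ofReal_rpow_of_nonneg (norm_nonneg _) (by linarith)]
  refine ENNReal.ofReal_le_ofReal ?_
  simp only [hF]
  by_cases hy : y.1 ∈ B
  · rw [indicator_of_mem (show y ∈ B ×ˢ I from ⟨hy, hyI.2⟩)]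
    exact norm_testGrad_sobFun_rpow_le hM hm hp hp2 (hη.1.differentiable one_ne_zero)
      (h0 _) (h1 _) hN (hg _)
  · rw [indicator_of_notMem (fun h : y ∈ B ×ˢ I => hy h.1)]
    simp only [testGrad, gradient_sq (hη.1.differentiable one_ne_zero), hB0 _ hy]
    simp [Real.zero_rpow (show p ≠ 0 by linarith)]

lemma ae_sobolev_sobFun (hp : 1 < p) (hpn : p < n) (hM : 0 < M) (hm : 0 ≤ m)
    (hη : IsTest 1 Ω η) (hB'm : MeasurableSet B') (hB' : B' ⊆ Ω) (hB1 : ∀ x ∈ B', η x = 1) :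
    ∀ᵐ t ∂(timeMeasure T),
      (∫⁻ x in B', ENNReal.ofReal (sobFun M (m / p) (u (x, t))) ^ (n * p / (n - p))) ^
        ((n - p) / n) ≤ (sobolevConst n p : ℝ≥0∞) ^ p *
        ∫⁻ x in Ω, ‖testGrad (sobFun M (m / p)) (fun x => η x ^ 2) u D (x, t)‖ₑ ^ p := by
  have hp0 : 0 < p := by linarith
  have hn0 : (0 : ℝ) < n := hp0.trans hpn
  have hnp : 0 < n - p := sub_pos.2 hpn
  have hr : 0 < n * p / (n - p) := by positivity
  filter_upwards [d.ae_memWZero (contDiff_sobFun hM)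
    (abs_deriv_sobFun_le_const (e := m / p) hM (by positivity)) hη.sq] with t h
  have h2 := h.eLpNorm_le hp.le hpn
  rw [eLpNorm_eq_lintegral_rpow_enorm_toReal (by simpa using hr) ENNReal.ofReal_ne_top,
    eLpNorm_eq_lintegral_rpow_enorm_toReal (by simpa using hp0) ENNReal.ofReal_ne_top,
    ENNReal.toReal_ofReal hr.le, ENNReal.toReal_ofReal hp0.le] at h2
  have h3 := ENNReal.rpow_le_rpow h2 hp0.le
  rw [ENNReal.mul_rpow_of_nonneg _ _ hp0.le, ← ENNReal.rpow_mul, ← ENNReal.rpow_mul,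
    one_div_mul_cancel hp0.ne', ENNReal.rpow_one,
    show 1 / (n * p / (n - p)) * p = (n - p) / n by field_simp] at h3
  refine le_trans (ENNReal.rpow_le_rpow ?_ (by positivity)) h3
  refine le_trans ?_ (lintegral_mono_set hB')
  refine setLIntegral_mono_ae' hB'm (Eventually.of_forall fun x hx => ?_)
  simp only [hB1 x hx, one_pow, mul_one]
  rw [← ofReal_norm, Real.norm_of_nonneg (sobFun_pos hM _).le]

end WeakData


/-! ### Gain of integrability for truncated powers. -/

/-- The constant of the truncated gain of integrability. -/
def gainConst (n : ℕ) (p lam Lam K : ℝ) : ℝ :=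
  2 * (3 + (2 * K + (lam / 2) ^ (1 - p) * (2 * Lam) ^ p)) +
    (sobolevConst n p : ℝ) ^ p *
      (32 / lam * (1 + (2 * K + (lam / 2) ^ (1 - p) * (2 * Lam) ^ p)) + 16)

/-- `η` is a cutoff function between the sets `B' ⊆ B` of `Ω`, with gradient at most `N`. -/
structure IsCutoff {n : ℕ} (Ω B B' : Set (Eucl n)) (η : Eucl n → ℝ) (N : ℝ) : Prop where
  isTest : IsTest 1 Ω η
  nonneg : ∀ x, 0 ≤ η x
  le_one : ∀ x, η x ≤ 1
  measurableSet : MeasurableSet B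
  measurableSet' : MeasurableSet B'
  subset : B ⊆ Ω
  subset' : B' ⊆ B
  eq_zero : ∀ x ∉ B, η x = 0
  eq_one : ∀ x ∈ B', η x = 1
  one_le : 1 ≤ N
  norm_gradient_le : ∀ x, ‖gradient η x‖ ≤ N

namespace WeakData

variable {n : ℕ} {Ω : Set (Eucl n)} {p T : ℝ} [Fact (1 ≤ ENNReal.ofReal p)]
    {E₁ Ep : Eucl n → ℝ} {u : Eucl n × ℝ → ℝ} {U : ℝ → V Ω (ENNReal.ofReal p)}
    {c : ℝ → LTwo Ω} {D A : Eucl n × ℝ → Eucl n} (d : WeakData Ω p T E₁ Ep u U c D A)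
    {M m : ℝ} {η : Eucl n → ℝ} {B B' : Set (Eucl n)}

include d

lemma ae_lintegral_truncDensity_le {N C₀ X b t₀ : ℝ} (hM : 0 < M) (hm : 0 ≤ m)
    (hη : IsCutoff Ω B B' η N) (hI : Ioc b t₀ ⊆ Ioo 0 T) (hC0 : 0 ≤ C₀)
    (hvol : volume.real B' ≤ N ^ 2 * X)
    (hen : ∀ t ∈ Icc b t₀, (∫ x in Ω, testPrim M m (c t x) * η x ^ 2) ≤ (1 + C₀) * N ^ 2 * X) :
    ∀ᵐ t ∂(volume.restrict (Ioc b t₀)),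
      ∫⁻ x in B', ENNReal.ofReal (truncDensity M m (u (x, t))) ≤
        ENNReal.ofReal (2 * (3 + C₀) * (1 + m) ^ 2 * (N ^ 2 * X)) := by
  obtain ⟨hη, h0, h1, hBm, hB'm, hB, hB', hB0, hB1, hN, hg⟩ := hη
  have hB'Ω := hB'.trans hB
  have hNX : 0 ≤ N ^ 2 * X := le_trans (by positivity) hvol
  filter_upwards [ae_restrict_of_ae_restrict_of_subset hI
    (d.ae_integral_truncDensity_le hM hm hη hB'm hB'Ω hB1),
    ae_restrict_of_ae_restrict_of_subset hI (d.ae_integrable_truncDensity hM hm),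
    ae_restrict_mem measurableSet_Ioc] with t k1 k2 k3
  rw [← ofReal_integral_eq_lintegral_ofReal (IntegrableOn.mono_set k2 hB'Ω)
    (Eventually.of_forall fun x => truncDensity_nonneg hM _)]
  refine ENNReal.ofReal_le_ofReal (k1.trans ?_)
  have k5 := hen t ⟨k3.1.le, k3.2⟩
  calc volume.real B' + (2 + 2 * m) * ∫ x in Ω, testPrim M m (c t x) * η x ^ 2
      ≤ N ^ 2 * X + (2 + 2 * m) * ((1 + C₀) * N ^ 2 * X) := by gcongr
    _ = (1 + 2 * (1 + C₀) * (1 + m)) * (N ^ 2 * X) := by ring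
    _ ≤ (2 * (3 + C₀) * (1 + m) ^ 2) * (N ^ 2 * X) := by
        refine mul_le_mul_of_nonneg_right ?_ hNX
        nlinarith [mul_nonneg hC0 hm, sq_nonneg m, mul_nonneg hC0 (sq_nonneg m)]

lemma lintegral_testGrad_le_of_energy {N C₀ X b t₀ lam : ℝ} (hp : 1 < p) (hp2 : p < 2)
    (hlam : 0 < lam) (hM : 0 < M) (hm : 0 ≤ m)
    (hη : IsCutoff Ω B B' η N) (hI : Ioc b t₀ ⊆ Ioo 0 T)
    (hX : ∫ y in B ×ˢ Ioc b t₀, truncDensity M m (u y) ≤ X)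
    (hen : lam / 2 * (∫ y in Ω ×ˢ Ioc b t₀, trunc M (u y) ^ m * ‖D y‖ ^ p * η y.1 ^ 2) ≤
      (1 + C₀) * N ^ 2 * X) :
    ∫⁻ y in Ω ×ˢ Ioc b t₀, ‖testGrad (sobFun M (m / p)) (fun x => η x ^ 2) u D y‖ₑ ^ p ≤
      ENNReal.ofReal ((32 / lam * (1 + C₀) + 16) * ((1 + m) ^ 2 * (N ^ 2 * X))) := by
  obtain ⟨hη, h0, h1, hBm, hB'm, hB, hB', hB0, hB1, hN, hg⟩ := hη
  have hX0 : 0 ≤ X := (integral_nonneg fun y => truncDensity_nonneg hM _).trans hX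
  have hNX : 0 ≤ N ^ 2 * X := by positivity
  have hG0 : 0 ≤ ∫ y in Ω ×ˢ Ioc b t₀, trunc M (u y) ^ m * ‖D y‖ ^ p * η y.1 ^ 2 :=
    integral_nonneg fun y => by
      have := Real.rpow_nonneg (trunc_pos hM (u y)).le m
      simp only [Pi.zero_apply]
      positivity
  have k1 := d.lintegral_testGrad_sobFun_le hp hp2.le hM hm hη h0 h1 hBm hB hB0 hN hg hI
    measurableSet_Ioc
  have k3 : (∫ y in Ω ×ˢ Ioc b t₀, trunc M (u y) ^ m * ‖D y‖ ^ p * η y.1 ^ 2) ≤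
      2 / lam * ((1 + C₀) * N ^ 2 * X) := by
    rw [div_mul_eq_mul_div, le_div_iff₀ hlam]
    linarith
  have k5 : 4 * ((1 + 2 * m) ^ 2 *
      (∫ y in Ω ×ˢ Ioc b t₀, trunc M (u y) ^ m * ‖D y‖ ^ p * η y.1 ^ 2) +
      4 * N ^ 2 * ∫ y in B ×ˢ Ioc b t₀, truncDensity M m (u y)) ≤
      (32 / lam * (1 + C₀) + 16) * ((1 + m) ^ 2 * (N ^ 2 * X)) := by
    have a1 : (1 + 2 * m) ^ 2 ≤ 4 * (1 + m) ^ 2 := by nlinarith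
    calc _ ≤ 4 * ((4 * (1 + m) ^ 2) * (2 / lam * ((1 + C₀) * N ^ 2 * X)) + 4 * N ^ 2 * X) := by
          gcongr
      _ = 32 / lam * (1 + C₀) * ((1 + m) ^ 2 * (N ^ 2 * X)) + 16 * (N ^ 2 * X) := by ring
      _ ≤ 32 / lam * (1 + C₀) * ((1 + m) ^ 2 * (N ^ 2 * X)) +
          16 * ((1 + m) ^ 2 * (N ^ 2 * X)) := by
          have : N ^ 2 * X ≤ (1 + m) ^ 2 * (N ^ 2 * X) := le_mul_of_one_le_left hNX (by nlinarith)
          linarith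
      _ = _ := by ring
  exact k1.trans (ENNReal.ofReal_le_ofReal k5)

/-- On each slice, Hölder's inequality splits the integrand into a Sobolev factor, linear in the
gradient energy of the slice, and the power $p/n$ of the slice integral of the density. The latter
is at most $Y$ uniformly in time and leaves the time integral, hence the total power $1+p/n$. -/
lemma lintegral_gain_le {N b t₀ Y : ℝ} (hp : 1 < p) (hpn : p < n)
    (hM : 0 < M) (hm : 0 ≤ m) (hη : IsCutoff Ω B B' η N) (hI : Ioc b t₀ ⊆ Ioo 0 T)
    (hslice : ∀ᵐ t ∂(volume.restrict (Ioc b t₀)),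
      ∫⁻ x in B', ENNReal.ofReal (truncDensity M m (u (x, t))) ≤ ENNReal.ofReal Y)
    (hgrad : (sobolevConst n p : ℝ≥0∞) ^ p * ∫⁻ y in Ω ×ˢ Ioc b t₀,
      ‖testGrad (sobFun M (m / p)) (fun x => η x ^ 2) u D y‖ₑ ^ p ≤ ENNReal.ofReal Y) :
    ∫⁻ y in B' ×ˢ Ioc b t₀, ENNReal.ofReal (sobFun M (m / p) (u y)) ^ p *
        ENNReal.ofReal (truncDensity M m (u y)) ^ (p / n) ≤ ENNReal.ofReal Y ^ (1 + p / n) := by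
  obtain ⟨hη, h0, h1, hBm, hB'm, hB, hB', hB0, hB1, hN, hg⟩ := hη
  have hB'Ω := hB'.trans hB
  have hp0 : 0 < p := by linarith
  have hn0 : (0 : ℝ) < n := hp0.trans hpn
  have hsob := ae_restrict_of_ae_restrict_of_subset hI
    (d.ae_sobolev_sobFun hp hpn hM hm hη hB'm hB'Ω hB1)
  have hHm : Measurable fun y => ENNReal.ofReal (sobFun M (m / p) (u y)) :=
    ((contDiff_sobFun (k := 0) hM).continuous.comp_stronglyMeasurable
      d.measurable_u).measurable.ennreal_ofReal
  have hWm : Measurable fun y => ENNReal.ofReal (truncDensity M m (u y)) :=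
    ((continuous_truncDensity hM).comp_stronglyMeasurable
      d.measurable_u).measurable.ennreal_ofReal
  have hTm : Measurable fun y => ‖testGrad (sobFun M (m / p)) (fun x => η x ^ 2) u D y‖ₑ ^ p :=
    (d.stronglyMeasurable_testGrad (contDiff_sobFun hM) hη.sq).measurable.enorm.pow_const p
  rw [Measure.volume_eq_prod, ← Measure.prod_restrict] at hgrad ⊢
  rw [lintegral_prod_symm' _ hTm] at hgrad
  have hPm : Measurable fun y => ENNReal.ofReal (sobFun M (m / p) (u y)) ^ p *
      ENNReal.ofReal (truncDensity M m (u y)) ^ (p / n) := (hHm.pow_const p).mul (hWm.pow_const _)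
  rw [lintegral_prod_symm' _ hPm]
  calc ∫⁻ t in Ioc b t₀, ∫⁻ x in B', ENNReal.ofReal (sobFun M (m / p) (u (x, t))) ^ p *
        ENNReal.ofReal (truncDensity M m (u (x, t))) ^ (p / n)
      ≤ ∫⁻ t in Ioc b t₀, ((sobolevConst n p : ℝ≥0∞) ^ p * ∫⁻ x in Ω,
          ‖testGrad (sobFun M (m / p)) (fun x => η x ^ 2) u D (x, t)‖ₑ ^ p) *
          ENNReal.ofReal Y ^ (p / n) := by
        refine lintegral_mono_ae ?_
        filter_upwards [hslice, hsob] with t k1 k2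
        refine (lintegral_rpow_mul_rpow_le hp0 hpn
          (hHm.comp measurable_prodMk_right).aemeasurable
          (hWm.comp measurable_prodMk_right).aemeasurable).trans ?_
        exact mul_le_mul' k2 (ENNReal.rpow_le_rpow k1 (by positivity))
    _ = ((sobolevConst n p : ℝ≥0∞) ^ p * ∫⁻ t in Ioc b t₀, ∫⁻ x in Ω,
          ‖testGrad (sobFun M (m / p)) (fun x => η x ^ 2) u D (x, t)‖ₑ ^ p) *
          ENNReal.ofReal Y ^ (p / n) := by
        rw [lintegral_mul_const _ (hTm.lintegral_prod_left'.const_mul _),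
          lintegral_const_mul _ hTm.lintegral_prod_left']
    _ ≤ ENNReal.ofReal Y * ENNReal.ofReal Y ^ (p / n) := mul_le_mul' hgrad le_rfl
    _ = _ := by
        rw [ENNReal.rpow_add_of_nonneg _ _ zero_le_one (by positivity), ENNReal.rpow_one]

lemma gain_truncated {lam Lam K N : ℝ} (hE : IsDensityPair p lam Lam E₁ Ep)
    (hK : ∀ z, ∀ ζ ∈ subdifferential E₁ z, ‖ζ‖ ≤ K) (hlam : 0 < lam) (hLam : lam ≤ Lam)
    (hp : 1 < p) (hp2 : p < 2) (hpn : p < n)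
    (hM : 0 < M) (hm : 0 ≤ m) (hη : IsCutoff Ω B B' η N) {a b t₀ X : ℝ} (ha : 0 < a) (hab : a < b)
    (hbt : b ≤ t₀) (ht0 : t₀ < T) (hX : ∫ y in B ×ˢ Ioc a t₀, truncDensity M m (u y) ≤ X)
    (hba : (b - a)⁻¹ ≤ N ^ 2) (hX' : volume.real B' * (b - a) ≤ X) :
    ∫⁻ y in B' ×ˢ Ioc b t₀, ENNReal.ofReal (sobFun M (m / p) (u y)) ^ p *
        ENNReal.ofReal (truncDensity M m (u y)) ^ (p / n) ≤
      ENNReal.ofReal (gainConst n p lam Lam K * ((1 + m) ^ 2 * (N ^ 2 * X))) ^ (1 + p / n) := by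
  set C₀ := 2 * K + (lam / 2) ^ (1 - p) * (2 * Lam) ^ p with hC₀
  have hK0 := subdifferential_bound_nonneg hE hK
  have hLam0 : 0 < Lam := hlam.trans_le hLam
  have hC0 : 0 ≤ C₀ := by positivity
  have hp0 : 0 < p := by linarith
  have hab' : 0 < b - a := sub_pos.2 hab
  have hX0 : 0 ≤ X := le_trans (by positivity) hX'
  have hI : Ioc b t₀ ⊆ Ioo 0 T := fun t ht => ⟨(ha.trans hab).trans ht.1, ht.2.trans_lt ht0⟩
  have hen : ∀ t ∈ Icc b t₀, (∫ x in Ω, testPrim M m (c t x) * η x ^ 2) +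
      lam / 2 * (∫ y in Ω ×ˢ Ioc b t, trunc M (u y) ^ m * ‖D y‖ ^ p * η y.1 ^ 2) ≤
      (1 + C₀) * N ^ 2 * X := by
    intro t ht
    refine (d.energy_average_le hE hK hlam hLam hp hp2 hM hm hη.isTest hη.nonneg hη.le_one
      hη.measurableSet hη.subset hη.eq_zero hη.one_le hη.norm_gradient_le ha hab ht0
      hX ht).trans (mul_le_mul_of_nonneg_right ?_ hX0)
    linarith
  -- This absorbs the volume left over on slices into $N^2X$.
  have hvol : volume.real B' ≤ N ^ 2 * X := by
    rw [← le_div_iff₀ hab', div_eq_mul_inv] at hX'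
    refine hX'.trans ?_
    rw [mul_comm]
    exact mul_le_mul_of_nonneg_right hba hX0
  have hNX : 0 ≤ (1 + m) ^ 2 * (N ^ 2 * X) := by positivity
  have hS0 : (0 : ℝ) ≤ (sobolevConst n p : ℝ) ^ p := by positivity
  -- A single $Y$ serves both hypotheses because `gainConst` is the sum of the constant for the
  -- slices and the constant for the gradient.
  refine d.lintegral_gain_le hp hpn hM hm hη hI ?_ ?_
  · have h1 := d.ae_lintegral_truncDensity_le hM hm hη hI hC0 hvol fun t ht => by
      have h2 : 0 ≤ ∫ y in Ω ×ˢ Ioc b t, trunc M (u y) ^ m * ‖D y‖ ^ p * η y.1 ^ 2 :=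
        integral_nonneg fun y => by
          have := Real.rpow_nonneg (trunc_pos hM (u y)).le m
          simp only [Pi.zero_apply]
          positivity
      have h3 := mul_nonneg (half_pos hlam).le h2
      linarith [hen t ht]
    filter_upwards [h1] with t ht
    refine ht.trans (ENNReal.ofReal_le_ofReal ?_)
    rw [mul_assoc]
    refine mul_le_mul_of_nonneg_right ?_ hNX
    rw [gainConst]
    have : 0 ≤ (sobolevConst n p : ℝ) ^ p * (32 / lam * (1 + C₀) + 16) := by positivity
    linarith
  · have h1 : ∫ y in B ×ˢ Ioc b t₀, truncDensity M m (u y) ≤ X := by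
      refine (setIntegral_mono_set (IntegrableOn.mono_set (d.integrable_truncDensity hM hm)
        (prod_mono hη.subset fun t ht => ⟨ha.trans ht.1, ht.2.trans_lt ht0⟩))
        (Eventually.of_forall fun y => truncDensity_nonneg hM _)
        (LE.le.eventuallyLE (prod_mono_right (Ioc_subset_Ioc_left hab.le)))).trans hX
    have h2 := d.lintegral_testGrad_le_of_energy hp hp2 hlam hM hm hη hI h1 (C₀ := C₀) (by
      have : 0 ≤ ∫ x in Ω, testPrim M m (c t₀ x) * η x ^ 2 :=
        integral_nonneg fun x => mul_nonneg (testPrim_nonneg hM hm _) (sq_nonneg _)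
      linarith [hen t₀ ⟨hbt, le_rfl⟩])
    have h3 : (sobolevConst n p : ℝ≥0∞) ^ p = ENNReal.ofReal ((sobolevConst n p : ℝ) ^ p) := by
      rw [← ENNReal.ofReal_rpow_of_nonneg NNReal.zero_le_coe hp0.le, ENNReal.ofReal_coe_nnreal]
    rw [h3]
    refine (mul_le_mul_right h2 _).trans ?_
    rw [← ENNReal.ofReal_mul hS0, ← mul_assoc]
    refine ENNReal.ofReal_le_ofReal (mul_le_mul_of_nonneg_right ?_ hNX)
    rw [gainConst]
    linarith

end WeakData


/-! ### Removal of the truncation and the gain on cylinders. -/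

/-- The integral of `(1 + u²)^{σ/2}` over a parabolic cylinder. -/
def levelInt {n : ℕ} (u : Eucl n × ℝ → ℝ) (x₀ : Eucl n) (t₀ ρ σ : ℝ) : ℝ≥0∞ :=
  ∫⁻ y in cylinder ρ x₀ t₀, ENNReal.ofReal ((1 + u y ^ 2) ^ (σ / 2))

/-- The limiting power of $w$ is $p/2+m+(1+m)p/r$. The loss $2-p$ arises because the Sobolev factor
carries $w^{p/2}$ instead of $w$. -/
lemma tendsto_gain_density {p r m : ℝ} (hp : 0 < p) (hr : 0 < r) (hm : 0 ≤ m) (s : ℝ) :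
    Tendsto (fun k : ℕ => ENNReal.ofReal (sobFun (k + 1) (m / p) s) ^ p *
      ENNReal.ofReal (truncDensity (k + 1) m s) ^ (p / r)) atTop
      (𝓝 (ENNReal.ofReal ((1 + s ^ 2) ^ (((1 + p / r) * (2 + 2 * m) - (2 - p)) / 2)))) := by
  have hw : 0 < 1 + s ^ 2 := by positivity
  have h1 : Tendsto (fun k : ℕ => sobFun (k + 1) (m / p) s ^ p *
      truncDensity (k + 1) m s ^ (p / r)) atTop
      (𝓝 ((√(1 + s ^ 2) * (1 + s ^ 2) ^ (m / p)) ^ p *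
        ((1 + s ^ 2) * (1 + s ^ 2) ^ m) ^ (p / r))) := by
    have e1 := ((tendsto_trunc s).rpow_const (p := m / p) (Or.inl hw.ne')).const_mul (√(1 + s ^ 2))
    have e2 := ((tendsto_trunc s).rpow_const (p := m) (Or.inl hw.ne')).const_mul (1 + s ^ 2)
    exact (e1.rpow_const (Or.inr hp.le)).mul (e2.rpow_const (Or.inr (by positivity)))
  have h2 : (√(1 + s ^ 2) * (1 + s ^ 2) ^ (m / p)) ^ p *
        ((1 + s ^ 2) * (1 + s ^ 2) ^ m) ^ (p / r) =
      (1 + s ^ 2) ^ (((1 + p / r) * (2 + 2 * m) - (2 - p)) / 2) := by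
    rw [Real.sqrt_eq_rpow, ← Real.rpow_add hw, ← Real.rpow_one_add' hw.le (by positivity),
      ← Real.rpow_mul hw.le, ← Real.rpow_mul hw.le, ← Real.rpow_add hw]
    congr 1
    field_simp
    ring
  rw [h2] at h1
  refine (ENNReal.tendsto_ofReal h1).congr fun k => ?_
  have hk : (0 : ℝ) < k + 1 := by positivity
  have k1 := (sobFun_pos (e := m / p) hk s).le
  have k2 := truncDensity_nonneg (m := m) hk s
  rw [ENNReal.ofReal_mul (Real.rpow_nonneg k1 p), ENNReal.ofReal_rpow_of_nonneg k1 hp.le,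
    ENNReal.ofReal_rpow_of_nonneg k2 (by positivity)]

lemma gainConst_pos {n : ℕ} {p lam Lam K : ℝ} (hlam : 0 < lam) (hLam : lam ≤ Lam) (hK : 0 ≤ K) :
    0 < gainConst n p lam Lam K := by
  have hLam0 : 0 < Lam := hlam.trans_le hLam
  unfold gainConst
  positivity

/-- The gain of integrability on cylinders. -/
lemma exists_gain_const (n : ℕ) (p lam Lam K : ℝ) [Fact (1 ≤ ENNReal.ofReal p)] (hp : 1 < p)
    (hp2 : p < 2) (hpn : p < n) (hlam : 0 < lam) (hLam : lam ≤ Lam) (hK : 0 ≤ K) :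
    ∃ C : ℝ, 0 < C ∧ ∀ (E₁ Ep : Eucl n → ℝ), IsDensityPair p lam Lam E₁ Ep →
      (∀ z, ∀ ζ ∈ subdifferential E₁ z, ‖ζ‖ ≤ K) →
      ∀ (Ω : Set (Eucl n)) (T : ℝ) (u : Eucl n × ℝ → ℝ) (U : ℝ → V Ω (ENNReal.ofReal p))
        (c : ℝ → LTwo Ω) (D A : Eucl n × ℝ → Eucl n), WeakData Ω p T E₁ Ep u U c D A →
      ∀ (x₀ : Eucl n) (t₀ ρ₁ ρ₂ σ : ℝ), 0 < ρ₂ → ρ₂ < ρ₁ → ρ₁ ≤ 1 →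
        Metric.closedBall x₀ ρ₁ ⊆ Ω → 0 < t₀ - ρ₁ ^ 2 → t₀ < T → 2 ≤ σ →
        levelInt u x₀ t₀ ρ₂ ((1 + p / n) * σ - (2 - p)) ≤
          (ENNReal.ofReal (C * σ ^ 2 / (ρ₁ - ρ₂) ^ 2) * levelInt u x₀ t₀ ρ₁ σ) ^ (1 + p / n) := by
  obtain ⟨Bc, hBc, hcut⟩ := exists_ball_cutoff
  have hgc := gainConst_pos (n := n) (p := p) hlam hLam hK
  -- The quarter comes from $1+m=\sigma/2$ in the factor $(1+m)^2$.
  refine ⟨gainConst n p lam Lam K * Bc ^ 2 / 4, by positivity, ?_⟩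
  intro E₁ Ep hE hKb Ω T u U c D A d x₀ t₀ ρ₁ ρ₂ σ hρ2 hρ hρ1 hΩ ht ht0 hσ
  have hp0 : 0 < p := by linarith
  have hn0 : (0 : ℝ) < n := hp0.trans hpn
  have hd : 0 < ρ₁ - ρ₂ := sub_pos.2 hρ
  set κ := 1 + p / n with hκ
  have hκ0 : 0 < κ := by positivity
  -- If the level integral on the larger cylinder is infinite, the right side is infinite; otherwise
  -- it is a real number $X$.
  by_cases hY : levelInt u x₀ t₀ ρ₁ σ = ⊤
  · rw [hY, ENNReal.mul_top, ENNReal.top_rpow_of_pos hκ0]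
    · exact le_top
    · have : 0 < gainConst n p lam Lam K * Bc ^ 2 / 4 * σ ^ 2 / (ρ₁ - ρ₂) ^ 2 := by positivity
      simpa using this
  obtain ⟨η, hη, h0, h1, hη1, hη0, hg⟩ := hcut n x₀ ρ₁ ρ₂ hρ2.le hρ
  have hN : 1 ≤ Bc / (ρ₁ - ρ₂) := (one_le_div hd).2 (by linarith)
  have hcf : IsCutoff Ω (Metric.ball x₀ ρ₁) (Metric.ball x₀ ρ₂) η (Bc / (ρ₁ - ρ₂)) :=
    ⟨⟨hη.1, hη.2.1, hη.2.2.trans hΩ⟩, h0, h1, measurableSet_ball, measurableSet_ball,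
      Metric.ball_subset_closedBall.trans hΩ, Metric.ball_subset_ball hρ.le, hη0, hη1, hN, hg⟩
  set m := σ / 2 - 1 with hm_def
  have hm : 0 ≤ m := by linarith
  have hσm : 2 + 2 * m = σ := by rw [hm_def]; ring
  set X := (levelInt u x₀ t₀ ρ₁ σ).toReal with hX
  have hXe : levelInt u x₀ t₀ ρ₁ σ = ENNReal.ofReal X := (ENNReal.ofReal_toReal hY).symm
  have hab : t₀ - ρ₁ ^ 2 < t₀ - ρ₂ ^ 2 := by nlinarith
  have hba : (t₀ - ρ₂ ^ 2 - (t₀ - ρ₁ ^ 2))⁻¹ ≤ (Bc / (ρ₁ - ρ₂)) ^ 2 := by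
    rw [div_pow, inv_le_comm₀ (by linarith) (by positivity), inv_div]
    refine (div_le_self (sq_nonneg _) (one_le_pow₀ hBc)).trans ?_
    nlinarith
  -- The integrand $w^{\sigma/2}$ is at least $1$, so the level integral dominates the volume of the
  -- cylinder.
  have hvol : volume.real (Metric.ball x₀ ρ₂) * (t₀ - ρ₂ ^ 2 - (t₀ - ρ₁ ^ 2)) ≤ X := by
    have e1 : volume (cylinder ρ₁ x₀ t₀) ≤ levelInt u x₀ t₀ ρ₁ σ := by
      rw [← setLIntegral_one]
      refine lintegral_mono fun y => ?_
      rw [← ENNReal.ofReal_one]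
      refine ENNReal.ofReal_le_ofReal (Real.one_le_rpow ?_ (by linarith))
      nlinarith [sq_nonneg (u y)]
    rw [cylinder, Measure.volume_eq_prod, Measure.prod_prod, Real.volume_Ioc] at e1
    have e2 := ENNReal.toReal_mono hY e1
    rw [ENNReal.toReal_mul, ENNReal.toReal_ofReal (by nlinarith)] at e2
    refine le_trans (mul_le_mul ?_ (by nlinarith) (by nlinarith) ENNReal.toReal_nonneg) e2
    exact measureReal_mono (Metric.ball_subset_ball hρ.le) (by finiteness)
  have hk : ∀ k : ℕ, ∫⁻ y in cylinder ρ₂ x₀ t₀,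
      ENNReal.ofReal (sobFun (k + 1) (m / p) (u y)) ^ p *
        ENNReal.ofReal (truncDensity (k + 1) m (u y)) ^ (p / n) ≤
      (ENNReal.ofReal (gainConst n p lam Lam K * Bc ^ 2 / 4 * σ ^ 2 / (ρ₁ - ρ₂) ^ 2) *
        levelInt u x₀ t₀ ρ₁ σ) ^ κ := by
    intro k
    have hM : (0 : ℝ) < k + 1 := by positivity
    have hXk : ∫ y in Metric.ball x₀ ρ₁ ×ˢ Ioc (t₀ - ρ₁ ^ 2) t₀, truncDensity (k + 1) m (u y) ≤
        X := by
      rw [integral_eq_lintegral_of_nonneg_ae (Eventually.of_forall fun y =>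
        truncDensity_nonneg hM _) ((continuous_truncDensity hM).comp_stronglyMeasurable
        d.measurable_u).aestronglyMeasurable]
      refine ENNReal.toReal_mono hY (lintegral_mono fun y => ENNReal.ofReal_le_ofReal ?_)
      rw [← hσm, show (2 + 2 * m) / 2 = 1 + m by ring]
      exact truncDensity_le hM hm _
    refine (d.gain_truncated hE hKb hlam hLam hp hp2 hpn hM hm hcf ht hab
      (by nlinarith) ht0 hXk hba hvol).trans (le_of_eq ?_)
    rw [hXe, ← ENNReal.ofReal_mul (by positivity), ← hσm, div_pow]
    congr 2
    ring
  -- The bounds are uniform in the truncation height $k+1$, so Fatou's lemma applies to the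
  -- pointwise limit.
  have hlim : levelInt u x₀ t₀ ρ₂ (κ * σ - (2 - p)) =
      ∫⁻ y in cylinder ρ₂ x₀ t₀, liminf (fun k : ℕ =>
        ENNReal.ofReal (sobFun (k + 1) (m / p) (u y)) ^ p *
          ENNReal.ofReal (truncDensity (k + 1) m (u y)) ^ (p / n)) atTop := by
    refine lintegral_congr fun y => ?_
    rw [(tendsto_gain_density hp0 hn0 hm (u y)).liminf_eq, hσm]
  rw [hlim]
  refine (lintegral_liminf_le fun k => ?_).trans
    (liminf_le_of_frequently_le' (Eventually.of_forall hk).frequently)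
  have hM : (0 : ℝ) < k + 1 := by positivity
  exact ((((contDiff_sobFun (k := 0) hM).continuous.comp_stronglyMeasurable
    d.measurable_u).measurable.ennreal_ofReal).pow_const p).mul
    ((((continuous_truncDensity hM).comp_stronglyMeasurable
    d.measurable_u).measurable.ennreal_ofReal).pow_const _)


/-! ### Superlinear recursions and the passage to the supremum. -/

/-- The threshold constant of a superlinear iteration. -/
def iterConst (A b κ : ℝ) : ℝ :=
  (b ^ (-κ / (κ - 1))) ^ (1 / (κ - 1)) * A ^ (-κ / (κ - 1))

lemma iterConst_pos {A b κ : ℝ} (hA : 0 < A) (hb : 0 < b) : 0 < iterConst A b κ := by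
  unfold iterConst
  positivity

/-- The ansatz $y_k\le\alpha\beta^k\theta^{\kappa^k}$ with $\theta=x_0/\alpha$ reproduces itself
exactly when $(b\beta)^\kappa=\beta$ and $(A\alpha)^\kappa=\alpha\beta$. These equations determine
$\beta$ and `iterConst`; finally $\beta\le1$ is dropped. No smallness of $x_0$ is required. -/
lemma le_of_superlinear_iteration {y : ℕ → ℝ≥0∞} {A b κ x₀ : ℝ} (hA : 0 < A) (hb : 1 ≤ b)
    (hκ : 1 < κ) (hx : 0 < x₀) (h0 : y 0 ≤ ENNReal.ofReal x₀)
    (h : ∀ k, y (k + 1) ≤ (ENNReal.ofReal (A * b ^ k) * y k) ^ κ) (k : ℕ) :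
    y k ≤ ENNReal.ofReal (iterConst A b κ * (x₀ / iterConst A b κ) ^ (κ ^ k)) := by
  have hb0 : 0 < b := by linarith
  have hκ0 : 0 < κ := by linarith
  have hκ1 : κ - 1 ≠ 0 := by linarith
  set β := b ^ (-κ / (κ - 1)) with hβ
  have hβ0 : 0 < β := by positivity
  have hα0 := iterConst_pos (κ := κ) hA hb0
  set α := iterConst A b κ with hα
  set θ := x₀ / α with hθ
  have hθ0 : 0 < θ := by positivity
  have eβ : (b * β) ^ κ = β := by
    have e : b * β = b ^ (1 + -κ / (κ - 1)) := by rw [Real.rpow_add hb0, Real.rpow_one]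
    rw [e, ← Real.rpow_mul hb0.le, hβ]
    congr 1
    field_simp
    ring
  have eα : (A * α) ^ κ = α * β := by
    have e1 : α = β ^ (1 / (κ - 1)) * A ^ (-κ / (κ - 1)) := rfl
    have e2 : A * α = β ^ (1 / (κ - 1)) * A ^ (1 + -κ / (κ - 1)) := by
      rw [Real.rpow_add hA, Real.rpow_one, e1]
      ring
    rw [e2, Real.mul_rpow (by positivity) (by positivity), ← Real.rpow_mul hβ0.le,
      ← Real.rpow_mul hA.le, e1, mul_right_comm, ← Real.rpow_add_one hβ0.ne']
    congr 2
    · field_simp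
      ring
    · field_simp
      ring
  have key : ∀ k, y k ≤ ENNReal.ofReal (α * β ^ k * θ ^ (κ ^ k)) := by
    intro k
    induction k with
    | zero =>
      refine h0.trans (le_of_eq ?_)
      rw [pow_zero, pow_zero, Real.rpow_one, mul_one, hθ, mul_div_cancel₀ _ hα0.ne']
    | succ k ih =>
      refine (h k).trans ((ENNReal.rpow_le_rpow (mul_le_mul_right ih _) hκ0.le).trans
        (le_of_eq ?_))
      rw [← ENNReal.ofReal_mul (by positivity), ENNReal.ofReal_rpow_of_nonneg (by positivity)
        hκ0.le]
      congr 1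
      calc (A * b ^ k * (α * β ^ k * θ ^ κ ^ k)) ^ κ
          = ((A * α) * (b * β) ^ k * θ ^ κ ^ k) ^ κ := by
            congr 1
            rw [mul_pow]
            ring
        _ = (A * α) ^ κ * ((b * β) ^ κ) ^ k * θ ^ κ ^ (k + 1) := by
            rw [Real.mul_rpow (by positivity) (by positivity),
              Real.mul_rpow (by positivity) (by positivity), ← Real.rpow_mul hθ0.le,
              ← Real.rpow_natCast ((b * β)) k, ← Real.rpow_mul (by positivity), mul_comm (k : ℝ) κ,
              Real.rpow_mul (by positivity), Real.rpow_natCast, pow_succ]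
        _ = _ := by
            rw [eα, eβ]
            ring
  refine (key k).trans (ENNReal.ofReal_le_ofReal ?_)
  have hβ1 : β ≤ 1 := Real.rpow_le_one_of_one_le_of_nonpos hb
    (div_nonpos_of_nonpos_of_nonneg (by linarith) (by linarith))
  have := pow_le_one₀ (n := k) hβ0.le hβ1
  have h3 : 0 ≤ θ ^ κ ^ k := by positivity
  nlinarith [mul_nonneg hα0.le h3]

/-- By Chebyshev's inequality the set $\{f\ge l\}$ has measure at most $B(L/l)^{\tau_k}$, which
tends to $0$ for every $l>L$. -/
lemma ae_le_of_lintegral_rpow_le {X : Type*} [MeasurableSpace X] {μ : Measure X} {f : X → ℝ}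
    (hf : Measurable f) {τ : ℕ → ℝ} (hτ : Tendsto τ atTop atTop) {B L : ℝ}
    (hL : 0 < L) (h : ∀ k, ∫⁻ x, ENNReal.ofReal (f x ^ τ k) ∂μ ≤ ENNReal.ofReal (B * L ^ τ k)) :
    ∀ᵐ x ∂μ, f x ≤ L := by
  have key : ∀ l : ℝ, L < l → ∀ᵐ x ∂μ, f x < l := by
    intro l hl
    have hl0 : 0 < l := hL.trans hl
    have h1 : ∀ᶠ k in atTop, μ {x | l ≤ f x} ≤ ENNReal.ofReal (B * (L / l) ^ τ k) := by
      filter_upwards [hτ.eventually_ge_atTop 0] with k hk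
      have e1 := mul_meas_ge_le_lintegral (μ := μ)
        ((hf.pow_const (τ k)).ennreal_ofReal) (ENNReal.ofReal (l ^ τ k))
      have e2 : {x | l ≤ f x} ⊆ {x | ENNReal.ofReal (l ^ τ k) ≤ ENNReal.ofReal (f x ^ τ k)} :=
        fun x hx => ENNReal.ofReal_le_ofReal (Real.rpow_le_rpow hl0.le hx hk)
      have e3 := (mul_le_mul_right (measure_mono e2) (ENNReal.ofReal (l ^ τ k))).trans
        (e1.trans (h k))
      have hlk : 0 < l ^ τ k := by positivity
      rw [mul_comm, ← ENNReal.le_div_iff_mul_le (Or.inl (by simpa using hlk))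
        (Or.inl ENNReal.ofReal_ne_top), ← ENNReal.ofReal_div_of_pos hlk] at e3
      rwa [Real.div_rpow hL.le hl0.le, ← mul_div_assoc]
    have h2 : Tendsto (fun k => ENNReal.ofReal (B * (L / l) ^ τ k)) atTop (𝓝 0) := by
      have := (tendsto_rpow_atTop_of_base_lt_one (L / l)
        (by linarith [div_pos hL hl0]) ((div_lt_one hl0).2 hl)).comp hτ
      simpa using ENNReal.tendsto_ofReal (this.const_mul B)
    have h3 : μ {x | l ≤ f x} = 0 := le_antisymm (ge_of_tendsto h2 h1) zero_le
    simpa [ae_iff] using h3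
  have h2 : ∀ᵐ x ∂μ, ∀ j : ℕ, f x < L + 1 / ((j : ℝ) + 1) :=
    ae_all_iff.2 fun j => key _ (lt_add_of_pos_right _ (by positivity))
  filter_upwards [h2] with x hx
  have hlim : Tendsto (fun j : ℕ => L + 1 / ((j : ℝ) + 1)) atTop (𝓝 L) := by
    simpa using (tendsto_one_div_add_atTop_nhds_zero_nat (𝕜 := ℝ)).const_add L
  exact ge_of_tendsto' hlim fun j => (hx j).le


/-! ### Moser's iteration and the final estimate. -/

lemma two_le_critical_exponent {n : ℕ} {p : ℝ} (hp : 1 < p) (hpn : p ≤ 2 * n / (n + 2)) :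
    2 ≤ n * (2 - p) / p := by
  have hn : (0 : ℝ) < (n : ℝ) + 2 := by positivity
  rw [le_div_iff₀ hn] at hpn
  rw [le_div_iff₀ (by linarith)]
  linarith

lemma iterConst_div_sq {A₀ R b κ : ℝ} (hA : 0 < A₀) (hR : 0 < R) :
    iterConst (A₀ / R ^ 2) b κ = iterConst A₀ b κ * R ^ (2 * (κ / (κ - 1))) := by
  have e : (A₀ / R ^ 2) ^ (-κ / (κ - 1)) = A₀ ^ (-κ / (κ - 1)) * R ^ (2 * (κ / (κ - 1))) := by
    rw [Real.div_rpow hA.le (by positivity), ← Real.rpow_two, ← Real.rpow_mul hR.le,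
      show 2 * (-κ / (κ - 1)) = -(2 * (κ / (κ - 1))) by ring, Real.rpow_neg hR.le, div_inv_eq_mul]
  rw [iterConst, e, iterConst, mul_assoc]

/-- Moser's iteration: a gain of integrability on all pairs of concentric cylinders bounds the
function on the smaller cylinder. -/
lemma ae_abs_le_of_gain {n : ℕ} {p s C R : ℝ} {u : Eucl n × ℝ → ℝ} {x₀ : Eucl n} {t₀ X : ℝ}
    (hp : 1 < p) (hp2 : p < 2) (hn : 0 < n) (hu : Measurable u) (hC : 0 < C) (hR : 0 < R)
    (hX : 0 < X) (hsc : 2 ≤ n * (2 - p) / p) (hs : n * (2 - p) / p < s)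
    (hgain : ∀ ρ₁ ρ₂ σ, 0 < ρ₂ → ρ₂ < ρ₁ → ρ₁ ≤ R → 2 ≤ σ →
      levelInt u x₀ t₀ ρ₂ ((1 + p / n) * σ - (2 - p)) ≤
        (ENNReal.ofReal (C * σ ^ 2 / (ρ₁ - ρ₂) ^ 2) * levelInt u x₀ t₀ ρ₁ σ) ^ (1 + p / n))
    (h0 : levelInt u x₀ t₀ R s ≤ ENNReal.ofReal X) :
    ∀ᵐ y ∂(volume.restrict (cylinder (R / 2) x₀ t₀)), |u y| ≤
      (X / iterConst (16 * C * s ^ 2 / R ^ 2) (4 * (1 + p / n) ^ 2) (1 + p / n)) ^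
        (1 / (s - n * (2 - p) / p)) := by
  have hn0 : (0 : ℝ) < n := by exact_mod_cast hn
  have hp0 : 0 < p := by linarith
  set κ := 1 + p / n with hκ
  have hκ1 : 1 < κ := by
    have : 0 < p / n := by positivity
    linarith
  set S := n * (2 - p) / p with hS
  have hsS : 0 < s - S := sub_pos.2 hs
  have hs0 : 0 < s := by linarith
  -- Obtained from $C\sigma_k^2/(\rho_k-\rho_{k+1})^2$ with $\sigma_k\le s\kappa^k$ and
  -- $\rho_k-\rho_{k+1}=\frac R4 2^{-k}$. The remaining factor is $(4\kappa^2)^k$.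
  set A := 16 * C * s ^ 2 / R ^ 2 with hA
  have hA0 : 0 < A := by positivity
  have hb : 1 ≤ 4 * κ ^ 2 := by nlinarith
  have hα := iterConst_pos (κ := κ) hA0 (by linarith : 0 < 4 * κ ^ 2)
  set α := iterConst A (4 * κ ^ 2) κ
  set ρ : ℕ → ℝ := fun k => R / 2 * (1 + (1 / 2) ^ k) with hρ
  -- The orbit of $s$ under $\sigma\mapsto\kappa\sigma-(2-p)$, written around its fixed point $S$.
  set σ : ℕ → ℝ := fun k => S + κ ^ k * (s - S) with hσ
  have hκk : ∀ k : ℕ, 1 ≤ κ ^ k := fun k => one_le_pow₀ hκ1.le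
  have hσ0 : ∀ k, 2 ≤ σ k := fun k => by
    have := mul_nonneg (zero_le_one.trans (hκk k)) hsS.le
    simp only [hσ]
    linarith
  have hσs : ∀ k, σ k ≤ s * κ ^ k := fun k => by
    have := mul_le_mul_of_nonneg_left (hκk k) (by linarith : 0 ≤ S)
    simp only [hσ]
    linarith
  have hσ1 : ∀ k, κ * σ k - (2 - p) = σ (k + 1) := fun k => by
    have : κ * S - (2 - p) = S := by
      rw [hκ, hS]
      field_simp
      ring
    simp only [hσ, pow_succ]
    linarith
  have hρk : ∀ k, R / 2 ≤ ρ k := fun k => by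
    have : 0 < R / 2 * (1 / 2) ^ k := by positivity
    simp only [hρ]
    linarith
  have hρR : ∀ k, ρ k ≤ R := fun k => by
    have : ((1 : ℝ) / 2) ^ k ≤ 1 := pow_le_one₀ (by norm_num) (by norm_num)
    simp only [hρ]
    nlinarith
  have hρd : ∀ k, ρ k - ρ (k + 1) = R / 4 * (1 / 2) ^ k := fun k => by
    simp only [hρ, pow_succ]
    ring
  have hstep : ∀ k, levelInt u x₀ t₀ (ρ (k + 1)) (σ (k + 1)) ≤
      (ENNReal.ofReal (A * (4 * κ ^ 2) ^ k) * levelInt u x₀ t₀ (ρ k) (σ k)) ^ κ := by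
    intro k
    have hd : 0 < ρ k - ρ (k + 1) := by
      rw [hρd]
      positivity
    have h1 := hgain (ρ k) (ρ (k + 1)) (σ k) ((half_pos hR).trans_le (hρk _))
      (sub_pos.1 hd) (hρR k) (hσ0 k)
    rw [hσ1] at h1
    refine h1.trans (ENNReal.rpow_le_rpow (mul_le_mul_left (ENNReal.ofReal_le_ofReal ?_) _)
      (by linarith))
    have e1 : A * (4 * κ ^ 2) ^ k = C * (s * κ ^ k) ^ 2 / (R / 4 * (1 / 2) ^ k) ^ 2 := by
      have e3 : (4 : ℝ) ^ k = (2 ^ k) ^ 2 := by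
        rw [← pow_mul, mul_comm, pow_mul]
        norm_num
      have e4 : (κ ^ 2) ^ k = (κ ^ k) ^ 2 := by rw [← pow_mul, mul_comm, pow_mul]
      rw [hA, one_div, inv_pow, mul_pow 4, e3, e4]
      field_simp
      ring
    rw [e1, hρd]
    have := hσs k
    have := (hσ0 k)
    gcongr
  have hiter := le_of_superlinear_iteration (y := fun k => levelInt u x₀ t₀ (ρ k) (σ k)) hA0 hb hκ1
    hX (by
      have e1 : ρ 0 = R := by simp only [hρ, pow_zero]; ring
      have e2 : σ 0 = s := by simp only [hσ, pow_zero]; ring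
      simpa only [e1, e2] using h0) hstep
  set θ := X / α with hθ
  have hθ0 : 0 < θ := by positivity
  set L := θ ^ (1 / (s - S)) with hL
  have hL0 : 0 < L := by positivity
  have hτ : Tendsto (fun k => σ k / 2) atTop atTop :=
    (tendsto_atTop_add_const_left _ _ ((tendsto_pow_atTop_atTop_of_one_lt hκ1).atTop_mul_const
      hsS)).atTop_div_const two_pos
  -- Since $\kappa^k=(\sigma_k-S)/(s-S)$, the iterated bound $\alpha\theta^{\kappa^k}$ equals
  -- $B\,(L^2)^{\sigma_k/2}$ with $B=\alpha\theta^{-S/(s-S)}$ independent of $k$.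
  have hfin := ae_le_of_lintegral_rpow_le (μ := volume.restrict (cylinder (R / 2) x₀ t₀))
    (f := fun y => 1 + u y ^ 2) ((hu.pow_const 2).const_add 1) hτ
    (B := α * θ ^ (-(S / (s - S)))) (L := L ^ 2) (by positivity) fun k => by
      refine le_trans (le_trans (lintegral_mono_set (prod_mono (Metric.ball_subset_ball (hρk k))
        (Ioc_subset_Ioc_left ?_))) (hiter k)) (ENNReal.ofReal_le_ofReal (le_of_eq ?_))
      · have := hρk k
        nlinarith
      · have e : (L ^ 2) ^ (σ k / 2) = θ ^ (σ k / (s - S)) := by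
          rw [← Real.rpow_natCast L 2, ← Real.rpow_mul hL0.le, hL, ← Real.rpow_mul hθ0.le]
          congr 1
          push_cast
          ring
        rw [e, mul_assoc, ← Real.rpow_add hθ0]
        change α * θ ^ (κ ^ k) = _
        congr 2
        simp only [hσ]
        field_simp
        ring
  filter_upwards [hfin] with y hy
  exact abs_le_of_sq_le_sq (by linarith) hL0.le

lemma volume_real_cylinder {n : ℕ} (x₀ : Eucl n) (t₀ : ℝ) {R : ℝ} (hR : 0 < R) :
    volume.real (cylinder R x₀ t₀) = volume.real (Metric.ball (0 : Eucl n) 1) * R ^ (n + 2) := by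
  rw [cylinder, Measure.volume_eq_prod, measureReal_prod_prod, measureReal_def,
    measureReal_def, Measure.addHaar_ball_of_pos _ _ hR, Real.volume_Ioc, measureReal_def,
    ENNReal.toReal_mul, ENNReal.toReal_ofReal (by positivity),
    ENNReal.toReal_ofReal (by nlinarith), finrank_euclideanSpace_fin]
  ring

lemma one_add_sq_rpow_half_le_abs_add_one {s : ℝ} (hs : 0 ≤ s) (r : ℝ) :
    (1 + r ^ 2) ^ (s / 2) ≤ (|r| + 1) ^ s := by
  have h : 1 + r ^ 2 ≤ (|r| + 1) ^ 2 := by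
    nlinarith [abs_nonneg r, sq_abs r]
  refine (Real.rpow_le_rpow (by positivity) h (by positivity)).trans (le_of_eq ?_)
  rw [← Real.rpow_natCast, ← Real.rpow_mul (by positivity)]
  congr 1
  push_cast
  ring


section
variable {n : ℕ} {Ω : Set (Eucl n)} {T R t₀ s : ℝ} {x₀ : Eucl n} {u : Eucl n × ℝ → ℝ}

lemma closure_cylinder (hR : 0 < R) :
    closure (cylinder R x₀ t₀) = Metric.closedBall x₀ R ×ˢ Icc (t₀ - R ^ 2) t₀ := by
  rw [cylinder, closure_prod_eq, closure_ball _ hR.ne', closure_Ioc (by nlinarith)]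

lemma isCompact_closure_cylinder (hR : 0 < R) : IsCompact (closure (cylinder R x₀ t₀)) := by
  rw [closure_cylinder hR]
  exact (isCompact_closedBall _ _).prod isCompact_Icc

lemma isFiniteMeasure_restrict_cylinder (hR : 0 < R) :
    IsFiniteMeasure (volume.restrict (cylinder R x₀ t₀)) :=
  isFiniteMeasure_restrict.2 ((measure_mono subset_closure).trans_lt
    (isCompact_closure_cylinder hR).measure_lt_top).ne

lemma of_closure_cylinder_subset (hR : 0 < R)
    (h : closure (cylinder R x₀ t₀) ⊆ spaceTime Ω T) :
    Metric.closedBall x₀ R ⊆ Ω ∧ 0 < t₀ - R ^ 2 ∧ t₀ < T := by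
  rw [closure_cylinder hR] at h
  have h0 : t₀ - R ^ 2 ≤ t₀ := by nlinarith
  have hx := Metric.mem_closedBall_self (x := x₀) hR.le
  exact ⟨fun x hx => (h (mk_mem_prod hx (right_mem_Icc.2 h0))).1,
    (h (mk_mem_prod hx (left_mem_Icc.2 h0))).2.1, (h (mk_mem_prod hx (right_mem_Icc.2 h0))).2.2⟩

lemma MemLpLoc.integrableOn_cylinder (hus : MemLpLoc u s (spaceTime Ω T)) (hs0 : 0 < s)
    (hR : 0 < R) (hcl : closure (cylinder R x₀ t₀) ⊆ spaceTime Ω T) :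
    IntegrableOn (fun y => (|u y| + 1) ^ s) (cylinder R x₀ t₀) := by
  have := isFiniteMeasure_restrict_cylinder (x₀ := x₀) (t₀ := t₀) hR
  have h1 : MemLp u (ENNReal.ofReal s) (volume.restrict (cylinder R x₀ t₀)) :=
    (hus _ hcl (isCompact_closure_cylinder hR)).mono_measure
      (Measure.restrict_mono_set _ subset_closure)
  have h2 := (h1.norm.add (memLp_const (1 : ℝ))).integrable_norm_rpow (by simpa using hs0)
    ENNReal.ofReal_ne_top
  rw [ENNReal.toReal_ofReal hs0.le] at h2
  refine h2.congr (Eventually.of_forall fun y => ?_)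
  simp only [Pi.add_apply, Real.norm_eq_abs]
  rw [abs_of_nonneg (by positivity : 0 ≤ |u y| + 1)]

lemma one_le_average_cylinder (hs0 : 0 ≤ s) (hR : 0 < R)
    (hint : IntegrableOn (fun y => (|u y| + 1) ^ s) (cylinder R x₀ t₀)) :
    1 ≤ ⨍ y in cylinder R x₀ t₀, (|u y| + 1) ^ s := by
  have := isFiniteMeasure_restrict_cylinder (x₀ := x₀) (t₀ := t₀) hR
  have hv : 0 < volume.real (cylinder R x₀ t₀) := by
    rw [volume_real_cylinder x₀ t₀ hR]
    have : 0 < volume.real (Metric.ball (0 : Eucl n) 1) :=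
      ENNReal.toReal_pos (Metric.measure_ball_pos _ _ one_pos).ne' measure_ball_lt_top.ne
    positivity
  rw [setAverage_eq, smul_eq_mul, ← div_eq_inv_mul, one_le_div hv]
  have h1 : ∫ y in cylinder R x₀ t₀, (1 : ℝ) = volume.real (cylinder R x₀ t₀) := by simp
  rw [← h1]
  refine integral_mono (integrable_const _) hint fun y => ?_
  exact Real.one_le_rpow (by linarith [abs_nonneg (u y)]) hs0

end

/-- The threshold scales like $R^{2\kappa/(\kappa-1)}=R^{s_{\mathrm c}+n+2}$. The part $R^{n+2}$
cancels the volume of the cylinder and leaves $R^{-s_{\mathrm c}}$ in front of the mean value. -/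
lemma iteration_value_eq {n : ℕ} {p R J w A₀ : ℝ} (hp : 0 < p) (hn : 0 < n) (hR : 0 < R)
    (hA : 0 < A₀) (b : ℝ) :
    w * R ^ (n + 2) * J / iterConst (A₀ / R ^ 2) b (1 + p / n) =
      w / iterConst A₀ b (1 + p / n) * (R ^ (-(n * (2 - p) / p)) * J) := by
  have hn0 : (0 : ℝ) < n := by exact_mod_cast hn
  have hκ2 : 2 * ((1 + p / n) / (1 + p / n - 1)) = n * (2 - p) / p + (n + 2 : ℕ) := by
    rw [add_sub_cancel_left]
    push_cast
    field_simp
    ring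
  rw [iterConst_div_sq hA hR, hκ2, Real.rpow_add hR, Real.rpow_natCast, Real.rpow_neg hR.le]
  have h1 : R ^ (n + 2) ≠ 0 := by positivity
  rw [mul_right_comm w, ← mul_assoc (iterConst A₀ b (1 + p / n)), mul_div_mul_right _ _ h1,
    div_mul_eq_mul_div, div_mul_eq_div_div_swap, mul_div_assoc, mul_div_assoc, inv_mul_eq_div,
    mul_div_assoc]
  ring

theorem eLpNorm_top_le_of_isWeakSolution (n : ℕ) (hn : 3 ≤ n) (p s lam Lam K : ℝ) [Fact (1 ≤ ENNReal.ofReal p)]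
    (hp : 1 < p) (hpn : p ≤ 2 * n / (n + 2)) (hs : n * (2 - p) / p < s)
    (hlam : 0 < lam) (hLam : lam ≤ Lam) (hK : 0 < K) :
    ∃ C : ℝ, 0 < C ∧
      ∀ (E₁ Ep : Eucl n → ℝ), IsDensityPair p lam Lam E₁ Ep →
      (∀ z, ∀ ζ ∈ subdifferential E₁ z, ‖ζ‖ ≤ K) →
      ∀ (Ω : Set (Eucl n)), IsOpen Ω → Bornology.IsBounded Ω → ∀ T : ℝ, 0 < T →
      ∀ u : Eucl n × ℝ → ℝ, IsWeakSolution Ω p T E₁ Ep u → MemLpLoc u s (spaceTime Ω T) →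
      ∀ (x₀ : Eucl n) (t₀ R : ℝ), 0 < R → R < 1 →
        closure (cylinder R x₀ t₀) ⊆ spaceTime Ω T →
        eLpNorm u ⊤ (volume.restrict (cylinder (R / 2) x₀ t₀)) ≤
          ENNReal.ofReal (C * (R ^ (-(n * (2 - p) / p)) *
            ⨍ y in cylinder R x₀ t₀, (|u y| + 1) ^ s) ^ (1 / (s - n * (2 - p) / p))) := by
  have hn3 : (3 : ℝ) ≤ n := by exact_mod_cast hn
  have hn0 : (0 : ℝ) < n := by linarith
  have hp0 : 0 < p := by linarith
  have hp2 : p < 2 := hpn.trans_lt (by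
    rw [div_lt_iff₀ (by positivity)]
    linarith)
  have hsc := two_le_critical_exponent hp hpn
  have hsS : 0 < s - n * (2 - p) / p := sub_pos.2 hs
  have hs0 : 0 < s := by linarith
  obtain ⟨C₁, hC₁, hgain⟩ := exists_gain_const n p lam Lam K hp hp2 (by linarith) hlam hLam hK.le
  have hA : 0 < 16 * C₁ * s ^ 2 := by positivity
  have hb : 0 < 4 * (1 + p / n) ^ 2 := by positivity
  set w := volume.real (Metric.ball (0 : Eucl n) 1) with hw
  have hw0 : 0 < w := ENNReal.toReal_pos (Metric.measure_ball_pos _ _ one_pos).ne'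
    measure_ball_lt_top.ne
  set α := iterConst (16 * C₁ * s ^ 2) (4 * (1 + p / n) ^ 2) (1 + p / n) with hα
  have hα0 : 0 < α := iterConst_pos hA hb
  -- Here $w$ is the volume of the unit ball and $\alpha$ the threshold at scale $R=1$; both are
  -- fixed before the densities, the domain and the solution.
  refine ⟨(w / α) ^ (1 / (s - n * (2 - p) / p)), by positivity, ?_⟩
  intro E₁ Ep hE hKb Ω hΩ hΩb T hT u hu hus x₀ t₀ R hR hR1 hcl
  obtain ⟨u', U, c, D, A, hu', d⟩ := hu.exists_weakData hE hKb hp hΩ hΩb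
  obtain ⟨hB, ht1, ht0⟩ := of_closure_cylinder_subset hR hcl
  have hsub : cylinder R x₀ t₀ ⊆ spaceTime Ω T := subset_closure.trans hcl
  have hint := hus.integrableOn_cylinder hs0 hR hcl
  have hJ1 := one_le_average_cylinder hs0.le hR hint
  set J := ⨍ y in cylinder R x₀ t₀, (|u y| + 1) ^ s with hJ
  have hJ0 : 0 < J := one_pos.trans_le hJ1
  have hJX : ∫ y in cylinder R x₀ t₀, (|u y| + 1) ^ s = w * R ^ (n + 2) * J := by
    rw [hJ, setAverage_eq, smul_eq_mul, volume_real_cylinder x₀ t₀ hR,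
      mul_inv_cancel_left₀ (by positivity)]
  have hlev : levelInt u' x₀ t₀ R s ≤ ENNReal.ofReal (w * R ^ (n + 2) * J) := by
    rw [← hJX, ofReal_integral_eq_lintegral_ofReal hint (Eventually.of_forall fun y =>
      Real.rpow_nonneg (by positivity) s)]
    refine lintegral_mono_ae ?_
    filter_upwards [ae_restrict_of_ae_restrict_of_subset hsub hu'] with y hy
    rw [hy]
    exact ENNReal.ofReal_le_ofReal (one_add_sq_rpow_half_le_abs_add_one hs0.le _)
  have hbd := ae_abs_le_of_gain hp hp2 (by omega) d.measurable_u.measurable hC₁ hR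
    (by positivity : 0 < w * R ^ (n + 2) * J) hsc hs
    (fun ρ₁ ρ₂ σ h1 h2 h3 h4 => hgain E₁ Ep hE hKb Ω T u' U c D A d x₀ t₀ ρ₁ ρ₂ σ h1 h2
      (h3.trans hR1.le) ((Metric.closedBall_subset_closedBall h3).trans hB)
      (ht1.trans_le (sub_le_sub_left (pow_le_pow_left₀ (h1.trans h2).le h3 2) _)) ht0 h4)
    hlev
  have hsub2 : cylinder (R / 2) x₀ t₀ ⊆ spaceTime Ω T :=
    (Set.prod_mono (Metric.ball_subset_ball (half_le_self hR.le))
      (Ioc_subset_Ioc_left (by nlinarith))).trans hsub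
  rw [iteration_value_eq hp0 (by omega) hR hA, Real.mul_rpow (by positivity) (by positivity)]
    at hbd
  rw [eLpNorm_exponent_top]
  refine eLpNormEssSup_le_of_ae_bound ?_
  filter_upwards [hbd, ae_restrict_of_ae_restrict_of_subset hsub2 hu'] with y h1 h2
  rwa [← h2]

end OnePLaplace

end

theorem mainTheorem3 (n : ℕ) (hn : 3 ≤ n) (p s lam Lam K : ℝ) [Fact (1 ≤ ENNReal.ofReal p)]
    (hp : 1 < p) (hpn : p ≤ 2 * n / (n + 2)) (hs : n * (2 - p) / p < s)
    (hlam : 0 < lam) (hLam : lam ≤ Lam) (hK : 0 < K) :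
    ∃ C : ℝ, 0 < C ∧
      ∀ (E₁ Ep : Eucl n → ℝ), IsDensityPair p lam Lam E₁ Ep →
      (∀ z, ∀ ζ ∈ subdifferential E₁ z, ‖ζ‖ ≤ K) →
      ∀ (Ω : Set (Eucl n)), IsOpen Ω → Bornology.IsBounded Ω → ∀ T : ℝ, 0 < T →
      ∀ u : Eucl n × ℝ → ℝ, IsWeakSolution Ω p T E₁ Ep u → MemLpLoc u s (spaceTime Ω T) →
      ∀ (x₀ : Eucl n) (t₀ R : ℝ), 0 < R → R < 1 →
        closure (cylinder R x₀ t₀) ⊆ spaceTime Ω T →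
        eLpNorm u ⊤ (volume.restrict (cylinder (R / 2) x₀ t₀)) ≤
          ENNReal.ofReal (C * (R ^ (-(n * (2 - p) / p)) *
            ⨍ y in cylinder R x₀ t₀, (|u y| + 1) ^ s) ^ (1 / (s - n * (2 - p) / p))) :=
  eLpNorm_top_le_of_isWeakSolution n hn p s lam Lam K hp hpn hs hlam hLam hK
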